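/- Let $d\ge 1$ and let $V(z,\omega)$, $z\in\mathbb Z^d$, be i.i.d. random variables with values in $[0,\infty]$ on a probability space $(\Omega,\mathcal F,\mathbb P)$ such that $\mathbb P(V(0)=0)<1$ and $\operatorname{ess\,inf} V(0)=0$; if $d=1$, assume in addition that $\mathbb P(V(0)\in(0,\infty))>0$. Let $P^x$, with expectation $E^x$, be the law of the simple symmetric random walk $(S_n)_{n\ge0}$ on $\mathbb Z^d$ started at $x$, let $\tau_y=\inf\{n\ge0:S_n=y\}$, and let $\|\cdot\|$ be the Euclidean norm. For a potential $W:\mathbb Z^d\times\Omega\to[0,\infty]$ put $$Z_{y}(W)=\mathbb E\,E^0\Big(\mathbf 1_{\{\tau_y<\infty\}}e^{-\sum_{n=0}^{\tau_y-1}W(S_n,\omega)}\Big),\qquad y\in\mathbb Z^d ,$$ and let $Q_y$ be the annealed path measure of $V$, $$Q_y(A)=Z_y(V)^{-1}\,\mathbb E\,E^0\Big(\mathbf 1_{\{\tau_y<\infty\}}\mathbf 1_A\,e^{-\sum_{n=0}^{\tau_y-1}V(S_n,\omega)}\Big).$$ Then for every $\lambda\ge0$ and $h\in\mathbb R^d$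 the annealed Lyapunov exponent $$\beta_{\lambda+V}(h)=-\lim_{r\to\infty}\frac1r\log Z_{[rh]}(\lambda+V)$$ exists as a finite limit ($[\cdot]$ is the coordinatewise integer part). There is a constant $C\in(0,\infty)$ such that $$\limsup_{\|y\|\to\infty}\frac{E_{Q_y}(\tau_y)}{\|y\|}\le C ,$$ and for every such constant $C$ and every unit vector $s\in\mathbb R^d$ the right derivative of $\lambda\mapsto\beta_{\lambda+V}(s)$ at $\lambda=0$ exists, is finite, and satisfies $$\frac{d\beta_{\lambda+V}(s)}{d\lambda}\Big|_{\lambda=0+}\le C .$$ -/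

import Mathlib

open MeasureTheory ProbabilityTheory Filter Topology
open scoped ENNReal

noncomputable section

namespace AnnealedWalk

variable {d : ℕ}

/-- The nearest-neighbour step encoded by `(i, b)`: `e_i` if `b` is true, `-e_i` otherwise. -/
def unitStep (p : Fin d × Bool) : Fin d → ℤ :=
  if p.2 then Pi.single p.1 1 else -Pi.single p.1 1

/-- The path started at `x` with the given sequence of steps. -/
def walkPath (x : Fin d → ℤ) (ξ : ℕ → Fin d × Bool) (n : ℕ) : Fin d → ℤ :=
  x + ∑ k ∈ Finset.range n, unitStep (ξ k)

/-- The law `P^x`, on path space, of simple symmetric random walk on `ℤ^d` started at `x`: the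
steps are independent and uniform on the `2d` unit vectors `± e_i`. -/
def srw [NeZero d] (x : Fin d → ℤ) : Measure (ℕ → Fin d → ℤ) :=
  (Measure.infinitePi fun _ : ℕ => (PMF.uniformOfFintype (Fin d × Bool)).toMeasure).map
    (walkPath x)

/-- The hitting time `τ_y = inf {n ≥ 0 : S_n = y}`, equal to `⊤` if `y` is never hit. -/
def hitTime (y : Fin d → ℤ) (S : ℕ → Fin d → ℤ) : ℕ∞ :=
  ⨅ (n : ℕ) (_ : S n = y), (n : ℕ∞)

open Classical in
/-- `1_{τ_y < ∞} exp (-∑_{n < τ_y} v (S_n))` for a fixed potential `v`, where `exp (-∞) = 0`. -/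
def pathWeight (v : (Fin d → ℤ) → ℝ≥0∞) (y : Fin d → ℤ) (S : ℕ → Fin d → ℤ) : ℝ≥0∞ :=
  if hitTime y S < ⊤ then
    EReal.exp (-((∑ n ∈ Finset.range (hitTime y S).toNat, v (S n) : ℝ≥0∞) : EReal))
  else 0

variable [NeZero d] {Ω : Type*} [MeasurableSpace Ω]

/-- The quenched partition function `Z^{ω,x}_y` of a fixed potential `v = V(·, ω)`. -/
def quenchedZ (v : (Fin d → ℤ) → ℝ≥0∞) (x y : Fin d → ℤ) : ℝ≥0∞ :=
  ∫⁻ S, pathWeight v y S ∂(srw x)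

/-- The annealed partition function `Z^x_y = 𝔼 Z^{ω,x}_y`. -/
def annealedZ (μ : Measure Ω) (V : (Fin d → ℤ) → Ω → ℝ≥0∞) (x y : Fin d → ℤ) : ℝ≥0∞ :=
  ∫⁻ ω, quenchedZ (fun z => V z ω) x y ∂μ

/-- The annealed path measure
`Q^x_y (A) = (Z^x_y)⁻¹ 𝔼 E^x (1_{τ_y < ∞} 1_A exp (-∑_{n < τ_y} V (S_n, ω)))`. -/
def annealedQ (μ : Measure Ω) (V : (Fin d → ℤ) → Ω → ℝ≥0∞) (x y : Fin d → ℤ) :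
    Measure (ℕ → Fin d → ℤ) :=
  (annealedZ μ V x y)⁻¹ •
    ((μ.prod (srw x)).withDensity fun p => pathWeight (fun z => V z p.1) y p.2).map Prod.snd

/-- The expected crossing time `E_{Q^0_y} (τ_y)`. -/
def meanCrossingTime (μ : Measure Ω) (V : (Fin d → ℤ) → Ω → ℝ≥0∞) (y : Fin d → ℤ) : ℝ≥0∞ :=
  ∫⁻ S, (hitTime y S : ℝ≥0∞) ∂(annealedQ μ V 0 y)

/-- The Euclidean norm of a lattice point. -/
def latticeNorm {d : ℕ} (y : Fin d → ℤ) : ℝ :=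
  ‖(WithLp.toLp 2 fun i => (y i : ℝ) : EuclideanSpace ℝ (Fin d))‖

/-- `limsup_{‖y‖ → ∞} E_{Q^0_y} (τ_y) / ‖y‖`, as an element of `[0, ∞]`. -/
def limsupCrossingTime (μ : Measure Ω) (V : (Fin d → ℤ) → Ω → ℝ≥0∞) : ℝ≥0∞ :=
  limsup (fun y : Fin d → ℤ => meanCrossingTime μ V y / ENNReal.ofReal (latticeNorm y))
    (comap latticeNorm atTop)

/-- The coordinatewise integer part `[h]` of a vector `h`. -/
def intPart {d : ℕ} (h : EuclideanSpace ℝ (Fin d)) : Fin d → ℤ := fun i => ⌊h i⌋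

/-- `-(1/r) log Z^0_{[r h]}`. -/
def decayRate (μ : Measure Ω) (V : (Fin d → ℤ) → Ω → ℝ≥0∞) (h : EuclideanSpace ℝ (Fin d))
    (r : ℝ) : ℝ :=
  -(1 / r) * Real.log (annealedZ μ V 0 (intPart (r • h))).toReal

/-- The annealed Lyapunov exponent `β_V (h) = -lim_{r → ∞} (1/r) log Z^0_{[r h]}`. -/
def lyapunov (μ : Measure Ω) (V : (Fin d → ℤ) → Ω → ℝ≥0∞) (h : EuclideanSpace ℝ (Fin d)) : ℝ :=
  limUnder atTop (decayRate μ V h)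

/-- The potential `t + V`, used for `t ≥ 0`. -/
def shiftPotential {d : ℕ} {Ω : Type*} (t : ℝ) (V : (Fin d → ℤ) → Ω → ℝ≥0∞) :
    (Fin d → ℤ) → Ω → ℝ≥0∞ :=
  fun z ω => ENNReal.ofReal t + V z ω

end AnnealedWalk

end

/-!
Lyapunov exponents exist by subadditivity: `exp (-∑ V (S n))` is a product of powers of the
independent variables `exp (-V z)`, and powers of one variable are positively correlated, so
`Z_{x+y} ≥ Z_x Z_y`.

Let `c_n (y)` be the annealed weight of the paths which hit `y` at time `n`, so that
`Z_y (t + V) = ∑ n, exp (-t n) c_n (y)`. By Hölder's inequality its logarithm is convex in `t`,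
hence the Lyapunov exponent is concave in `t` and has a right derivative at `0`, the supremum of
the slopes from `0`. By Jensen's inequality `log Z_y (V) - log Z_y (t + V) ≤ t E_{Q_y} (τ_y)`,
which bounds these slopes by `limsup E_{Q_y} (τ_y) / ‖y‖`.

It remains to see that `E_{Q_y} (τ_y) = O(‖y‖)`. Each new site on a path costs at least a factor
`φ = 𝔼 exp (-V 0) < 1`, so `E_{Q_y} (φ ^ (-N)) ≤ 1 / Z_y` for the number `N` of visited sites, and
`E_{Q_y} (N) = O(‖y‖)` by Jensen's inequality. The expected time spent near a site is at most a
constant times the probability of a visit there: a walk which stays long in a box must find no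
obstacle in it, that is, no site where `V ≥ v₀` for a small constant `v₀ > 0`. For `d ≥ 2` a box of
radius `k` is obstacle-free with probability exponentially small in the number of its sites, while
crossing it along a shortest path costs only a factor exponential in `k`. For `d = 1` the interval
of length `m` is obstacle-free with probability `P(V 0 < v₀) ^ m`, while crossing it has annealed
weight at least `c ρ ^ m` for some `ρ > P(V 0 = 0)`, by comparison with a renewal process, and
`v₀` is chosen so small that `P(V 0 < v₀) < ρ`.
-/

noncomputable section

namespace AnnealedWalk

variable {d : ℕ}

/-- `exp (-a)` for `a ∈ [0, ∞]`, the survival probability of a visit to a site of potential `a`;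
`exp (-∞) = 0`. -/
def expNeg (a : ℝ≥0∞) : ℝ≥0∞ := EReal.exp (-(a : EReal))

lemma expNeg_zero : expNeg 0 = 1 := by simp [expNeg]

lemma expNeg_top : expNeg ⊤ = 0 := by simp [expNeg]

lemma expNeg_add (a b : ℝ≥0∞) : expNeg (a + b) = expNeg a * expNeg b := by
  unfold expNeg
  rw [← EReal.exp_add, EReal.coe_ennreal_add, EReal.neg_add, sub_eq_add_neg] <;> simp

lemma expNeg_antitone : Antitone expNeg := fun _ _ h =>
  EReal.exp_monotone (EReal.neg_le_neg_iff.2 (by exact_mod_cast h))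

lemma expNeg_le_one (a : ℝ≥0∞) : expNeg a ≤ 1 :=
  expNeg_zero ▸ expNeg_antitone zero_le

lemma expNeg_ne_top (a : ℝ≥0∞) : expNeg a ≠ ⊤ :=
  ne_top_of_le_ne_top ENNReal.one_ne_top (expNeg_le_one a)

lemma expNeg_lt_one {a : ℝ≥0∞} (h : a ≠ 0) : expNeg a < 1 := by
  rw [expNeg, EReal.exp_lt_one_iff, EReal.neg_lt_comm, neg_zero]
  exact_mod_cast pos_iff_ne_zero.2 h

lemma expNeg_pos {a : ℝ≥0∞} (h : a ≠ ⊤) : 0 < expNeg a := by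
  rw [expNeg, EReal.zero_lt_exp_iff, bot_lt_iff_ne_bot, ne_eq, EReal.neg_eq_bot_iff,
    EReal.coe_ennreal_eq_top_iff]
  exact h

lemma expNeg_ofReal {t : ℝ} (ht : 0 ≤ t) :
    expNeg (ENNReal.ofReal t) = ENNReal.ofReal (Real.exp (-t)) := by
  rw [expNeg, EReal.coe_ennreal_ofReal, max_eq_left ht, ← EReal.coe_neg, EReal.exp_coe]

lemma expNeg_sum {ι : Type*} (s : Finset ι) (f : ι → ℝ≥0∞) :
    expNeg (∑ i ∈ s, f i) = ∏ i ∈ s, expNeg (f i) := by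
  classical
  induction s using Finset.induction_on with
  | empty => simp [expNeg_zero]
  | insert a s ha ih => rw [Finset.sum_insert ha, Finset.prod_insert ha, expNeg_add, ih]

lemma measurable_expNeg : Measurable expNeg := expNeg_antitone.measurable

/-! ### Killed Markov chains -/

section MarkovChain

variable {α : Type*}

/-- The transition operator of the Markov chain with transition probabilities `p`: the expectation
of `f` after one step from `x`. -/
def markovOp (p : α → PMF α) (f : α → ℝ≥0∞) (x : α) : ℝ≥0∞ := ∑' z, p x z * f z

/-- One step of the chain `p` in the potential `v`, killed outside `A`: the potential is collected
at the departure point. -/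
def killedStep (p : α → PMF α) (A : Set α) (v f : α → ℝ≥0∞) : α → ℝ≥0∞ :=
  A.indicator fun x => expNeg (v x) * markovOp p f x

/-- The Green operator of the chain `p` in the potential `v`, killed outside `A`. For `y ∉ A`, the
value of `green p A v (Pi.single y 1)` at `x` is the expected weight of the chain from `x` up to its
exit from `A`, on the event that this happens at `y`. -/
def green (p : α → PMF α) (A : Set α) (v f : α → ℝ≥0∞) (x : α) : ℝ≥0∞ :=
  ∑' n, (killedStep p A v)^[n] f x

variable {p : α → PMF α} {A B : Set α} {v f g : α → ℝ≥0∞}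

lemma markovOp_mono : Monotone (markovOp p) := fun _ _ h _ =>
  ENNReal.tsum_le_tsum fun z => mul_le_mul_right (h z) _

lemma markovOp_const_mul (c : ℝ≥0∞) (f : α → ℝ≥0∞) (x : α) :
    markovOp p (fun z => c * f z) x = c * markovOp p f x := by
  simp only [markovOp, ← ENNReal.tsum_mul_left, mul_left_comm]

lemma markovOp_add (f g : α → ℝ≥0∞) (x : α) :
    markovOp p (fun z => f z + g z) x = markovOp p f x + markovOp p g x := by
  simp only [markovOp, mul_add, ENNReal.tsum_add]

lemma markovOp_tsum {ι : Type*} (f : ι → α → ℝ≥0∞) (x : α) :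
    markovOp p (fun z => ∑' i, f i z) x = ∑' i, markovOp p (f i) x := by
  simp only [markovOp, ← ENNReal.tsum_mul_left]
  exact ENNReal.tsum_comm

lemma markovOp_const (c : ℝ≥0∞) (x : α) : markovOp p (fun _ => c) x = c := by
  rw [markovOp, ENNReal.tsum_mul_right, PMF.tsum_coe, one_mul]

lemma markovOp_one_sub_add {ψ : α → ℝ≥0∞} (hψ : ∀ x, ψ x ≤ 1) (x : α) :
    markovOp p (fun z => 1 - ψ z) x + markovOp p ψ x = 1 := by
  simp only [← markovOp_add, tsub_add_cancel_of_le (hψ _), markovOp_const]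

lemma expNeg_mul_markovOp_one_sub_add_le_one {ψ : α → ℝ≥0∞} (hψ : ∀ x, ψ x ≤ 1) {c : ℝ≥0∞}
    {x : α} (hc : c ≤ markovOp p ψ x ∨ c ≤ 1 - expNeg (v x)) :
    expNeg (v x) * markovOp p (fun z => 1 - ψ z) x + c ≤ 1 := by
  have havg := markovOp_one_sub_add (p := p) hψ x
  rcases hc with hc | hc
  · calc _ ≤ 1 * markovOp p (fun z => 1 - ψ z) x + markovOp p ψ x := by
          gcongr; exact expNeg_le_one _
      _ = 1 := by rw [one_mul, havg]
  · calc _ ≤ expNeg (v x) * 1 + (1 - expNeg (v x)) := by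
          gcongr; exact le_self_add.trans havg.le
      _ = 1 := by rw [mul_one, add_tsub_cancel_of_le (expNeg_le_one _)]

lemma killedStep_of_mem {x : α} (hx : x ∈ A) :
    killedStep p A v f x = expNeg (v x) * markovOp p f x :=
  Set.indicator_of_mem hx _

lemma killedStep_of_notMem {x : α} (hx : x ∉ A) : killedStep p A v f x = 0 :=
  Set.indicator_of_notMem hx _

lemma killedStep_le_expNeg_mul (x : α) :
    killedStep p A v f x ≤ expNeg (v x) * markovOp p f x :=
  Set.indicator_le_self' (fun _ _ => zero_le) x

lemma killedStep_mono : Monotone (killedStep p A v) := fun _ _ h _ =>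
  Set.indicator_le_indicator (mul_le_mul_right (markovOp_mono h _) _)

lemma killedStep_mono_set (h : A ⊆ B) (x : α) : killedStep p A v f x ≤ killedStep p B v f x :=
  Set.indicator_le_indicator_of_subset h (fun _ => zero_le) x

lemma killedStep_sdiff {x : α} (hx : x ∉ B) :
    killedStep p (A \ B) v f x = killedStep p A v f x := by
  by_cases hxA : x ∈ A
  · rw [killedStep_of_mem hxA, killedStep_of_mem (A := A \ B) ⟨hxA, hx⟩]
  · rw [killedStep_of_notMem hxA, killedStep_of_notMem fun h => hxA h.1]

lemma killedStep_tsum {ι : Type*} (f : ι → α → ℝ≥0∞) :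
    killedStep p A v (fun z => ∑' i, f i z) = fun z => ∑' i, killedStep p A v (f i) z := by
  ext x
  by_cases hx : x ∈ A
  · simp only [killedStep_of_mem hx, markovOp_tsum, ENNReal.tsum_mul_left]
  · simp only [killedStep_of_notMem hx, tsum_zero]

lemma killedStep_add (x : α) :
    killedStep p A v (fun z => f z + g z) x = killedStep p A v f x + killedStep p A v g x := by
  by_cases hx : x ∈ A
  · simp only [killedStep_of_mem hx, markovOp_add, mul_add]
  · simp only [killedStep_of_notMem hx, add_zero]

lemma killedStep_const_mul (c : ℝ≥0∞) :
    killedStep p A v (fun z => c * f z) = fun z => c * killedStep p A v f z := by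
  ext x
  by_cases hx : x ∈ A
  · simp only [killedStep_of_mem hx, markovOp_const_mul, mul_left_comm]
  · simp only [killedStep_of_notMem hx, mul_zero]

lemma killedStep_sum {ι : Type*} (s : Finset ι) (f : ι → α → ℝ≥0∞) (x : α) :
    killedStep p A v (fun z => ∑ i ∈ s, f i z) x = ∑ i ∈ s, killedStep p A v (f i) x := by
  simp only [← Finset.tsum_subtype, killedStep_tsum]

lemma killedStep_iterate_tsum {ι : Type*} (f : ι → α → ℝ≥0∞) (n : ℕ) :
    (killedStep p A v)^[n] (fun z => ∑' i, f i z) =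
      fun z => ∑' i, (killedStep p A v)^[n] (f i) z := by
  induction n with
  | zero => rfl
  | succ n ih => simp only [Function.iterate_succ_apply', ih, killedStep_tsum]

lemma killedStep_iterate_const_mul (c : ℝ≥0∞) (n : ℕ) :
    (killedStep p A v)^[n] (fun z => c * f z) = fun z => c * (killedStep p A v)^[n] f z := by
  induction n with
  | zero => rfl
  | succ n ih => simp only [Function.iterate_succ_apply', ih, killedStep_const_mul]

lemma green_eq (x : α) : green p A v f x = f x + killedStep p A v (green p A v f) x := by
  have hgreen : green p A v f = fun z => ∑' n, (killedStep p A v)^[n] f z := rfl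
  rw [hgreen, killedStep_tsum]
  simp only [← Function.iterate_succ_apply' (f := killedStep p A v)]
  exact tsum_eq_zero_add' ENNReal.summable

lemma green_of_notMem {x : α} (hx : x ∉ A) : green p A v f x = f x := by
  rw [green_eq, killedStep_of_notMem hx, add_zero]

lemma le_green (x : α) : f x ≤ green p A v f x :=
  green_eq (f := f) x ▸ le_self_add

lemma green_le {u : α → ℝ≥0∞} (h : ∀ x, f x + killedStep p A v u x ≤ u x) (x : α) :
    green p A v f x ≤ u x := by
  refine ENNReal.tsum_le_of_sum_range_le fun N => ?_
  induction N generalizing x with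
  | zero => exact zero_le
  | succ N ih =>
    simp only [Finset.sum_range_succ', Function.iterate_succ_apply', Function.iterate_zero, id]
    rw [← killedStep_sum, add_comm]
    exact (add_le_add le_rfl (killedStep_mono ih x)).trans (h x)

lemma green_mono_set (h : A ⊆ B) (x : α) : green p A v f x ≤ green p B v f x :=
  green_le (fun x => (add_le_add le_rfl (killedStep_mono_set h x)).trans (green_eq x).ge) x

lemma green_const_mul (c : ℝ≥0∞) (x : α) :
    green p A v (fun z => c * f z) x = c * green p A v f x := by
  simp only [green, killedStep_iterate_const_mul, ENNReal.tsum_mul_left]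

lemma green_le_of_superharmonic {u : α → ℝ≥0∞} (hfA : ∀ x ∈ A, f x = 0)
    (hfu : ∀ x ∉ A, f x ≤ u x) (hu : ∀ x ∈ A, expNeg (v x) * markovOp p u x ≤ u x) (x : α) :
    green p A v f x ≤ u x := by
  refine green_le (fun x => ?_) x
  by_cases hx : x ∈ A
  · rw [hfA x hx, zero_add, killedStep_of_mem hx]; exact hu x hx
  · rw [killedStep_of_notMem hx, add_zero]; exact hfu x hx

open Classical in
lemma green_first_entrance (A B : Set α) (v f : α → ℝ≥0∞) (x : α) :
    green p A v f x =
      green p (A \ B) v (fun z => if z ∈ B then green p A v f z else f z) x := by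
  set F : α → ℝ≥0∞ := fun z => if z ∈ B then green p A v f z else f z
  have hFB {z : α} (hz : z ∈ B) : F z = green p A v f z := if_pos hz
  have hFBc {z : α} (hz : z ∉ B) : F z = f z := if_neg hz
  have hle : ∀ x, green p (A \ B) v F x ≤ green p A v f x := by
    refine green_le fun x => ?_
    by_cases hx : x ∈ B
    · rw [killedStep_of_notMem fun h => h.2 hx, hFB hx, add_zero]
    · rw [hFBc hx, killedStep_sdiff hx, ← green_eq]
  refine le_antisymm (green_le (fun x => ?_) x) (hle x)
  by_cases hx : x ∈ B
  · rw [green_of_notMem fun h => h.2 hx, hFB hx, green_eq]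
    exact add_le_add le_rfl (killedStep_mono hle x)
  · rw [green_eq (A := A \ B), hFBc hx, killedStep_sdiff hx]

lemma green_le_last_exit (A B : Set α) (v f : α → ℝ≥0∞) (x : α) :
    green p A v f x ≤ green p (A \ B) v f x +
      green p A v (B.indicator (killedStep p A v (green p (A \ B) v f))) x := by
  refine green_le (u := fun x => green p (A \ B) v f x +
      green p A v (B.indicator (killedStep p A v (green p (A \ B) v f))) x) (fun x => ?_) x
  rw [killedStep_add]
  conv_rhs => rw [green_eq, green_eq (A := A)]
  rw [← add_assoc, ← add_assoc]
  gcongr ?_ + _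
  by_cases hx : x ∈ B
  · rw [Set.indicator_of_mem hx]; gcongr; exact le_self_add
  · rw [Set.indicator_of_notMem hx, add_zero, killedStep_sdiff hx]

variable [DecidableEq α]

lemma single_one_le_one (b x : α) : (Pi.single b 1 : α → ℝ≥0∞) x ≤ 1 := by
  rw [Pi.single_apply]; split_ifs <;> simp

lemma green_eq_tsum (x : α) :
    green p A v f x = ∑' z, f z * green p A v (Pi.single z 1) x := by
  have hf : f = fun x => ∑' z, f z * Pi.single (M := fun _ => ℝ≥0∞) z 1 x := by
    ext x
    rw [tsum_eq_single x fun z hz => by rw [Pi.single_eq_of_ne hz.symm, mul_zero],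
      Pi.single_eq_same, mul_one]
  conv_lhs => rw [hf]
  simp only [green, killedStep_iterate_tsum, killedStep_iterate_const_mul,
    ← ENNReal.tsum_mul_left]
  exact ENNReal.tsum_comm

lemma green_single_self {b : α} (hb : b ∉ A) : green p A v (Pi.single b 1) b = 1 := by
  rw [green_of_notMem hb, Pi.single_eq_same]

lemma green_single_le_one {b : α} (hb : b ∉ A) (x : α) : green p A v (Pi.single b 1) x ≤ 1 :=
  green_le_of_superharmonic (u := fun _ => 1)
    (fun _ hx => Pi.single_eq_of_ne (ne_of_mem_of_not_mem hx hb) _)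
    (fun x _ => single_one_le_one b x)
    (fun x _ => by rw [markovOp_const, mul_one]; exact expNeg_le_one _) x

/-- If each visit to `b` has probability at least `δ` of being the last one, then the number of
visits is dominated by a geometric variable of mean `δ⁻¹`. -/
lemma green_single_le {b : α} {δ : ℝ≥0∞} (hδ : δ ≠ 0)
    (hret : expNeg (v b) * markovOp p (green p (A \ {b}) v (Pi.single b 1)) b + δ ≤ 1)
    (x : α) : green p A v (Pi.single b 1) x ≤ δ⁻¹ := by
  set u := green p (A \ {b}) v (Pi.single b 1) with hu
  have hb : b ∉ A \ {b} := fun h => h.2 rfl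
  have hδ' : δ ≠ ⊤ := ne_top_of_le_ne_top ENNReal.one_ne_top (le_add_self.trans hret)
  refine (green_le (u := fun x => δ⁻¹ * u x) (fun x => ?_) x).trans
    (mul_le_of_le_one_right zero_le (green_single_le_one hb x))
  rw [killedStep_const_mul]
  obtain rfl | hx := eq_or_ne x b
  · rw [hu, green_single_self hb, ← hu, mul_one, Pi.single_eq_same]
    calc 1 + δ⁻¹ * killedStep p A v u x
        ≤ δ⁻¹ * δ + δ⁻¹ * (expNeg (v x) * markovOp p u x) := by
          rw [ENNReal.inv_mul_cancel hδ hδ']; gcongr; exact killedStep_le_expNeg_mul x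
      _ = δ⁻¹ * (expNeg (v x) * markovOp p u x + δ) := by ring
      _ ≤ δ⁻¹ := mul_le_of_le_one_right zero_le hret
  · rw [Pi.single_eq_of_ne hx, zero_add]
    refine mul_le_mul_right ?_ _
    rw [hu, green_eq x, Pi.single_eq_of_ne hx, zero_add, killedStep_sdiff (B := {b}) hx]

/-- The barrier `ψ`, which vanishes at `b` and elsewhere is subharmonic or below the killing
probability, is dominated by the probability of never visiting `b`. -/
lemma green_single_le_of_barrier {b : α} {δ : ℝ≥0∞} (hδ : δ ≠ 0) (ψ : α → ℝ≥0∞)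
    (hψ1 : ∀ x, ψ x ≤ 1) (hψb : ψ b = 0)
    (hψ : ∀ x, x ≠ b → ψ x ≤ markovOp p ψ x ∨ ψ x ≤ 1 - expNeg (v x))
    (hδψ : δ ≤ markovOp p ψ b ∨ δ ≤ 1 - expNeg (v b)) (x : α) :
    green p A v (Pi.single b 1) x ≤ δ⁻¹ := by
  have hle : ∀ x, green p (A \ {b}) v (Pi.single b 1) x ≤ 1 - ψ x := by
    refine green_le_of_superharmonic (fun x hx => Pi.single_eq_of_ne hx.2 _) (fun x _ => ?_)
      (fun x hx => ?_)
    · obtain rfl | h := eq_or_ne x b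
      · rw [hψb, tsub_zero]; exact single_one_le_one x x
      · rw [Pi.single_eq_of_ne h]; exact zero_le
    · exact ENNReal.le_sub_of_add_le_right (ne_top_of_le_ne_top ENNReal.one_ne_top (hψ1 x))
        (expNeg_mul_markovOp_one_sub_add_le_one hψ1 (hψ x hx.2))
  refine green_single_le hδ (le_trans ?_ (expNeg_mul_markovOp_one_sub_add_le_one hψ1 hδψ)) x
  gcongr
  exact markovOp_mono hle b

end MarkovChain

/-! ### Path space -/

section ConsSeq

variable {α : Type*}

/-- The sequence with first term `a`, followed by `s`. -/
def consSeq (a : α) (s : ℕ → α) : ℕ → α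
  | 0 => a
  | n + 1 => s n

lemma preimage_consSeq_pi (s : Set ℕ) (t : ℕ → Set α) :
    (fun q : α × (ℕ → α) => consSeq q.1 q.2) ⁻¹' s.pi t =
      {a | 0 ∈ s → a ∈ t 0} ×ˢ (Nat.succ ⁻¹' s).pi fun n => t (n + 1) := by
  ext ⟨a, ξ⟩
  refine ⟨fun h => ⟨h 0, fun n hn => h (n + 1) hn⟩, ?_⟩
  rintro ⟨h₀, h⟩ (_ | n) hn
  exacts [h₀ hn, h n hn]

variable [MeasurableSpace α]

lemma measurable_consSeq : Measurable fun q : α × (ℕ → α) => consSeq q.1 q.2 := by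
  refine measurable_pi_lambda _ fun n => ?_
  cases n with
  | zero => exact measurable_fst
  | succ n => exact (measurable_pi_apply n).comp measurable_snd

lemma infinitePi_eq_map_consSeq (ν : Measure α) [IsProbabilityMeasure ν] :
    (ν.prod (Measure.infinitePi fun _ : ℕ => ν)).map (fun q => consSeq q.1 q.2) =
      Measure.infinitePi fun _ : ℕ => ν := by
  classical
  refine Measure.eq_infinitePi _ fun s t ht => ?_
  have hinj : Set.InjOn Nat.succ (Nat.succ ⁻¹' (s : Set ℕ)) := Nat.succ_injective.injOn
  have htail : ∏ n ∈ s.preimage Nat.succ hinj, ν (t (n + 1)) = ∏ n ∈ s.erase 0, ν (t n) := by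
    rw [Finset.prod_preimage' Nat.succ s hinj fun n => ν (t n)]
    refine Finset.prod_congr (Finset.ext fun n => ?_) fun _ _ => rfl
    rw [Finset.mem_filter, Finset.mem_erase, Nat.range_succ, Set.mem_ofPred_eq, pos_iff_ne_zero,
      and_comm]
  rw [Measure.map_apply measurable_consSeq (MeasurableSet.pi s.countable_toSet fun i _ => ht i),
    preimage_consSeq_pi, Measure.prod_prod, ← Finset.coe_preimage s hinj,
    Measure.infinitePi_pi _ fun n _ => ht (n + 1), htail]
  by_cases h₀ : 0 ∈ s
  · simp only [Finset.mem_coe, h₀, forall_const, Set.ofPred_mem_eq]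
    exact Finset.mul_prod_erase s (fun n => ν (t n)) h₀
  · simp only [Finset.mem_coe, h₀, IsEmpty.forall_iff, Set.ofPred_true, measure_univ, one_mul,
      Finset.erase_eq_of_notMem h₀]

lemma measurable_eval_path {β : Type*} [MeasurableSpace β] [Countable α]
    [MeasurableSingletonClass α] {v : α → β → ℝ≥0∞} (hv : ∀ z, Measurable (v z)) (k : ℕ) :
    Measurable fun q : β × (ℕ → α) => v (q.2 k) q.1 := by
  have hvv : Measurable fun q : β × α => v q.2 q.1 := measurable_from_prod_countable_left hv
  exact hvv.comp (measurable_fst.prodMk ((measurable_pi_apply k).comp measurable_snd))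

end ConsSeq

section Walk

/-- The transition probabilities of the simple symmetric random walk. -/
def srwStep [NeZero d] (x : Fin d → ℤ) : PMF (Fin d → ℤ) :=
  (PMF.uniformOfFintype (Fin d × Bool)).map fun s => x + unitStep s

lemma tsum_pmf_map_mul {α β : Type*} (p : PMF α) (g : α → β) (f : β → ℝ≥0∞) :
    ∑' b, p.map g b * f b = ∑' a, p a * f (g a) := by
  classical
  simp only [PMF.map_apply, ← ENNReal.tsum_mul_right, ite_mul, zero_mul]
  rw [ENNReal.tsum_comm]
  exact tsum_congr fun a => tsum_ite_eq (g a) _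

lemma markovOp_srwStep [NeZero d] (f : (Fin d → ℤ) → ℝ≥0∞) (x : Fin d → ℤ) :
    markovOp srwStep f x = ∑ s : Fin d × Bool, (2 * d : ℝ≥0∞)⁻¹ * f (x + unitStep s) := by
  unfold markovOp srwStep
  rw [tsum_pmf_map_mul, tsum_fintype]
  simp [mul_comm (2 : ℝ≥0∞)]

lemma measurable_walkPath (x : Fin d → ℤ) : Measurable (walkPath x) :=
  measurable_pi_lambda _ fun _ => measurable_const.add <| Finset.measurable_fun_sum _ fun k _ =>
    (measurable_of_countable unitStep).comp (measurable_pi_apply k)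

lemma walkPath_consSeq (x : Fin d → ℤ) (s : Fin d × Bool) (ξ : ℕ → Fin d × Bool) :
    walkPath x (consSeq s ξ) = consSeq x (walkPath (x + unitStep s) ξ) := by
  ext1 n
  cases n with
  | zero => simp [walkPath, consSeq]
  | succ n =>
    simp only [walkPath, consSeq, Finset.sum_range_succ']
    abel

instance [NeZero d] (x : Fin d → ℤ) : IsProbabilityMeasure (srw x) :=
  Measure.isProbabilityMeasure_map (measurable_walkPath x).aemeasurable

lemma lintegral_srw [NeZero d] (x : Fin d → ℤ) {F : (ℕ → Fin d → ℤ) → ℝ≥0∞} (hF : Measurable F) :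
    ∫⁻ S, F S ∂(srw x) = markovOp srwStep (fun z => ∫⁻ S, F (consSeq x S) ∂(srw z)) x := by
  have hFx : Measurable fun S => F (consSeq x S) :=
    hF.comp (measurable_consSeq.comp (measurable_const.prodMk measurable_id))
  have hFw : Measurable fun ξ => F (walkPath x ξ) := hF.comp (measurable_walkPath x)
  have hFc : Measurable fun q : (Fin d × Bool) × (ℕ → Fin d × Bool) =>
      F (walkPath x (consSeq q.1 q.2)) := hFw.comp measurable_consSeq
  rw [markovOp_srwStep, srw, lintegral_map hF (measurable_walkPath x),
    ← infinitePi_eq_map_consSeq, lintegral_map hFw measurable_consSeq,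
    lintegral_prod _ hFc.aemeasurable, lintegral_fintype]
  refine Finset.sum_congr rfl fun s _ => ?_
  rw [PMF.toMeasure_apply_singleton _ _ (measurableSet_singleton s), mul_comm,
    PMF.uniformOfFintype_apply, srw, lintegral_map hFx (measurable_walkPath _)]
  simp only [walkPath_consSeq, Fintype.card_prod, Fintype.card_fin, Fintype.card_bool,
    Nat.cast_mul, Nat.cast_ofNat, mul_comm]

end Walk

section CrossWeight

variable {v : (Fin d → ℤ) → ℝ≥0∞} {x y : Fin d → ℤ} {S : ℕ → Fin d → ℤ} {m n : ℕ}

lemma hitTime_eq_coe_iff : hitTime y S = n ↔ S n = y ∧ ∀ k < n, S k ≠ y := by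
  have hle {k : ℕ} (hk : S k = y) : hitTime y S ≤ k := iInf₂_le k hk
  refine ⟨fun h => ?_, fun ⟨hn, hlt⟩ => le_antisymm (hle hn) (le_iInf₂ fun k hk => ?_)⟩
  · have hlt : ∀ k < n, S k ≠ y := fun k hk hS => hk.not_ge (by exact_mod_cast h ▸ hle hS)
    refine ⟨by_contra fun hn => ?_, hlt⟩
    have hge : ((n + 1 : ℕ) : ℕ∞) ≤ hitTime y S := le_iInf₂ fun k hk => by
      have hkn : n < k := lt_of_le_of_ne (not_lt.1 fun h => hlt k h hk) fun h => hn (h ▸ hk)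
      exact_mod_cast hkn
    exact n.lt_succ_self.not_ge (by exact_mod_cast h ▸ hge)
  · exact_mod_cast not_lt.1 fun h => hlt k h hk

lemma hitTime_consSeq_eq_zero_iff : hitTime y (consSeq x S) = (0 : ℕ) ↔ x = y := by
  rw [hitTime_eq_coe_iff]
  exact and_iff_left fun k hk => absurd hk k.not_lt_zero

lemma hitTime_consSeq_eq_succ_iff :
    hitTime y (consSeq x S) = (n + 1 : ℕ) ↔ x ≠ y ∧ hitTime y S = n := by
  rw [hitTime_eq_coe_iff, hitTime_eq_coe_iff]
  constructor
  · rintro ⟨h, h'⟩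
    exact ⟨h' 0 n.succ_pos, h, fun k hk => h' (k + 1) (Nat.succ_lt_succ hk)⟩
  · rintro ⟨h₀, h, h'⟩
    refine ⟨h, fun k hk => ?_⟩
    cases k with
    | zero => exact h₀
    | succ k => exact h' k (Nat.lt_of_succ_lt_succ hk)

lemma measurable_hitTime (y : Fin d → ℤ) : Measurable (hitTime y) := by
  have hset : ∀ k, MeasurableSet {S : ℕ → Fin d → ℤ | S k = y} := fun k =>
    measurableSet_eq_fun (measurable_pi_apply k) measurable_const
  refine ENat.measurable_iff.2 fun n => ?_
  have heq : hitTime y ⁻¹' {(n : ℕ∞)} =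
      {S | S n = y} ∩ ⋂ k ∈ Set.Iio n, {S : ℕ → Fin d → ℤ | S k = y}ᶜ := by
    ext S; simp [hitTime_eq_coe_iff]
  exact heq ▸ (hset n).inter (MeasurableSet.biInter (Set.to_countable _) fun k _ => (hset k).compl)

open Classical in
/-- The contribution to `pathWeight` of the paths hitting `y` for the first time at time `n`. -/
def crossWeight (v : (Fin d → ℤ) → ℝ≥0∞) (y : Fin d → ℤ) (n : ℕ) (S : ℕ → Fin d → ℤ) : ℝ≥0∞ :=
  if hitTime y S = n then expNeg (∑ k ∈ Finset.range n, v (S k)) else 0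

lemma measurable_crossWeight_uncurry {β : Type*} [MeasurableSpace β]
    {v : (Fin d → ℤ) → β → ℝ≥0∞} (hv : ∀ z, Measurable (v z)) (y : Fin d → ℤ) (n : ℕ) :
    Measurable fun q : β × (ℕ → Fin d → ℤ) => crossWeight (fun z => v z q.1) y n q.2 :=
  Measurable.ite (measurableSet_eq_fun ((measurable_hitTime y).comp measurable_snd)
      measurable_const)
    (measurable_expNeg.comp (Finset.measurable_fun_sum _ fun k _ => measurable_eval_path hv k))
    measurable_const

lemma measurable_crossWeight (v : (Fin d → ℤ) → ℝ≥0∞) (y : Fin d → ℤ) (n : ℕ) :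
    Measurable (crossWeight v y n) :=
  (measurable_crossWeight_uncurry (β := Unit) (v := fun z _ => v z)
    (fun _ => measurable_const) y n).comp (measurable_prodMk_left (x := ()))

lemma crossWeight_zero_consSeq :
    crossWeight v y 0 (consSeq x S) = (Pi.single y 1 : (Fin d → ℤ) → ℝ≥0∞) x := by
  simp only [crossWeight, hitTime_consSeq_eq_zero_iff, Finset.range_zero, Finset.sum_empty,
    expNeg_zero, Pi.single_apply]

lemma crossWeight_succ_consSeq_self : crossWeight v y (n + 1) (consSeq y S) = 0 :=
  if_neg fun h => (hitTime_consSeq_eq_succ_iff.1 h).1 rfl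

lemma crossWeight_succ_consSeq (hx : x ≠ y) :
    crossWeight v y (n + 1) (consSeq x S) = expNeg (v x) * crossWeight v y n S := by
  simp only [crossWeight, hitTime_consSeq_eq_succ_iff, ne_eq, hx, not_false_eq_true, true_and,
    Finset.sum_range_succ', consSeq, expNeg_add, mul_comm (expNeg (v x)), ite_mul, zero_mul]

lemma lintegral_crossWeight [NeZero d] (v : (Fin d → ℤ) → ℝ≥0∞) (y : Fin d → ℤ) (n : ℕ)
    (x : Fin d → ℤ) :
    ∫⁻ S, crossWeight v y n S ∂(srw x) =
      (killedStep srwStep {y}ᶜ v)^[n] (Pi.single y 1) x := by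
  induction n generalizing x with
  | zero =>
    rw [lintegral_srw x (measurable_crossWeight v y 0)]
    simp only [crossWeight_zero_consSeq, lintegral_const, measure_univ, mul_one]
    exact markovOp_const _ x
  | succ n ih =>
    rw [lintegral_srw x (measurable_crossWeight v y _), Function.iterate_succ_apply']
    obtain rfl | hx := eq_or_ne x y
    · rw [killedStep_of_notMem (A := {x}ᶜ) fun h => h rfl]
      simp only [crossWeight_succ_consSeq_self, lintegral_zero]
      exact markovOp_const 0 x
    · rw [killedStep_of_mem hx, ← markovOp_const_mul]
      simp only [crossWeight_succ_consSeq hx,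
        lintegral_const_mul _ (measurable_crossWeight v y n), ih]

lemma crossWeight_eq_of_hitTime (h : hitTime y S = n) (m : ℕ) :
    crossWeight v y m S = if m = n then pathWeight v y S else 0 := by
  obtain rfl | hm := eq_or_ne m n
  · simp [crossWeight, pathWeight, h, expNeg]
  · rw [crossWeight, h, if_neg hm, if_neg]
    exact_mod_cast hm.symm

lemma crossWeight_eq_zero_of_hitTime_top (h : hitTime y S = ⊤) (m : ℕ) :
    crossWeight v y m S = 0 :=
  if_neg (h ▸ ENat.top_ne_natCast m)

lemma pathWeight_of_hitTime_top (h : hitTime y S = ⊤) : pathWeight v y S = 0 :=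
  if_neg (h ▸ lt_irrefl _)

lemma pathWeight_eq_tsum (v : (Fin d → ℤ) → ℝ≥0∞) (y : Fin d → ℤ) (S : ℕ → Fin d → ℤ) :
    pathWeight v y S = ∑' n, crossWeight v y n S := by
  induction h : hitTime y S using ENat.recTopCoe with
  | top => simp only [crossWeight_eq_zero_of_hitTime_top h, pathWeight_of_hitTime_top h, tsum_zero]
  | coe n => simp only [crossWeight_eq_of_hitTime h, tsum_ite_eq]

lemma pathWeight_mul_hitTime_eq_tsum (v : (Fin d → ℤ) → ℝ≥0∞) (y : Fin d → ℤ)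
    (S : ℕ → Fin d → ℤ) :
    pathWeight v y S * (hitTime y S : ℝ≥0∞) = ∑' n : ℕ, crossWeight v y n S * n := by
  induction h : hitTime y S using ENat.recTopCoe with
  | top =>
    simp only [crossWeight_eq_zero_of_hitTime_top h, pathWeight_of_hitTime_top h, zero_mul,
      tsum_zero]
  | coe n =>
    simp only [crossWeight_eq_of_hitTime h, ite_mul, zero_mul, tsum_ite_eq,
      ENat.toENNReal_coe]

lemma measurable_pathWeight_uncurry {β : Type*} [MeasurableSpace β]
    {v : (Fin d → ℤ) → β → ℝ≥0∞} (hv : ∀ z, Measurable (v z)) (y : Fin d → ℤ) :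
    Measurable fun q : β × (ℕ → Fin d → ℤ) => pathWeight (fun z => v z q.1) y q.2 := by
  simp only [pathWeight_eq_tsum]
  exact Measurable.tsum fun n => measurable_crossWeight_uncurry hv y n

lemma measurable_pathWeight (v : (Fin d → ℤ) → ℝ≥0∞) (y : Fin d → ℤ) :
    Measurable (pathWeight v y) :=
  (measurable_pathWeight_uncurry (β := Unit) (v := fun z _ => v z)
    (fun _ => measurable_const) y).comp (measurable_prodMk_left (x := ()))

lemma quenchedZ_eq_green [NeZero d] (v : (Fin d → ℤ) → ℝ≥0∞) (x y : Fin d → ℤ) :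
    quenchedZ v x y = green srwStep {y}ᶜ v (Pi.single y 1) x := by
  simp only [quenchedZ, green, pathWeight_eq_tsum, ← lintegral_crossWeight]
  exact lintegral_tsum fun n => (measurable_crossWeight v y n).aemeasurable

end CrossWeight

section Annealed

variable {α Ω : Type*} [Countable α] {p : α → PMF α}

lemma measurable_markovOp {m : MeasurableSpace Ω} {F : α → Ω → ℝ≥0∞}
    (hF : ∀ z, Measurable[m] (F z)) (x : α) :
    Measurable[m] fun ω => markovOp p (fun z => F z ω) x :=
  Measurable.tsum fun z => (hF z).const_mul _

variable {m : MeasurableSpace Ω} {A : Set α} {V : α → Ω → ℝ≥0∞}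

lemma measurable_killedStep_iterate (hV : ∀ z ∈ A, Measurable[m] (V z)) (f : α → ℝ≥0∞) (n : ℕ)
    (x : α) : Measurable[m] fun ω => (killedStep p A fun z => V z ω)^[n] f x := by
  induction n generalizing x with
  | zero => exact measurable_const
  | succ n ih =>
    simp only [Function.iterate_succ_apply']
    by_cases hx : x ∈ A
    · simp only [killedStep_of_mem hx]
      exact (measurable_expNeg.comp (hV x hx)).mul (measurable_markovOp (fun z => ih z) x)
    · simp only [killedStep_of_notMem hx]
      exact measurable_const

lemma measurable_green (hV : ∀ z ∈ A, Measurable[m] (V z)) (f : α → ℝ≥0∞) (x : α) :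
    Measurable[m] fun ω => green p A (fun z => V z ω) f x :=
  Measurable.tsum fun n => measurable_killedStep_iterate hV f n x

end Annealed

section Crossing

variable [NeZero d] {Ω : Type*} [MeasurableSpace Ω] {μ : Measure Ω} {V : (Fin d → ℤ) → Ω → ℝ≥0∞}

/-- The annealed weight of the paths from `0` which hit `y` for the first time at time `n`. -/
def crossMass (μ : Measure Ω) (V : (Fin d → ℤ) → Ω → ℝ≥0∞) (y : Fin d → ℤ) (n : ℕ) : ℝ≥0∞ :=
  ∫⁻ ω, (killedStep srwStep {y}ᶜ fun z => V z ω)^[n] (Pi.single y 1) 0 ∂μ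

lemma annealedZ_eq_lintegral_green (μ : Measure Ω) (V : (Fin d → ℤ) → Ω → ℝ≥0∞)
    (x y : Fin d → ℤ) :
    annealedZ μ V x y = ∫⁻ ω, green srwStep {y}ᶜ (fun z => V z ω) (Pi.single y 1) x ∂μ := by
  simp only [annealedZ, quenchedZ_eq_green]

lemma annealedZ_eq_tsum_crossMass (hV : ∀ z, Measurable (V z)) (y : Fin d → ℤ) :
    annealedZ μ V 0 y = ∑' n, crossMass μ V y n := by
  simp only [annealedZ_eq_lintegral_green, green, crossMass]
  exact lintegral_tsum fun n => (measurable_killedStep_iterate (fun z _ => hV z) _ n 0).aemeasurable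

lemma lintegral_pathWeight_mul_hitTime (v : (Fin d → ℤ) → ℝ≥0∞) (x y : Fin d → ℤ) :
    ∫⁻ S, pathWeight v y S * (hitTime y S : ℝ≥0∞) ∂(srw x) =
      ∑' n : ℕ, (killedStep srwStep {y}ᶜ v)^[n] (Pi.single y 1) x * n := by
  simp only [pathWeight_mul_hitTime_eq_tsum]
  rw [lintegral_tsum fun n => ((measurable_crossWeight v y n).mul_const _).aemeasurable]
  simp only [lintegral_mul_const _ (measurable_crossWeight v y _), lintegral_crossWeight]

lemma meanCrossingTime_eq (hV : ∀ z, Measurable (V z)) (y : Fin d → ℤ) :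
    meanCrossingTime μ V y = (annealedZ μ V 0 y)⁻¹ * ∑' n : ℕ, crossMass μ V y n * n := by
  have hpw := measurable_pathWeight_uncurry hV y
  have hτ : Measurable fun S : ℕ → Fin d → ℤ => (hitTime y S : ℝ≥0∞) :=
    (measurable_of_countable _).comp (measurable_hitTime y)
  have hτ' : Measurable fun q : Ω × (ℕ → Fin d → ℤ) => (hitTime y q.2 : ℝ≥0∞) :=
    hτ.comp measurable_snd
  have hmass : ∀ n, Measurable fun ω =>
      (killedStep srwStep {y}ᶜ fun z => V z ω)^[n] (Pi.single y 1) 0 := fun n =>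
    measurable_killedStep_iterate (fun z _ => hV z) _ n 0
  rw [meanCrossingTime, annealedQ, lintegral_smul_measure, smul_eq_mul,
    lintegral_map hτ measurable_snd, lintegral_withDensity_eq_lintegral_mul _ hpw hτ',
    lintegral_prod _ (hpw.mul hτ').aemeasurable]
  simp only [Pi.mul_apply, lintegral_pathWeight_mul_hitTime, crossMass]
  rw [lintegral_tsum fun n => ((hmass n).mul_const _).aemeasurable]
  simp only [lintegral_mul_const _ (hmass _)]

end Crossing

/-! ### I.i.d. potentials -/

section Field

variable {ι Ω : Type*}

/-- The random variables `V z` are independent and identically distributed under `μ`. -/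
structure IsIIDField [Zero ι] [MeasurableSpace Ω] (μ : Measure Ω) (V : ι → Ω → ℝ≥0∞) : Prop where
  meas : ∀ z, Measurable (V z)
  indep : iIndepFun V μ
  ident : ∀ z, IdentDistrib (V z) (V 0) μ μ

/-- `𝔼 exp (-V(0))`. -/
def meanExp [Zero ι] [MeasurableSpace Ω] (μ : Measure Ω) (V : ι → Ω → ℝ≥0∞) : ℝ≥0∞ :=
  ∫⁻ ω, expNeg (V 0 ω) ∂μ

/-- The `σ`-algebra generated by the potential at the sites of `S`. -/
@[reducible]
def sitesAlgebra (V : ι → Ω → ℝ≥0∞) (S : Set ι) : MeasurableSpace Ω :=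
  ⨆ z ∈ S, MeasurableSpace.comap (V z) inferInstance

lemma measurable_sitesAlgebra {V : ι → Ω → ℝ≥0∞} {S : Set ι} {z : ι} (hz : z ∈ S) :
    Measurable[sitesAlgebra V S] (V z) :=
  measurable_iff_comap_le.2
    (le_iSup₂_of_le (f := fun z (_ : z ∈ S) => MeasurableSpace.comap (V z) inferInstance) z hz
      le_rfl)

variable [MeasurableSpace Ω] {μ : Measure Ω} {V : ι → Ω → ℝ≥0∞}

namespace IsIIDField

section Zero

variable [Zero ι]

lemma sitesAlgebra_le (hV : IsIIDField μ V) (S : Set ι) :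
    sitesAlgebra V S ≤ ‹MeasurableSpace Ω› :=
  iSup₂_le fun z _ => measurable_iff_comap_le.1 (hV.meas z)

lemma lintegral_mul (hV : IsIIDField μ V) {S T : Set ι} (hST : Disjoint S T)
    {f g : Ω → ℝ≥0∞} (hf : Measurable[sitesAlgebra V S] f) (hg : Measurable[sitesAlgebra V T] g) :
    ∫⁻ ω, f ω * g ω ∂μ = (∫⁻ ω, f ω ∂μ) * ∫⁻ ω, g ω ∂μ :=
  lintegral_mul_eq_lintegral_mul_lintegral_of_independent_measurableSpace
    (hV.sitesAlgebra_le S) (hV.sitesAlgebra_le T)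
    (indep_iSup_of_disjoint (fun z => measurable_iff_comap_le.1 (hV.meas z)) hV.indep hST) hf hg

lemma lintegral_comp (hV : IsIIDField μ V) {g : ℝ≥0∞ → ℝ≥0∞} (hg : Measurable g) (z : ι) :
    ∫⁻ ω, g (V z ω) ∂μ = ∫⁻ ω, g (V 0 ω) ∂μ :=
  ((hV.ident z).comp hg).lintegral_eq

lemma lintegral_prod (hV : IsIIDField μ V) (s : Finset ι)
    {g : ι → ℝ≥0∞ → ℝ≥0∞} (hg : ∀ z, Measurable (g z)) :
    ∫⁻ ω, ∏ z ∈ s, g z (V z ω) ∂μ = ∏ z ∈ s, ∫⁻ ω, g z (V 0 ω) ∂μ := by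
  exact (lintegral_prod_eq_prod_lintegral_of_indepFun s _ (hV.indep.comp g hg)
    fun z => (hg z).comp (hV.meas z)).trans
    (Finset.prod_congr rfl fun z _ => hV.lintegral_comp (hg z) z)

end Zero

lemma lintegral_shift [AddGroup ι] (hV : IsIIDField μ V)
    {Φ : (ι → ℝ≥0∞) → ℝ≥0∞} (hΦ : Measurable Φ) (x : ι) :
    ∫⁻ ω, Φ (fun z => V (x + z) ω) ∂μ = ∫⁻ ω, Φ (fun z => V z ω) ∂μ := by
  have := hV.indep.isProbabilityMeasure
  have hind : iIndepFun (fun z => V (x + z)) μ := hV.indep.precomp (add_right_injective x)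
  have hlaw : (fun z => μ.map (V (x + z))) = fun z => μ.map (V z) :=
    funext fun z => (hV.ident (x + z)).map_eq.trans (hV.ident z).map_eq.symm
  rw [← lintegral_map hΦ (measurable_pi_lambda _ fun z => hV.meas (x + z)),
    ← lintegral_map hΦ (measurable_pi_lambda _ fun z => hV.meas z),
    hV.indep.map_fun_eq_infinitePi_map hV.meas,
    hind.map_fun_eq_infinitePi_map fun z => hV.meas _, hlaw]

end IsIIDField

end Field

section Distance

/-- The `ℓ¹` distance on `ℤ^d`. -/
def latticeDist (a b : Fin d → ℤ) : ℕ := ∑ i, (a i - b i).natAbs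

lemma latticeDist_self (a : Fin d → ℤ) : latticeDist a a = 0 := by simp [latticeDist]

lemma eq_of_latticeDist_eq_zero {a b : Fin d → ℤ} (h : latticeDist a b = 0) : a = b := by
  ext i
  have hi := Finset.sum_eq_zero_iff.1 h i (Finset.mem_univ i)
  lia

lemma latticeDist_update_add (a b : Fin d → ℤ) (i : Fin d) (t : ℤ) :
    latticeDist (Function.update a i t) b + (a i - b i).natAbs =
      latticeDist a b + (t - b i).natAbs := by
  have hrest : ∑ j ∈ Finset.univ.erase i, (Function.update a i t j - b j).natAbs =
      ∑ j ∈ Finset.univ.erase i, (a j - b j).natAbs :=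
    Finset.sum_congr rfl fun j hj => by rw [Function.update_of_ne (Finset.ne_of_mem_erase hj)]
  simp only [latticeDist]
  rw [← Finset.add_sum_erase _ _ (Finset.mem_univ i), hrest,
    ← Finset.add_sum_erase _ (fun j => (a j - b j).natAbs) (Finset.mem_univ i),
    Function.update_self]
  lia

lemma unitStep_apply_self (p : Fin d × Bool) : unitStep p p.1 = if p.2 then 1 else -1 := by
  unfold unitStep; split_ifs <;> simp

lemma unitStep_apply_of_ne {p : Fin d × Bool} {i : Fin d} (h : i ≠ p.1) : unitStep p i = 0 := by
  unfold unitStep; split_ifs <;> simp [h]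

lemma add_unitStep (a : Fin d → ℤ) (p : Fin d × Bool) :
    a + unitStep p = Function.update a p.1 (a p.1 + if p.2 then 1 else -1) := by
  ext j
  obtain rfl | hj := eq_or_ne j p.1
  · rw [Function.update_self, Pi.add_apply, unitStep_apply_self]
  · rw [Function.update_of_ne hj, Pi.add_apply, unitStep_apply_of_ne hj, add_zero]

lemma exists_unitStep_closer {a b : Fin d → ℤ} (h : a ≠ b) :
    ∃ p : Fin d × Bool, latticeDist (a + unitStep p) b + 1 = latticeDist a b ∧
      a ⊓ b ≤ a + unitStep p ∧ a + unitStep p ≤ a ⊔ b := by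
  obtain ⟨i, hi⟩ := Function.ne_iff.1 h
  refine ⟨(i, decide (a i < b i)), ?_⟩
  have hdist := latticeDist_update_add a b i (a i + if a i < b i then 1 else -1)
  simp only [add_unitStep, decide_eq_true_eq, update_le_iff, le_update_iff,
    Pi.inf_apply, Pi.sup_apply]
  refine ⟨?_, ⟨?_, fun j _ => inf_le_left⟩, ?_, fun j _ => le_sup_left⟩ <;> grind

lemma two_mul_inv_le_one [NeZero d] : (2 * d : ℝ≥0∞)⁻¹ ≤ 1 := by
  rw [ENNReal.inv_le_one]
  have hd : 1 ≤ 2 * d := by have := NeZero.pos d; lia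
  exact_mod_cast hd

lemma le_markovOp_srwStep [NeZero d] (f : (Fin d → ℤ) → ℝ≥0∞) (x : Fin d → ℤ)
    (s : Fin d × Bool) : (2 * d : ℝ≥0∞)⁻¹ * f (x + unitStep s) ≤ markovOp srwStep f x := by
  rw [markovOp_srwStep]
  exact Finset.single_le_sum (f := fun s => (2 * d : ℝ≥0∞)⁻¹ * f (x + unitStep s))
    (fun _ _ => zero_le) (Finset.mem_univ s)

lemma mul_green_unitStep_le [NeZero d] {A : Set (Fin d → ℤ)} {a : Fin d → ℤ} (ha : a ∈ A)
    (v f : (Fin d → ℤ) → ℝ≥0∞) (s : Fin d × Bool) :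
    (2 * d : ℝ≥0∞)⁻¹ * expNeg (v a) * green srwStep A v f (a + unitStep s) ≤
      green srwStep A v f a := by
  rw [green_eq a, killedStep_of_mem ha, mul_comm (2 * d : ℝ≥0∞)⁻¹, mul_assoc]
  exact le_add_of_nonneg_of_le zero_le (mul_le_mul_right (le_markovOp_srwStep _ a s) _)

lemma exists_path_le_green [NeZero d] {l u : Fin d → ℤ} {b : Fin d → ℤ} (hb : b ∈ Set.Icc l u)
    {a : Fin d → ℤ} (ha : a ∈ Set.Icc l u) :
    ∃ P : Finset (Fin d → ℤ), P.card = latticeDist a b + 1 ∧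
      (∀ x ∈ P, latticeDist x b ≤ latticeDist a b) ∧
      ∀ v : (Fin d → ℤ) → ℝ≥0∞, ∏ x ∈ P, ((2 * d : ℝ≥0∞)⁻¹ * expNeg (v x)) ≤
        green srwStep (Set.Icc l u \ {b}) v (Pi.single b 1) a * expNeg (v b) := by
  induction hn : latticeDist a b generalizing a with
  | zero =>
    obtain rfl := eq_of_latticeDist_eq_zero hn
    refine ⟨{a}, by simp, by simp [latticeDist_self], fun v => ?_⟩
    rw [Finset.prod_singleton, green_single_self fun h => h.2 rfl]
    gcongr
    exact two_mul_inv_le_one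
  | succ n ih =>
    have hab : a ≠ b := fun h => by rw [h, latticeDist_self] at hn; lia
    obtain ⟨s, hs, hinf, hsup⟩ := exists_unitStep_closer hab
    obtain ⟨P, hcard, hdist, hprod⟩ := ih (a := a + unitStep s)
      ⟨(le_inf ha.1 hb.1).trans hinf, hsup.trans (sup_le ha.2 hb.2)⟩ (by lia)
    have haP : a ∉ P := fun h => by have := hdist a h; lia
    refine ⟨insert a P, by rw [Finset.card_insert_of_notMem haP, hcard], ?_, fun v => ?_⟩
    · intro x hx
      rcases Finset.mem_insert.1 hx with rfl | hx
      · exact hn.le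
      · exact (hdist x hx).trans n.le_succ
    · rw [Finset.prod_insert haP]
      refine (mul_le_mul_right (hprod v) _).trans ?_
      rw [← mul_assoc]
      exact mul_le_mul_left (mul_green_unitStep_le (A := Set.Icc l u \ {b}) ⟨ha, hab⟩ _ _ s) _

end Distance

section Hit

variable {α : Type*} [DecidableEq α] {p : α → PMF α} {v : α → ℝ≥0∞}

lemma green_compl_singleton_superharmonic (y x : α) :
    expNeg (v x) * markovOp p (green p {y}ᶜ v (Pi.single y 1)) x ≤
      green p {y}ᶜ v (Pi.single y 1) x := by
  have hy : y ∉ ({y}ᶜ : Set α) := fun h => h rfl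
  obtain rfl | hx := eq_or_ne x y
  · rw [green_single_self hy]
    calc _ ≤ 1 * markovOp p (fun _ => 1) x := by
          gcongr
          · exact expNeg_le_one _
          · exact markovOp_mono (green_single_le_one hy) x
      _ = 1 := by rw [markovOp_const, one_mul]
  · conv_rhs => rw [green_eq, killedStep_of_mem (A := {y}ᶜ) hx]
    exact le_add_self

lemma green_single_mul_le {A : Set α} {b : α} (hb : b ∉ A) {u : α → ℝ≥0∞}
    (hu : ∀ x ∈ A, expNeg (v x) * markovOp p u x ≤ u x) (x : α) :
    green p A v (Pi.single b 1) x * u b ≤ u x := by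
  rw [mul_comm, ← green_const_mul]
  refine green_le_of_superharmonic (fun x hx => ?_) (fun x _ => ?_) hu x
  · rw [Pi.single_eq_of_ne (ne_of_mem_of_not_mem hx hb), mul_zero]
  · obtain rfl | h := eq_or_ne x b
    · rw [Pi.single_eq_same, mul_one]
    · rw [Pi.single_eq_of_ne h, mul_zero]
      exact zero_le

end Hit

section Shift

variable [NeZero d]

lemma killedStep_shift (x : Fin d → ℤ) (A : Set (Fin d → ℤ)) (v f : (Fin d → ℤ) → ℝ≥0∞) :
    (fun z => killedStep srwStep A v f (x + z)) =
      killedStep srwStep ((x + ·) ⁻¹' A) (fun z => v (x + z)) fun z => f (x + z) := by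
  ext z
  by_cases hz : x + z ∈ A
  · rw [killedStep_of_mem hz, killedStep_of_mem (A := (x + ·) ⁻¹' A) hz]
    simp only [markovOp_srwStep, add_assoc]
  · rw [killedStep_of_notMem hz, killedStep_of_notMem (A := (x + ·) ⁻¹' A) hz]

lemma green_shift (x : Fin d → ℤ) (A : Set (Fin d → ℤ)) (v f : (Fin d → ℤ) → ℝ≥0∞)
    (z : Fin d → ℤ) :
    green srwStep A v f (x + z) =
      green srwStep ((x + ·) ⁻¹' A) (fun z => v (x + z)) (fun z => f (x + z)) z := by
  have hiter (n : ℕ) : (fun z => (killedStep srwStep A v)^[n] f (x + z)) =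
      (killedStep srwStep ((x + ·) ⁻¹' A) fun z => v (x + z))^[n] fun z => f (x + z) := by
    induction n with
    | zero => rfl
    | succ n ih => simp only [Function.iterate_succ_apply', killedStep_shift, ih]
  exact tsum_congr fun n => congrFun (hiter n) z

end Shift

section Correlation

section Monovary

lemma mul_add_mul_le_of_monovary {Ω : Type*} {F G : Ω → ℝ≥0∞} (h : Monovary F G) (ω ω' : Ω) :
    F ω * G ω' + F ω' * G ω ≤ F ω * G ω + F ω' * G ω' := by
  wlog hG : G ω ≤ G ω' generalizing ω ω'
  · rw [add_comm, add_comm (F ω * G ω)]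
    exact this ω' ω (le_of_not_ge hG)
  obtain hG | hG := hG.eq_or_lt
  · rw [hG]
  obtain ⟨c, hc⟩ := exists_add_of_le (h hG)
  obtain ⟨e, he⟩ := exists_add_of_le hG.le
  rw [hc, he]
  calc _ = F ω * G ω + (F ω + c) * G ω + F ω * e := by ring
    _ ≤ F ω * G ω + (F ω + c) * G ω + (F ω + c) * e := by gcongr; exact le_self_add
    _ = _ := by ring

variable {Ω : Type*} [MeasurableSpace Ω] {μ : Measure Ω}

lemma lintegral_mul_lintegral_le_of_monovary [IsProbabilityMeasure μ] {F G : Ω → ℝ≥0∞}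
    (hF : Measurable F) (hG : Measurable G) (h : Monovary F G) :
    (∫⁻ ω, F ω ∂μ) * ∫⁻ ω, G ω ∂μ ≤ ∫⁻ ω, F ω * G ω ∂μ := by
  have htwo : 2 * ((∫⁻ ω, F ω ∂μ) * ∫⁻ ω, G ω ∂μ) ≤ 2 * ∫⁻ ω, F ω * G ω ∂μ := by
    calc _ = ∫⁻ ω, ∫⁻ ω', (F ω * G ω' + F ω' * G ω) ∂μ ∂μ := by
          simp only [lintegral_add_left (hG.const_mul _), lintegral_const_mul _ hG,
            lintegral_mul_const _ hF]
          rw [lintegral_add_left (hF.mul_const _), lintegral_mul_const _ hF,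
            lintegral_const_mul _ hG, two_mul]
      _ ≤ ∫⁻ ω, ∫⁻ ω', (F ω * G ω + F ω' * G ω') ∂μ ∂μ :=
          lintegral_mono fun ω => lintegral_mono fun ω' => mul_add_mul_le_of_monovary h ω ω'
      _ = _ := by
          simp only [lintegral_add_left measurable_const, lintegral_const, measure_univ, mul_one]
          rw [lintegral_add_left (f := fun ω => F ω * G ω) (hF.mul hG), lintegral_const,
            measure_univ, mul_one, two_mul]
  rwa [ENNReal.mul_le_mul_iff_right (by simp) (by simp)] at htwo

lemma lintegral_pow_mul_lintegral_pow_le [IsProbabilityMeasure μ] {W : Ω → ℝ≥0∞}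
    (hW : Measurable W) (m n : ℕ) :
    (∫⁻ ω, W ω ^ m ∂μ) * ∫⁻ ω, W ω ^ n ∂μ ≤ ∫⁻ ω, W ω ^ (m + n) ∂μ := by
  simp only [pow_add]
  exact lintegral_mul_lintegral_le_of_monovary (hW.pow_const m) (hW.pow_const n)
    fun _ _ h => pow_le_pow_left₀ zero_le
      (lt_of_not_ge fun hle => h.not_ge (pow_le_pow_left₀ zero_le hle n)).le m

end Monovary

section ExpSeries

variable {α Ω : Type*}

/-- A monomial in the variables `exp (-v z)`. -/
def expMonomial (n : α →₀ ℕ) (v : α → ℝ≥0∞) : ℝ≥0∞ :=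
  n.prod fun z k => expNeg (v z) ^ k

/-- `F` is a power series with nonnegative coefficients in the variables `exp (-v z)`. -/
def IsExpSeries (F : (α → ℝ≥0∞) → ℝ≥0∞) : Prop :=
  ∃ c : (α →₀ ℕ) → ℝ≥0∞, ∀ v, F v = ∑' n, c n * expMonomial n v

lemma expMonomial_add (m n : α →₀ ℕ) (v : α → ℝ≥0∞) :
    expMonomial (m + n) v = expMonomial m v * expMonomial n v :=
  Finsupp.prod_add_index' (fun _ => pow_zero _) fun _ _ _ => pow_add _ _ _

lemma expMonomial_single (x : α) (v : α → ℝ≥0∞) :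
    expMonomial (Finsupp.single x 1) v = expNeg (v x) := by
  simp [expMonomial]

namespace IsExpSeries

lemma const (a : ℝ≥0∞) : IsExpSeries fun _ : α → ℝ≥0∞ => a := by
  classical
  refine ⟨Pi.single 0 a, fun v => ?_⟩
  rw [tsum_eq_single 0 fun n hn => by rw [Pi.single_eq_of_ne hn, zero_mul]]
  simp [expMonomial]

lemma tsum {ι : Type*} {F : ι → (α → ℝ≥0∞) → ℝ≥0∞} (hF : ∀ i, IsExpSeries (F i)) :
    IsExpSeries fun v => ∑' i, F i v := by
  choose c hc using hF
  refine ⟨fun n => ∑' i, c i n, fun v => ?_⟩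
  simp only [hc, ← ENNReal.tsum_mul_right]
  exact ENNReal.tsum_comm

lemma expMonomial_mul {F : (α → ℝ≥0∞) → ℝ≥0∞} (hF : IsExpSeries F) (m : α →₀ ℕ) :
    IsExpSeries fun v => expMonomial m v * F v := by
  classical
  obtain ⟨c, hc⟩ := hF
  refine ⟨fun k => ∑' n, if k = m + n then c n else 0, fun v => ?_⟩
  simp only [hc, ← ENNReal.tsum_mul_right, ← ENNReal.tsum_mul_left, ite_mul, zero_mul]
  rw [ENNReal.tsum_comm]
  refine tsum_congr fun n => ?_
  rw [tsum_ite_eq, expMonomial_add, mul_left_comm]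

lemma const_mul {F : (α → ℝ≥0∞) → ℝ≥0∞} (hF : IsExpSeries F) (a : ℝ≥0∞) :
    IsExpSeries fun v => a * F v := by
  obtain ⟨c, hc⟩ := hF
  exact ⟨fun n => a * c n, fun v => by simp only [hc, ← ENNReal.tsum_mul_left, mul_assoc]⟩

end IsExpSeries

lemma isExpSeries_green (p : α → PMF α) (A : Set α) (f : α → ℝ≥0∞) (x : α) :
    IsExpSeries fun v => green p A v f x := by
  refine IsExpSeries.tsum fun n => ?_
  induction n generalizing x with
  | zero => exact IsExpSeries.const (f x)
  | succ n ih =>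
    simp only [Function.iterate_succ_apply']
    by_cases hx : x ∈ A
    · simp only [killedStep_of_mem hx, ← expMonomial_single]
      exact (IsExpSeries.tsum fun z => (ih z).const_mul _).expMonomial_mul _
    · simp only [killedStep_of_notMem hx]
      exact IsExpSeries.const 0

variable [MeasurableSpace Ω] {μ : Measure Ω} {V : α → Ω → ℝ≥0∞}

lemma measurable_expMonomial (hV : ∀ z, Measurable (V z)) (n : α →₀ ℕ) :
    Measurable fun ω => expMonomial n fun z => V z ω :=
  Finset.measurable_fun_prod _ fun z _ => (measurable_expNeg.comp (hV z)).pow_const _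

variable [IsProbabilityMeasure μ] [Zero α]

lemma lintegral_expMonomial_mul_le (hV : IsIIDField μ V) (m n : α →₀ ℕ) :
    (∫⁻ ω, expMonomial m (fun z => V z ω) ∂μ) * ∫⁻ ω, expMonomial n (fun z => V z ω) ∂μ ≤
      ∫⁻ ω, expMonomial (m + n) (fun z => V z ω) ∂μ := by
  classical
  have hfactor (k : α →₀ ℕ) (hk : k.support ⊆ m.support ∪ n.support) :
      ∫⁻ ω, expMonomial k (fun z => V z ω) ∂μ =
        ∏ z ∈ m.support ∪ n.support, ∫⁻ ω, expNeg (V 0 ω) ^ k z ∂μ := by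
    rw [← hV.lintegral_prod _ (g := fun z a => expNeg a ^ k z)
      fun z => measurable_expNeg.pow_const _]
    exact lintegral_congr fun ω =>
      Finsupp.prod_of_support_subset _ hk _ fun _ _ => pow_zero _
  rw [hfactor m Finset.subset_union_left, hfactor n Finset.subset_union_right,
    hfactor _ Finsupp.support_add, ← Finset.prod_mul_distrib]
  exact Finset.prod_le_prod' fun z _ =>
    lintegral_pow_mul_lintegral_pow_le (measurable_expNeg.comp (hV.meas 0)) _ _

lemma IsExpSeries.lintegral_mul_le [Countable α] {F G : (α → ℝ≥0∞) → ℝ≥0∞}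
    (hF : IsExpSeries F) (hG : IsExpSeries G) (hV : IsIIDField μ V) :
    (∫⁻ ω, F (fun z => V z ω) ∂μ) * ∫⁻ ω, G (fun z => V z ω) ∂μ ≤
      ∫⁻ ω, F (fun z => V z ω) * G (fun z => V z ω) ∂μ := by
  obtain ⟨c, hc⟩ := hF
  obtain ⟨e, he⟩ := hG
  have hM := measurable_expMonomial hV.meas
  simp only [hc, he, ← ENNReal.tsum_mul_left, ← ENNReal.tsum_mul_right, mul_mul_mul_comm,
    ← expMonomial_add]
  simp only [lintegral_tsum fun n => ((hM n).const_mul (e n)).aemeasurable,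
    lintegral_tsum fun n => ((hM n).const_mul (c n)).aemeasurable,
    lintegral_tsum fun n => (Measurable.tsum fun m =>
      (hM (m + n)).const_mul (c m * e n)).aemeasurable,
    lintegral_tsum fun m => ((hM (m + _)).const_mul (c m * _)).aemeasurable,
    lintegral_const_mul _ (hM _), ← ENNReal.tsum_mul_left, ← ENNReal.tsum_mul_right]
  refine ENNReal.tsum_le_tsum fun n => ENNReal.tsum_le_tsum fun m => ?_
  rw [mul_mul_mul_comm]
  exact mul_le_mul_right (lintegral_expMonomial_mul_le hV m n) _

end ExpSeries

end Correlation

section Supermultiplicative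

variable [NeZero d] {Ω : Type*} [MeasurableSpace Ω] {μ : Measure Ω}
  {V : (Fin d → ℤ) → Ω → ℝ≥0∞}

lemma annealedZ_shift (hV : IsIIDField μ V) (x y : Fin d → ℤ) :
    annealedZ μ V x (x + y) = annealedZ μ V 0 y := by
  have hΦ : Measurable fun v : (Fin d → ℤ) → ℝ≥0∞ => green srwStep {y}ᶜ v (Pi.single y 1) 0 :=
    measurable_green (V := fun z (v : (Fin d → ℤ) → ℝ≥0∞) => v z)
      (fun z _ => measurable_pi_apply z) (Pi.single y 1) 0
  have hset : (x + ·) ⁻¹' ({x + y}ᶜ : Set (Fin d → ℤ)) = {y}ᶜ := by ext z; simp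
  have hsingle : (fun z => (Pi.single (x + y) 1 : (Fin d → ℤ) → ℝ≥0∞) (x + z)) =
      Pi.single y 1 := by ext z; simp [Pi.single_apply]
  rw [annealedZ_eq_lintegral_green, annealedZ_eq_lintegral_green, ← hV.lintegral_shift hΦ x]
  refine lintegral_congr fun ω => ?_
  conv_lhs => rw [← add_zero x, green_shift, add_zero, hset, hsingle]

lemma pow_le_lintegral_green (hV : IsIIDField μ V) {l u a b : Fin d → ℤ}
    (ha : a ∈ Set.Icc l u) (hb : b ∈ Set.Icc l u) :
    ((2 * d : ℝ≥0∞)⁻¹ * meanExp μ V) ^ (latticeDist a b + 1) ≤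
      ∫⁻ ω, green srwStep (Set.Icc l u \ {b}) (fun z => V z ω) (Pi.single b 1) a *
        expNeg (V b ω) ∂μ := by
  obtain ⟨P, hcard, -, hP⟩ := exists_path_le_green hb ha
  refine le_trans ?_ (lintegral_mono fun ω => hP fun z => V z ω)
  have hmeas : Measurable fun ω => expNeg (V 0 ω) := measurable_expNeg.comp (hV.meas 0)
  rw [hV.lintegral_prod P (g := fun _ a => (2 * d : ℝ≥0∞)⁻¹ * expNeg a)
    fun _ => measurable_expNeg.const_mul _, lintegral_const_mul _ hmeas,
    Finset.prod_const, hcard, meanExp]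

lemma pow_le_annealedZ (hV : IsIIDField μ V) (y : Fin d → ℤ) :
    ((2 * d : ℝ≥0∞)⁻¹ * meanExp μ V) ^ (latticeDist 0 y + 1) ≤ annealedZ μ V 0 y := by
  rw [annealedZ_eq_lintegral_green]
  refine (pow_le_lintegral_green hV (l := 0 ⊓ y) (u := 0 ⊔ y) ⟨inf_le_left, le_sup_left⟩
    ⟨inf_le_right, le_sup_right⟩).trans (lintegral_mono fun ω => ?_)
  exact (mul_le_of_le_one_right zero_le (expNeg_le_one _)).trans
    (green_mono_set (fun z hz => hz.2) 0)

variable [IsProbabilityMeasure μ]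

lemma annealedZ_mul_le (hV : IsIIDField μ V) (x y : Fin d → ℤ) :
    annealedZ μ V 0 x * annealedZ μ V 0 y ≤ annealedZ μ V 0 (x + y) := by
  rw [← annealedZ_shift hV x y]
  simp only [annealedZ_eq_lintegral_green]
  refine ((isExpSeries_green srwStep _ _ _).lintegral_mul_le
    (isExpSeries_green srwStep _ _ _) hV).trans (lintegral_mono fun ω => ?_)
  exact green_single_mul_le (by simp)
    (fun z _ => green_compl_singleton_superharmonic _ _) 0

lemma annealedZ_le_one (x y : Fin d → ℤ) : annealedZ μ V x y ≤ 1 := by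
  rw [annealedZ_eq_lintegral_green]
  calc _ ≤ ∫⁻ _, 1 ∂μ := lintegral_mono fun ω => green_single_le_one (by simp) x
    _ = 1 := by rw [lintegral_const, measure_univ, mul_one]

end Supermultiplicative

/-! ### Existence of the Lyapunov exponents -/

section Lyapunov

lemma latticeDist_zero_le {e : Fin d → ℤ} {N : ℕ} (h : ∀ i, |e i| ≤ N) :
    latticeDist 0 e ≤ d * N := by
  unfold latticeDist
  calc _ ≤ ∑ _i : Fin d, N := Finset.sum_le_sum fun i _ => by
        rw [Pi.zero_apply, zero_sub, Int.natAbs_neg]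
        exact_mod_cast (Int.abs_eq_natAbs _).symm.trans_le (h i)
    _ = d * N := by simp

lemma abs_intPart_add_smul_sub_le (h : EuclideanSpace ℝ (Fin d)) (s t : ℝ) (i : Fin d) :
    |(intPart ((s + t) • h) - (intPart (s • h) + intPart (t • h))) i| ≤ 1 := by
  simp only [Pi.sub_apply, Pi.add_apply, intPart, PiLp.smul_apply, smul_eq_mul, add_mul]
  have hlower := Int.le_floor_add (s * h i) (t * h i)
  have hupper := Int.le_floor_add_floor (s * h i) (t * h i)
  rw [abs_le]
  constructor <;> lia

lemma abs_intPart_smul_sub_le (h : EuclideanSpace ℝ (Fin d)) {r s : ℝ} (hrs : |r - s| ≤ 1)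
    (i : Fin d) : |(intPart (r • h) - intPart (s • h)) i| ≤ (⌈‖h‖⌉₊ + 1 : ℕ) := by
  have hprod : |r * h i - s * h i| ≤ ⌈‖h‖⌉₊ := by
    rw [← sub_mul, abs_mul]
    calc _ ≤ |h i| := mul_le_of_le_one_left (abs_nonneg _) hrs
      _ ≤ ‖h‖ := PiLp.norm_apply_le h i
      _ ≤ _ := Nat.le_ceil _
  have hcast : |((⌊r * h i⌋ - ⌊s * h i⌋ : ℤ) : ℝ)| < ((⌈‖h‖⌉₊ + 2 : ℕ) : ℤ) := by
    push_cast
    rw [abs_lt]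
    have hr := Int.floor_le (r * h i)
    have hr' := Int.lt_floor_add_one (r * h i)
    have hs := Int.floor_le (s * h i)
    have hs' := Int.lt_floor_add_one (s * h i)
    constructor <;> linarith [(abs_le.1 hprod).1, (abs_le.1 hprod).2]
  simp only [Pi.sub_apply, intPart, PiLp.smul_apply, smul_eq_mul]
  rw [← Int.cast_abs, Int.cast_lt] at hcast
  lia

lemma tendsto_div_of_abs_sub_floor_le {f : ℝ → ℝ} {u : ℕ → ℝ} {L M : ℝ}
    (hu : Tendsto (fun n => u n / n) atTop (𝓝 L)) (hM : ∀ r, 0 ≤ r → |f r - u ⌊r⌋₊| ≤ M) :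
    Tendsto (fun r => f r / r) atTop (𝓝 L) := by
  have hfloor := (hu.comp (tendsto_nat_floor_atTop (α := ℝ))).mul
    (tendsto_nat_floor_div_atTop (R := ℝ))
  have herr : Tendsto (fun r : ℝ => (f r - u ⌊r⌋₊) / r) atTop (𝓝 0) := by
    refine squeeze_zero_norm' (a := fun r : ℝ => M / r) ?_ (tendsto_const_nhds.div_atTop tendsto_id)
    filter_upwards [eventually_gt_atTop 0] with r hr
    rw [Real.norm_eq_abs, abs_div, abs_of_pos hr]
    gcongr
    exact hM r hr.le
  have hsum := hfloor.add herr
  rw [mul_one, add_zero] at hsum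
  refine hsum.congr' ?_
  filter_upwards [eventually_ge_atTop 1] with r hr
  have hfloor_ne : (⌊r⌋₊ : ℝ) ≠ 0 := by
    have := Nat.floor_pos.2 hr
    positivity
  have hr_ne : r ≠ 0 := by positivity
  simp only [Function.comp]
  field_simp
  ring

section Subadditive

variable {g : (Fin d → ℤ) → ℝ} {K : ℝ}

lemma le_of_abs_apply_le (hK : 0 ≤ K) (hgle : ∀ x, g x ≤ K * (latticeDist 0 x + 1)) {N : ℕ}
    {e : Fin d → ℤ} (he : ∀ i, |e i| ≤ N) : g e ≤ K * (d * N + 1) := by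
  refine (hgle e).trans (mul_le_mul_of_nonneg_left ?_ hK)
  gcongr
  exact_mod_cast latticeDist_zero_le he

lemma abs_sub_le_of_abs_sub_apply_le (hK : 0 ≤ K) (hgadd : ∀ x y, g (x + y) ≤ g x + g y)
    (hgle : ∀ x, g x ≤ K * (latticeDist 0 x + 1)) {N : ℕ} {x y : Fin d → ℤ}
    (hxy : ∀ i, |(x - y) i| ≤ N) : |g x - g y| ≤ K * (d * N + 1) := by
  have hx := hgadd y (x - y)
  have hy := hgadd x (y - x)
  have hxy' := le_of_abs_apply_le hK hgle hxy
  have hyx' := le_of_abs_apply_le hK hgle (e := y - x) (N := N) fun i => by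
    rw [← neg_sub, Pi.neg_apply, abs_neg]
    exact hxy i
  rw [add_sub_cancel] at hx hy
  rw [abs_le]
  constructor <;> linarith

-- Integer parts are additive only up to a bounded error, which the added constant absorbs.
lemma subadditive_intPart_smul (hK : 0 ≤ K) (hgadd : ∀ x y, g (x + y) ≤ g x + g y)
    (hgle : ∀ x, g x ≤ K * (latticeDist 0 x + 1)) (h : EuclideanSpace ℝ (Fin d)) :
    Subadditive fun n : ℕ => g (intPart ((n : ℝ) • h)) + K * (d * (1 : ℕ) + 1) := by
  intro m n
  have hadd := hgadd (intPart ((m : ℝ) • h)) (intPart ((n : ℝ) • h))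
  have hdiff := (abs_le.1 (abs_sub_le_of_abs_sub_apply_le (N := 1) hK hgadd hgle
    (abs_intPart_add_smul_sub_le h m n))).2
  push_cast at hdiff ⊢
  linarith

lemma tendsto_subadditive_intPart_div (hK : 0 ≤ K) (hg0 : ∀ x, 0 ≤ g x)
    (hgadd : ∀ x y, g (x + y) ≤ g x + g y) (hgle : ∀ x, g x ≤ K * (latticeDist 0 x + 1))
    (h : EuclideanSpace ℝ (Fin d)) :
    ∃ L, Tendsto (fun r : ℝ => g (intPart (r • h)) / r) atTop (𝓝 L) := by
  have hsub := subadditive_intPart_smul hK hgadd hgle h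
  have hlim := hsub.tendsto_lim ⟨0, by
    rintro _ ⟨n, rfl⟩
    have := hg0 (intPart ((n : ℝ) • h))
    positivity⟩
  refine ⟨_, tendsto_div_of_abs_sub_floor_le hlim
    (M := K * (d * (⌈‖h‖⌉₊ + 1 : ℕ) + 1) + K * (d * (1 : ℕ) + 1)) fun r hr => ?_⟩
  have hfloor : |r - (⌊r⌋₊ : ℝ)| ≤ 1 := by
    rw [abs_of_nonneg (sub_nonneg.2 (Nat.floor_le hr))]
    linarith [Nat.lt_floor_add_one r]
  have hdiff := abs_sub_le_of_abs_sub_apply_le hK hgadd hgle (abs_intPart_smul_sub_le h hfloor)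
  calc _ = |g (intPart (r • h)) - g (intPart ((⌊r⌋₊ : ℝ) • h)) - K * (d * (1 : ℕ) + 1)| := by
        rw [sub_sub]
    _ ≤ _ := (abs_sub _ _).trans
        (add_le_add hdiff (abs_of_nonneg (by positivity)).le)

end Subadditive

variable {Ω : Type*} [MeasurableSpace Ω] {μ : Measure Ω} {V : (Fin d → ℤ) → Ω → ℝ≥0∞}

lemma meanExp_le_one [IsProbabilityMeasure μ] : meanExp μ V ≤ 1 := by
  calc _ ≤ ∫⁻ _, 1 ∂μ := lintegral_mono fun ω => expNeg_le_one _
    _ = 1 := by simp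

lemma stepMass_ne_zero (h0 : meanExp μ V ≠ 0) : (2 * d : ℝ≥0∞)⁻¹ * meanExp μ V ≠ 0 :=
  mul_ne_zero (ENNReal.inv_ne_zero.2 (ENNReal.mul_ne_top (by simp) (by simp))) h0

variable [NeZero d]

lemma annealedZ_ne_zero (hV : IsIIDField μ V) (h0 : meanExp μ V ≠ 0) (y : Fin d → ℤ) :
    annealedZ μ V 0 y ≠ 0 :=
  fun h => pow_ne_zero _ (stepMass_ne_zero h0) (le_antisymm (h ▸ pow_le_annealedZ hV y) zero_le)

variable [IsProbabilityMeasure μ]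

lemma stepMass_le_one : (2 * d : ℝ≥0∞)⁻¹ * meanExp μ V ≤ 1 :=
  mul_le_one' two_mul_inv_le_one meanExp_le_one

lemma annealedZ_ne_top (x y : Fin d → ℤ) : annealedZ μ V x y ≠ ⊤ :=
  ne_top_of_le_ne_top ENNReal.one_ne_top (annealedZ_le_one x y)

lemma annealedZ_toReal_pos (hV : IsIIDField μ V) (h0 : meanExp μ V ≠ 0) (y : Fin d → ℤ) :
    0 < (annealedZ μ V 0 y).toReal :=
  ENNReal.toReal_pos (annealedZ_ne_zero hV h0 y) (annealedZ_ne_top 0 y)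

lemma neg_log_toReal_nonneg {a : ℝ≥0∞} (ha : a ≤ 1) : 0 ≤ -Real.log a.toReal :=
  neg_nonneg.2 (Real.log_nonpos ENNReal.toReal_nonneg
    (by simpa using ENNReal.toReal_mono ENNReal.one_ne_top ha))

lemma neg_log_annealedZ_le (hV : IsIIDField μ V) (h0 : meanExp μ V ≠ 0) (y : Fin d → ℤ) :
    -Real.log (annealedZ μ V 0 y).toReal ≤
      -Real.log ((2 * d : ℝ≥0∞)⁻¹ * meanExp μ V).toReal * (latticeDist 0 y + 1) := by
  have hpow := ENNReal.toReal_mono (annealedZ_ne_top 0 y) (pow_le_annealedZ hV y)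
  have hpos : 0 < ((2 * d : ℝ≥0∞)⁻¹ * meanExp μ V).toReal := ENNReal.toReal_pos
    (stepMass_ne_zero h0) (ne_top_of_le_ne_top ENNReal.one_ne_top stepMass_le_one)
  rw [ENNReal.toReal_pow] at hpow
  have hlog := Real.log_le_log (pow_pos hpos _) hpow
  rw [Real.log_pow] at hlog
  push_cast at hlog
  linarith

lemma neg_log_annealedZ_add_le (hV : IsIIDField μ V) (h0 : meanExp μ V ≠ 0) (x y : Fin d → ℤ) :
    -Real.log (annealedZ μ V 0 (x + y)).toReal ≤
      -Real.log (annealedZ μ V 0 x).toReal + -Real.log (annealedZ μ V 0 y).toReal := by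
  have hx := annealedZ_toReal_pos hV h0 x
  have hy := annealedZ_toReal_pos hV h0 y
  have hmul := ENNReal.toReal_mono (annealedZ_ne_top 0 (x + y)) (annealedZ_mul_le hV x y)
  rw [ENNReal.toReal_mul] at hmul
  have hlog := Real.log_le_log (mul_pos hx hy) hmul
  rw [Real.log_mul hx.ne' hy.ne'] at hlog
  linarith

lemma tendsto_decayRate (hV : IsIIDField μ V) (h0 : meanExp μ V ≠ 0)
    (h : EuclideanSpace ℝ (Fin d)) :
    Tendsto (decayRate μ V h) atTop (𝓝 (lyapunov μ V h)) := by
  obtain ⟨L, hL⟩ := tendsto_subadditive_intPart_div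
    (g := fun y => -Real.log (annealedZ μ V 0 y).toReal) (neg_log_toReal_nonneg stepMass_le_one)
    (fun y => neg_log_toReal_nonneg (annealedZ_le_one 0 y))
    (neg_log_annealedZ_add_le hV h0) (neg_log_annealedZ_le hV h0) h
  have hrate : Tendsto (decayRate μ V h) atTop (𝓝 L) :=
    hL.congr fun r => by unfold decayRate; ring
  unfold lyapunov
  rwa [hrate.limUnder_eq]

end Lyapunov

/-! ### The number of visited sites -/

section Range

section Green

variable {α : Type*} {p : α → PMF α}

lemma green_add {A : Set α} {v f g : α → ℝ≥0∞} (x : α) :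
    green p A v (fun z => f z + g z) x = green p A v f x + green p A v g x := by
  classical
  rw [green_eq_tsum, green_eq_tsum (f := f), green_eq_tsum (f := g), ← ENNReal.tsum_add]
  simp only [add_mul]

lemma green_sdiff_singleton [DecidableEq α] (A : Set α) (v f : α → ℝ≥0∞) (a x : α) :
    green p (A \ {a}) v f x = green p A (Function.update v a ⊤) f x := by
  have hstep : killedStep p (A \ {a}) v = killedStep p A (Function.update v a ⊤) := by
    ext f z
    obtain rfl | hz := eq_or_ne z a
    · rw [killedStep_of_notMem (by simp)]
      by_cases hA : z ∈ A
      · rw [killedStep_of_mem hA, Function.update_self, expNeg_top, zero_mul]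
      · rw [killedStep_of_notMem hA]
    · rw [killedStep_sdiff (by simpa using hz)]
      simp only [killedStep, Set.indicator, Function.update_of_ne hz]
  simp only [green, hstep]

end Green

/-- The sites visited by `S` strictly before the hitting time of `y`, if that is finite; by the
convention `(⊤ : ℕ∞).toNat = 0` there are none if `y` is never hit. -/
def visitedSites (y : Fin d → ℤ) (S : ℕ → Fin d → ℤ) : Finset (Fin d → ℤ) :=
  (Finset.range (hitTime y S).toNat).image S

/-- The part of `pathWeight` due to the paths which visit `a` before hitting `y`. -/
def visitWeight (v : (Fin d → ℤ) → ℝ≥0∞) (y a : Fin d → ℤ) (S : ℕ → Fin d → ℤ) : ℝ≥0∞ :=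
  if a ∈ visitedSites y S then pathWeight v y S else 0

lemma pathWeight_eq_expNeg {v : (Fin d → ℤ) → ℝ≥0∞} {y : Fin d → ℤ} {S : ℕ → Fin d → ℤ} {n : ℕ}
    (h : hitTime y S = n) : pathWeight v y S = expNeg (∑ k ∈ Finset.range n, v (S k)) := by
  simp [pathWeight, h, expNeg]

lemma pathWeight_update_top (v : (Fin d → ℤ) → ℝ≥0∞) (y a : Fin d → ℤ) (S : ℕ → Fin d → ℤ) :
    pathWeight (Function.update v a ⊤) y S =
      if a ∈ visitedSites y S then 0 else pathWeight v y S := by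
  induction h : hitTime y S using ENat.recTopCoe with
  | top => simp [pathWeight_of_hitTime_top h]
  | coe n =>
    rw [pathWeight_eq_expNeg h, pathWeight_eq_expNeg h]
    simp only [visitedSites, h, ENat.toNat_natCast]
    split_ifs with ha
    · obtain ⟨k, hk, rfl⟩ := Finset.mem_image.1 ha
      rw [ENNReal.sum_eq_top.2 ⟨k, hk, by simp⟩, expNeg_top]
    · congr 1
      refine Finset.sum_congr rfl fun k hk => Function.update_of_ne ?_ _ _
      rintro rfl
      exact ha (Finset.mem_image_of_mem _ hk)

lemma pathWeight_update_top_add_visitWeight (v : (Fin d → ℤ) → ℝ≥0∞) (y a : Fin d → ℤ)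
    (S : ℕ → Fin d → ℤ) :
    pathWeight (Function.update v a ⊤) y S + visitWeight v y a S = pathWeight v y S := by
  rw [pathWeight_update_top, visitWeight]
  split_ifs
  · rw [zero_add]
  · rw [add_zero]

lemma visitWeight_eq_sub (v : (Fin d → ℤ) → ℝ≥0∞) (y a : Fin d → ℤ) (S : ℕ → Fin d → ℤ) :
    visitWeight v y a S = pathWeight v y S - pathWeight (Function.update v a ⊤) y S := by
  rw [pathWeight_update_top, visitWeight]
  split_ifs <;> simp

lemma tsum_visitWeight (v : (Fin d → ℤ) → ℝ≥0∞) (y : Fin d → ℤ) (S : ℕ → Fin d → ℤ) :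
    ∑' a, visitWeight v y a S = (visitedSites y S).card * pathWeight v y S := by
  unfold visitWeight
  rw [tsum_eq_sum (s := visitedSites y S) fun a ha => if_neg ha, Finset.sum_ite_mem,
    Finset.inter_self, Finset.sum_const, nsmul_eq_mul]

lemma measurable_visitWeight_uncurry {β : Type*} [MeasurableSpace β]
    {v : (Fin d → ℤ) → β → ℝ≥0∞} (hv : ∀ z, Measurable (v z)) (y a : Fin d → ℤ) :
    Measurable fun q : β × (ℕ → Fin d → ℤ) => visitWeight (fun z => v z q.1) y a q.2 := by
  have hupdate (z : Fin d → ℤ) : Measurable fun b => Function.update (fun z => v z b) a ⊤ z := by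
    obtain rfl | hz := eq_or_ne z a
    · simp only [Function.update_self, measurable_const]
    · simpa only [Function.update_of_ne hz] using hv z
  simp only [visitWeight_eq_sub]
  exact (measurable_pathWeight_uncurry hv y).sub (measurable_pathWeight_uncurry hupdate y)

lemma measurable_visitWeight (v : (Fin d → ℤ) → ℝ≥0∞) (y a : Fin d → ℤ) :
    Measurable (visitWeight v y a) := by
  simp only [funext (visitWeight_eq_sub v y a)]
  exact (measurable_pathWeight _ y).sub (measurable_pathWeight _ y)

-- For the zero potential, `∑' a, visitWeight 0 y a S` counts the visited sites.
lemma measurable_card_visitedSites (y : Fin d → ℤ) :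
    Measurable fun S : ℕ → Fin d → ℤ => (visitedSites y S).card := by
  have hcard (S : ℕ → Fin d → ℤ) :
      ((visitedSites y S).card : ℝ≥0∞) = ∑' a, visitWeight (fun _ => 0) y a S := by
    rw [tsum_visitWeight]
    induction h : hitTime y S using ENat.recTopCoe with
    | top => simp [visitedSites, h]
    | coe n => simp [pathWeight_eq_expNeg h, expNeg_zero]
  refine measurable_to_countable' fun n => ?_
  have hpreimage : (fun S : ℕ → Fin d → ℤ => (visitedSites y S).card) ⁻¹' {n} =
      {S | ∑' a, visitWeight (fun _ => 0) y a S = n} := by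
    ext S
    simp [← hcard]
  rw [hpreimage]
  exact measurableSet_eq_fun (Measurable.tsum fun a => measurable_visitWeight _ y a)
    measurable_const

-- Cutting at the first visit to `a` splits the weight of the paths from `x` to `y` through `a`.
lemma green_mul_green_eq_lintegral_visitWeight [NeZero d] (v : (Fin d → ℤ) → ℝ≥0∞)
    {y a : Fin d → ℤ} (hay : a ≠ y) (x : Fin d → ℤ) :
    green srwStep ({y}ᶜ \ {a}) v (Pi.single a 1) x * green srwStep {y}ᶜ v (Pi.single y 1) a =
      ∫⁻ S, visitWeight v y a S ∂(srw x) := by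
  have hpath : quenchedZ v x y = quenchedZ (Function.update v a ⊤) x y +
      ∫⁻ S, visitWeight v y a S ∂(srw x) := by
    unfold quenchedZ
    rw [← lintegral_add_left (measurable_pathWeight _ y)]
    exact lintegral_congr fun S => (pathWeight_update_top_add_visitWeight v y a S).symm
  have hgreen : quenchedZ v x y = quenchedZ (Function.update v a ⊤) x y +
      green srwStep ({y}ᶜ \ {a}) v (Pi.single a 1) x *
        green srwStep {y}ᶜ v (Pi.single y 1) a := by
    rw [quenchedZ_eq_green, quenchedZ_eq_green, ← green_sdiff_singleton,
      green_first_entrance _ {a}, mul_comm, ← green_const_mul, ← green_add]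
    congr 1
    ext z
    obtain rfl | hz := eq_or_ne z a
    · simp [Pi.single_eq_of_ne hay]
    · simp [hz]
  have hfin : quenchedZ (Function.update v a ⊤) x y ≠ ⊤ := by
    rw [quenchedZ_eq_green]
    exact ne_top_of_le_ne_top ENNReal.one_ne_top (green_single_le_one (by simp) x)
  exact (ENNReal.add_right_inj hfin).1 (hgreen.symm.trans hpath)

lemma pathWeight_le_prod (v : (Fin d → ℤ) → ℝ≥0∞) (y : Fin d → ℤ) (S : ℕ → Fin d → ℤ) :
    pathWeight v y S ≤ ∏ z ∈ visitedSites y S, expNeg (v z) := by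
  induction h : hitTime y S using ENat.recTopCoe with
  | top => simp [pathWeight_of_hitTime_top h]
  | coe n =>
    rw [pathWeight_eq_expNeg h, ← expNeg_sum]
    simp only [visitedSites, h, ENat.toNat_natCast]
    exact expNeg_antitone (Finset.sum_image_le_of_nonneg fun _ _ => zero_le)

-- `1 + t ≤ exp t` with `t = r (-log φ) + log Z`.
lemma ofReal_neg_log_mul_le {φ Z : ℝ≥0∞} (hφ0 : φ ≠ 0) (hφ : φ ≠ ⊤) (hZ0 : Z ≠ 0) (hZ : Z ≤ 1)
    (r : ℕ) :
    ENNReal.ofReal (-Real.log φ.toReal) * r ≤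
      ENNReal.ofReal (-Real.log Z.toReal) + Z * φ⁻¹ ^ r := by
  have hZtop : Z ≠ ⊤ := ne_top_of_le_ne_top ENNReal.one_ne_top hZ
  have hφpos : 0 < φ.toReal := ENNReal.toReal_pos hφ0 hφ
  have hZpos : 0 < Z.toReal := ENNReal.toReal_pos hZ0 hZtop
  have hexp : Real.exp (-Real.log φ.toReal * r + Real.log Z.toReal) =
      Z.toReal * φ.toReal⁻¹ ^ r := by
    rw [Real.exp_add, Real.exp_log hZpos, mul_comm (-Real.log φ.toReal), Real.exp_nat_mul,
      Real.exp_neg, Real.exp_log hφpos, mul_comm]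
  have hofReal : Z * φ⁻¹ ^ r = ENNReal.ofReal (Z.toReal * φ.toReal⁻¹ ^ r) := by
    rw [ENNReal.ofReal_mul hZpos.le, ENNReal.ofReal_toReal hZtop,
      ENNReal.ofReal_pow (inv_nonneg.2 hφpos.le), ENNReal.ofReal_inv_of_pos hφpos,
      ENNReal.ofReal_toReal hφ]
  have hone := Real.add_one_le_exp (-Real.log φ.toReal * r + Real.log Z.toReal)
  rw [hexp] at hone
  rw [hofReal, ← ENNReal.ofReal_add (neg_log_toReal_nonneg hZ) (by positivity),
    ← ENNReal.ofReal_natCast r, ← ENNReal.ofReal_mul' (Nat.cast_nonneg r)]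
  exact ENNReal.ofReal_le_ofReal (by linarith)

variable {Ω : Type*} [MeasurableSpace Ω] [NeZero d] {μ : Measure Ω}
  {V : (Fin d → ℤ) → Ω → ℝ≥0∞}

/-- The annealed weight of the paths from `0` to `y` via `a`. -/
def visitMass (μ : Measure Ω) (V : (Fin d → ℤ) → Ω → ℝ≥0∞) (y a : Fin d → ℤ) : ℝ≥0∞ :=
  ∫⁻ ω, ∫⁻ S, visitWeight (fun z => V z ω) y a S ∂(srw 0) ∂μ

lemma tsum_visitMass (hV : ∀ z, Measurable (V z)) (y : Fin d → ℤ) :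
    ∑' a, visitMass μ V y a =
      ∫⁻ ω, ∫⁻ S, (visitedSites y S).card * pathWeight (fun z => V z ω) y S ∂(srw 0) ∂μ := by
  simp only [← tsum_visitWeight, visitMass]
  rw [← lintegral_tsum fun a => (measurable_visitWeight_uncurry hV y
    a).lintegral_prod_right'.aemeasurable]
  refine lintegral_congr fun ω => ?_
  rw [lintegral_tsum fun a => (measurable_visitWeight _ y a).aemeasurable]

variable [IsProbabilityMeasure μ]

lemma lintegral_pow_card_mul_pathWeight_le (hV : IsIIDField μ V) (h0 : meanExp μ V ≠ 0)
    (y : Fin d → ℤ) :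
    ∫⁻ ω, ∫⁻ S, (meanExp μ V)⁻¹ ^ (visitedSites y S).card *
      pathWeight (fun z => V z ω) y S ∂(srw 0) ∂μ ≤ 1 := by
  have hcard : Measurable fun S => (meanExp μ V)⁻¹ ^ (visitedSites y S).card :=
    (measurable_of_countable fun n : ℕ => (meanExp μ V)⁻¹ ^ n).comp
      (measurable_card_visitedSites y)
  rw [lintegral_lintegral_swap ((hcard.comp measurable_snd).mul
    (measurable_pathWeight_uncurry hV.meas y)).aemeasurable]
  have hpath (S : ℕ → Fin d → ℤ) : ∫⁻ ω, (meanExp μ V)⁻¹ ^ (visitedSites y S).card *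
      pathWeight (fun z => V z ω) y S ∂μ ≤ 1 := by
    calc _ ≤ ∫⁻ ω, (meanExp μ V)⁻¹ ^ (visitedSites y S).card *
          ∏ z ∈ visitedSites y S, expNeg (V z ω) ∂μ :=
          lintegral_mono fun ω => mul_le_mul_right (pathWeight_le_prod _ y S) _
      _ = (meanExp μ V)⁻¹ ^ (visitedSites y S).card * meanExp μ V ^ (visitedSites y S).card := by
          rw [lintegral_const_mul' _ _ (ENNReal.pow_ne_top (ENNReal.inv_ne_top.2 h0)),
            hV.lintegral_prod _ (g := fun _ => expNeg) fun _ => measurable_expNeg,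
            Finset.prod_const, meanExp]
      _ = 1 := by
          rw [← mul_pow, ENNReal.inv_mul_cancel h0
            (ne_top_of_le_ne_top ENNReal.one_ne_top meanExp_le_one), one_pow]
  calc _ ≤ ∫⁻ _, 1 ∂(srw (0 : Fin d → ℤ)) := lintegral_mono hpath
    _ = 1 := by simp

lemma tsum_visitMass_le (hV : IsIIDField μ V) (h0 : meanExp μ V ≠ 0) (y : Fin d → ℤ) :
    ENNReal.ofReal (-Real.log (meanExp μ V).toReal) * ∑' a, visitMass μ V y a ≤
      ENNReal.ofReal (-Real.log (annealedZ μ V 0 y).toReal + 1) * annealedZ μ V 0 y := by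
  set φ := meanExp μ V
  have hφ : φ ≠ ⊤ := ne_top_of_le_ne_top ENNReal.one_ne_top meanExp_le_one
  set Z := annealedZ μ V 0 y with hZ
  have hZ0 : Z ≠ 0 := annealedZ_ne_zero hV h0 y
  have hZ1 : Z ≤ 1 := annealedZ_le_one 0 y
  have hZtop : Z ≠ ⊤ := annealedZ_ne_top 0 y
  have hmeas : Measurable fun ω => ∫⁻ S, pathWeight (fun z => V z ω) y S ∂(srw 0) :=
    (measurable_pathWeight_uncurry hV.meas y).lintegral_prod_right'
  have hcard (v : (Fin d → ℤ) → ℝ≥0∞) (S : ℕ → Fin d → ℤ) :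
      ENNReal.ofReal (-Real.log φ.toReal) * ((visitedSites y S).card * pathWeight v y S) ≤
        ENNReal.ofReal (-Real.log Z.toReal) * pathWeight v y S +
          Z * (φ⁻¹ ^ (visitedSites y S).card * pathWeight v y S) := by
    rw [← mul_assoc, ← mul_assoc, ← add_mul]
    exact mul_le_mul_left (ofReal_neg_log_mul_le h0 hφ hZ0 hZ1 _) _
  calc _ = ∫⁻ ω, ∫⁻ S, ENNReal.ofReal (-Real.log φ.toReal) *
        ((visitedSites y S).card * pathWeight (fun z => V z ω) y S) ∂(srw 0) ∂μ := by
        simp only [tsum_visitMass hV.meas, lintegral_const_mul' _ _ ENNReal.ofReal_ne_top]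
    _ ≤ ∫⁻ ω, ∫⁻ S, (ENNReal.ofReal (-Real.log Z.toReal) * pathWeight (fun z => V z ω) y S +
        Z * (φ⁻¹ ^ (visitedSites y S).card * pathWeight (fun z => V z ω) y S)) ∂(srw 0) ∂μ :=
        lintegral_mono fun ω => lintegral_mono fun S => hcard _ S
    _ = ENNReal.ofReal (-Real.log Z.toReal) * Z + Z * ∫⁻ ω, ∫⁻ S,
        φ⁻¹ ^ (visitedSites y S).card * pathWeight (fun z => V z ω) y S ∂(srw 0) ∂μ := by
        simp only [lintegral_add_left ((measurable_pathWeight _ y).const_mul _),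
          lintegral_const_mul' _ _ ENNReal.ofReal_ne_top, lintegral_const_mul' _ _ hZtop]
        rw [lintegral_add_left (hmeas.const_mul _), lintegral_const_mul' _ _ ENNReal.ofReal_ne_top,
          lintegral_const_mul' _ _ hZtop, hZ, annealedZ]
        rfl
    _ ≤ ENNReal.ofReal (-Real.log Z.toReal) * Z + Z * 1 := by
        gcongr
        exact lintegral_pow_card_mul_pathWeight_le hV h0 y
    _ = _ := by
        rw [ENNReal.ofReal_add (neg_log_toReal_nonneg hZ1) zero_le_one, ENNReal.ofReal_one]
        ring

end Range

/-! ### Local comparison of the time spent with the number of visited sites -/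

section Box

/-- The sup-norm ball of radius `r` around `z`; it is empty for `r < 0`. -/
def latticeBox (z : Fin d → ℤ) (r : ℤ) : Finset (Fin d → ℤ) :=
  Finset.Icc (fun i => z i - r) fun i => z i + r

variable {z x : Fin d → ℤ} {r : ℤ}

lemma mem_latticeBox : x ∈ latticeBox z r ↔ ∀ i, z i - r ≤ x i ∧ x i ≤ z i + r := by
  simp only [latticeBox, Finset.mem_Icc, Pi.le_def, forall_and]

lemma mem_latticeBox_comm : x ∈ latticeBox z r ↔ z ∈ latticeBox x r := by
  simp only [mem_latticeBox]
  exact forall_congr' fun i => by lia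

lemma self_mem_latticeBox (z : Fin d → ℤ) (k : ℕ) : z ∈ latticeBox z k :=
  mem_latticeBox.2 fun i => by lia

lemma card_latticeBox (z : Fin d → ℤ) (r : ℤ) : (latticeBox z r).card = (2 * r + 1).toNat ^ d := by
  have hside (i : Fin d) : (Finset.Icc (z i - r) (z i + r)).card = (2 * r + 1).toNat := by
    rw [Int.card_Icc]
    congr 1
    ring
  simp [latticeBox, Pi.card_Icc, hside]

lemma latticeDist_le_of_mem_latticeBox {a b : Fin d → ℤ} {k : ℕ} (ha : a ∈ latticeBox z k)
    (hb : b ∈ latticeBox z k) : latticeDist a b ≤ d * (2 * k) := by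
  unfold latticeDist
  calc _ ≤ ∑ _i : Fin d, 2 * k := Finset.sum_le_sum fun i _ => by
        have hai := mem_latticeBox.1 ha i
        have hbi := mem_latticeBox.1 hb i
        lia
    _ = d * (2 * k) := by simp

end Box

section TimeSum

lemma tsum_mul_natCast (a : ℕ → ℝ≥0∞) : ∑' n : ℕ, a n * n = ∑' j, ∑' m, a (m + (j + 1)) := by
  have hcount (n : ℕ) : a n * n = ∑' j : ℕ, if j < n then a n else 0 := by
    rw [tsum_eq_sum (s := Finset.range n) fun j hj => if_neg fun h => hj (Finset.mem_range.2 h),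
      Finset.sum_congr rfl fun j hj => if_pos (Finset.mem_range.1 hj), Finset.sum_const,
      Finset.card_range, nsmul_eq_mul, mul_comm]
  have htail (j : ℕ) : ∑' n, (if j < n then a n else 0) = ∑' m, a (m + (j + 1)) := by
    rw [← Summable.sum_add_tsum_nat_add' (k := j + 1) ENNReal.summable, Finset.sum_eq_zero,
      zero_add]
    · exact tsum_congr fun m => if_pos (by lia)
    · exact fun n hn => if_neg (by have := Finset.mem_range.1 hn; lia)
  simp only [hcount]
  rw [ENNReal.tsum_comm]
  exact tsum_congr htail

variable {α : Type*} {p : α → PMF α} {A : Set α} {v f : α → ℝ≥0∞}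

lemma tsum_killedStep_iterate_mul_natCast (x : α) :
    ∑' n : ℕ, (killedStep p A v)^[n] f x * n =
      green p A v (killedStep p A v (green p A v f)) x := by
  have hstep : killedStep p A v (green p A v f) =
      fun z => ∑' m, (killedStep p A v)^[m + 1] f z := by
    rw [show green p A v f = fun z => ∑' n, (killedStep p A v)^[n] f z from rfl, killedStep_tsum]
    simp only [Function.iterate_succ_apply']
  rw [tsum_mul_natCast, hstep]
  simp only [green, killedStep_iterate_tsum, ← Function.iterate_add_apply]
  exact tsum_congr fun j => tsum_congr fun m => by rw [add_left_comm]

variable [DecidableEq α]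

/-- The expected time spent at `z ≠ y` before the chain started at `x` hits `y`, on the event that
it does so and weighted by the potential. -/
def siteTime (p : α → PMF α) (v : α → ℝ≥0∞) (x y z : α) : ℝ≥0∞ :=
  if z = y then 0 else green p {y}ᶜ v (Pi.single z 1) x * green p {y}ᶜ v (Pi.single y 1) z

lemma tsum_hit_mul_natCast_le (v : α → ℝ≥0∞) (x y : α) :
    ∑' n : ℕ, (killedStep p {y}ᶜ v)^[n] (Pi.single y 1) x * n ≤ ∑' z, siteTime p v x y z := by
  rw [tsum_killedStep_iterate_mul_natCast, green_eq_tsum]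
  refine ENNReal.tsum_le_tsum fun z => ?_
  unfold siteTime
  split_ifs with h
  · rw [killedStep_of_notMem (by simpa using h), zero_mul]
  · rw [mul_comm]
    gcongr
    conv_rhs => rw [green_eq]
    exact le_add_self

lemma green_le_entrance {y z : α} {B : Finset α} (hz : z ∈ B) (hzy : z ≠ y)
    {Γ : ℝ≥0∞} (hΓ : ∀ a, green p {y}ᶜ v (Pi.single z 1) a ≤ Γ) (x : α) :
    green p {y}ᶜ v (Pi.single z 1) x ≤
      Γ * ∑ a ∈ B.erase y, green p ({y}ᶜ \ (B : Set α)) v (Pi.single a 1) x := by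
  classical
  rw [green_first_entrance _ (B : Set α), green_eq_tsum, Finset.mul_sum,
    tsum_eq_sum (s := B.erase y)]
  · refine Finset.sum_le_sum fun a ha => ?_
    rw [if_pos (Finset.mem_coe.2 (Finset.mem_of_mem_erase ha))]
    gcongr
    exact hΓ a
  · intro a ha
    by_cases haB : a ∈ B
    · obtain rfl : a = y := by
        by_contra h
        exact ha (Finset.mem_erase.2 ⟨h, haB⟩)
      rw [if_pos (Finset.mem_coe.2 haB), green_of_notMem (by simp), Pi.single_eq_of_ne hzy.symm,
        zero_mul]
    · rw [if_neg (by simpa using haB), Pi.single_eq_of_ne (ne_of_mem_of_not_mem hz haB).symm,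
        zero_mul]

/-- The weight of going from `b ∈ B` to `y` without returning to `B`. The weight of the site `b`
itself is not included, so that `exitWeight p B v y b` does not depend on the potential in `B`. -/
def exitWeight (p : α → PMF α) (B : Finset α) (v : α → ℝ≥0∞) (y b : α) : ℝ≥0∞ :=
  if y ∈ B then Pi.single (M := fun _ => ℝ≥0∞) y 1 b
  else markovOp p (green p ({y}ᶜ \ (B : Set α)) v (Pi.single y 1)) b

lemma green_le_exitWeight {y z : α} {B : Finset α} (hz : z ∈ B) (hzy : z ≠ y)
    {Γ : ℝ≥0∞} (hΓ : ∀ b ∈ B, green p {y}ᶜ v (Pi.single b 1) z ≤ Γ) :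
    green p {y}ᶜ v (Pi.single y 1) z ≤ Γ * ∑ b ∈ B, exitWeight p B v y b := by
  by_cases hy : y ∈ B
  · have hΓ1 : 1 ≤ Γ := by
      refine le_trans ?_ (hΓ z hz)
      simpa using le_green (p := p) (A := {y}ᶜ) (v := v) (f := Pi.single z 1) z
    have hsum1 : 1 ≤ ∑ b ∈ B, exitWeight p B v y b := by
      refine le_trans ?_ (Finset.single_le_sum (fun _ _ => zero_le) hy)
      simp [exitWeight, hy]
    exact (green_single_le_one (by simp) z).trans (one_le_mul hΓ1 hsum1)
  · refine (green_le_last_exit _ (B : Set α) v _ z).trans ?_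
    rw [green_of_notMem (A := {y}ᶜ \ (B : Set α)) (fun h => h.2 (Finset.mem_coe.2 hz)),
      Pi.single_eq_of_ne hzy, zero_add, green_eq_tsum, Finset.mul_sum, tsum_eq_sum (s := B)]
    · refine Finset.sum_le_sum fun b hb => ?_
      rw [Set.indicator_of_mem (Finset.mem_coe.2 hb), mul_comm, exitWeight, if_neg hy]
      refine mul_le_mul' (hΓ b hb) ((killedStep_le_expNeg_mul b).trans ?_)
      exact mul_le_of_le_one_left' (expNeg_le_one _)
    · intro b hb
      rw [Set.indicator_of_notMem (by simpa using hb), zero_mul]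

lemma expNeg_mul_exitWeight_le (B : Finset α) (v : α → ℝ≥0∞) (y b : α) :
    expNeg (v b) * exitWeight p B v y b ≤ green p {y}ᶜ v (Pi.single y 1) b := by
  unfold exitWeight
  split_ifs with hy
  · exact (mul_le_of_le_one_left' (expNeg_le_one _)).trans (le_green b)
  · refine le_trans ?_ (green_compl_singleton_superharmonic y b)
    gcongr
    exact markovOp_mono (green_mono_set Set.sdiff_subset) b

/-- The weight of going from `x` to `a ∈ B` before entering `B`, and from `b ∈ B` to `y` without
returning to `B`. It does not depend on the potential in `B`. -/
def outerWeight (p : α → PMF α) (B : Finset α) (v : α → ℝ≥0∞) (x y a b : α) : ℝ≥0∞ :=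
  green p ({y}ᶜ \ (B : Set α)) v (Pi.single a 1) x * exitWeight p B v y b

/-- The weight of going from `a` to `b` inside `B`, the site `b` included. -/
def innerWeight (p : α → PMF α) (B : Finset α) (v : α → ℝ≥0∞) (a b : α) : ℝ≥0∞ :=
  green p ((B : Set α) \ {b}) v (Pi.single b 1) a * expNeg (v b)

lemma innerWeight_le_one (B : Finset α) (v : α → ℝ≥0∞) (a b : α) : innerWeight p B v a b ≤ 1 :=
  mul_le_one' (green_single_le_one (by simp) a) (expNeg_le_one _)

-- The part of a path between its first entrance into `B` and its last exit from `B` is replaced by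
-- a path inside `B` from `a` to `b`.
lemma outerWeight_mul_innerWeight_le {y a : α} {B : Finset α} (ha : a ∈ B) (b x : α) :
    outerWeight p B v x y a b * innerWeight p B v a b ≤
      green p ({y}ᶜ \ {a}) v (Pi.single a 1) x * green p {y}ᶜ v (Pi.single y 1) a := by
  unfold outerWeight innerWeight
  calc _ = green p ({y}ᶜ \ (B : Set α)) v (Pi.single a 1) x *
        (green p ((B : Set α) \ {b}) v (Pi.single b 1) a *
          (expNeg (v b) * exitWeight p B v y b)) := by ring
    _ ≤ green p ({y}ᶜ \ {a}) v (Pi.single a 1) x *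
        (green p ((B : Set α) \ {b}) v (Pi.single b 1) a *
          green p {y}ᶜ v (Pi.single y 1) b) := by
        gcongr
        · refine green_mono_set (Set.sdiff_subset_sdiff_right ?_) x
          simpa using ha
        · exact expNeg_mul_exitWeight_le B v y b
    _ ≤ _ := by
        gcongr
        exact green_single_mul_le (by simp) (fun z _ => green_compl_singleton_superharmonic y z) a

lemma siteTime_le {y z : α} {B : Finset α} (hz : z ∈ B) {Γ : ℝ≥0∞}
    (hΓ : ∀ b ∈ B, ∀ x, green p {y}ᶜ v (Pi.single b 1) x ≤ Γ) (x : α) :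
    siteTime p v x y z ≤ Γ ^ 2 * ∑ a ∈ B.erase y, ∑ b ∈ B, outerWeight p B v x y a b := by
  unfold siteTime
  split_ifs with hzy
  · exact zero_le
  calc _ ≤ (Γ * ∑ a ∈ B.erase y, green p ({y}ᶜ \ (B : Set α)) v (Pi.single a 1) x) *
        (Γ * ∑ b ∈ B, exitWeight p B v y b) := by
        gcongr
        · exact green_le_entrance hz hzy (hΓ z hz) x
        · exact green_le_exitWeight hz hzy fun b hb => hΓ b hb z
    _ = _ := by
        simp only [outerWeight]
        rw [← Finset.sum_mul_sum]
        ring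

end TimeSum

section Local

variable {Ω : Type*} {V : (Fin d → ℤ) → Ω → ℝ≥0∞}

/-- The event that the box of radius `k` around `z` is the smallest one which contains a site where
the potential is at least `v₀`. -/
def firstObstacle (V : (Fin d → ℤ) → Ω → ℝ≥0∞) (v₀ : ℝ≥0∞) (z : Fin d → ℤ) (k : ℕ) : Set Ω :=
  {ω | (∀ x ∈ latticeBox z (k - 1), V x ω < v₀) ∧ ∃ w ∈ latticeBox z k, v₀ ≤ V w ω}

lemma measurableSet_firstObstacle (v₀ : ℝ≥0∞) (z : Fin d → ℤ) (k : ℕ) :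
    MeasurableSet[sitesAlgebra V (latticeBox z k)] (firstObstacle V v₀ z k) := by
  have hsub (x : Fin d → ℤ) (hx : x ∈ latticeBox z (k - 1)) : x ∈ latticeBox z k := by
    rw [mem_latticeBox] at hx ⊢
    exact fun i => by have := hx i; lia
  have hset : firstObstacle V v₀ z k = (⋂ x ∈ latticeBox z (k - 1), V x ⁻¹' Set.Iio v₀) ∩
      ⋃ w ∈ latticeBox z k, V w ⁻¹' Set.Ici v₀ := by
    ext ω
    simp [firstObstacle]
  rw [hset]
  refine MeasurableSet.inter (Finset.measurableSet_biInter _ fun x hx => ?_)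
    (Finset.measurableSet_biUnion _ fun x hx => ?_)
  · exact measurable_sitesAlgebra (Finset.mem_coe.2 (hsub x hx)) measurableSet_Iio
  · exact measurable_sitesAlgebra (Finset.mem_coe.2 hx) measurableSet_Ici

lemma exists_firstObstacle [NeZero d] {v₀ : ℝ≥0∞} {ω : Ω} (h : ∃ x, v₀ ≤ V x ω)
    (z : Fin d → ℤ) : ∃ k, ω ∈ firstObstacle V v₀ z k := by
  classical
  obtain ⟨x, hx⟩ := h
  have hex : ∃ k : ℕ, ∃ w ∈ latticeBox z k, v₀ ≤ V w ω := by
    refine ⟨∑ i, (x i - z i).natAbs, x, mem_latticeBox.2 fun i => ?_, hx⟩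
    have := Finset.single_le_sum (f := fun i => (x i - z i).natAbs) (fun i _ => Nat.zero_le _)
      (Finset.mem_univ i)
    lia
  refine ⟨Nat.find hex, fun w hw => ?_, Nat.find_spec hex⟩
  by_contra hlt
  obtain h0 | hpos := Nat.eq_zero_or_pos (Nat.find hex)
  · have hw0 := mem_latticeBox.1 hw 0
    rw [h0] at hw0
    push_cast at hw0
    lia
  · refine Nat.find_min hex (Nat.sub_lt hpos one_pos) ⟨w, ?_, not_lt.1 hlt⟩
    rwa [Nat.cast_sub (show 1 ≤ Nat.find hex from hpos), Nat.cast_one]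

section Measurability

variable {α : Type*} [Countable α] [DecidableEq α] {p : α → PMF α} {V : α → Ω → ℝ≥0∞}

lemma measurable_siteTime [MeasurableSpace Ω] (hV : ∀ z, Measurable (V z)) (x y z : α) :
    Measurable fun ω => siteTime p (fun z => V z ω) x y z := by
  unfold siteTime
  split_ifs
  · exact measurable_const
  · exact (measurable_green (fun z _ => hV z) _ x).mul (measurable_green (fun z _ => hV z) _ z)

lemma measurable_exitWeight (B : Finset α) (y b : α) :
    Measurable[sitesAlgebra V (B : Set α)ᶜ] fun ω => exitWeight p B (fun z => V z ω) y b := by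
  unfold exitWeight
  split_ifs
  · exact measurable_const
  · exact measurable_markovOp (fun z => measurable_green
      (fun x hx => measurable_sitesAlgebra hx.2) _ _) b

lemma measurable_outerWeight (B : Finset α) (x y a b : α) :
    Measurable[sitesAlgebra V (B : Set α)ᶜ] fun ω =>
      outerWeight p B (fun z => V z ω) x y a b :=
  (measurable_green (fun _ hz => measurable_sitesAlgebra hz.2) _ x).mul
    (measurable_exitWeight B y b)

lemma measurable_innerWeight {B : Finset α} {b : α} (hb : b ∈ B) (a : α) :
    Measurable[sitesAlgebra V (B : Set α)] fun ω => innerWeight p B (fun z => V z ω) a b :=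
  (measurable_green (fun _ hz => measurable_sitesAlgebra hz.1) _ a).mul
    (measurable_expNeg.comp (measurable_sitesAlgebra (Finset.mem_coe.2 hb)))

end Measurability

variable [MeasurableSpace Ω] {μ : Measure Ω}

lemma measure_forall_lt {ι : Type*} [Zero ι] {V : ι → Ω → ℝ≥0∞} (hV : IsIIDField μ V)
    (v₀ : ℝ≥0∞) (s : Finset ι) :
    μ {ω | ∀ x ∈ s, V x ω < v₀} = μ {ω | V 0 ω < v₀} ^ s.card := by
  have hset : {ω | ∀ x ∈ s, V x ω < v₀} = ⋂ x ∈ s, V x ⁻¹' Set.Iio v₀ := by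
    ext ω
    simp
  rw [hset, hV.indep.measure_inter_preimage_eq_mul s fun _ _ => measurableSet_Iio,
    ← Finset.prod_const]
  exact Finset.prod_congr rfl fun x _ => (hV.ident x).measure_mem_eq measurableSet_Iio

lemma measure_firstObstacle_le (hV : IsIIDField μ V) (v₀ : ℝ≥0∞) (z : Fin d → ℤ) (k : ℕ) :
    μ (firstObstacle V v₀ z k) ≤ μ {ω | V 0 ω < v₀} ^ ((2 * k - 1) ^ d) := by
  have hsub : firstObstacle V v₀ z k ⊆ {ω | ∀ x ∈ latticeBox z (k - 1), V x ω < v₀} :=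
    fun ω hω => hω.1
  refine (measure_mono hsub).trans (le_of_eq ?_)
  rw [measure_forall_lt hV, card_latticeBox]
  congr 2
  lia

end Local

section Comparison

lemma cast_card_latticeBox (z : Fin d → ℤ) (k : ℕ) :
    ((latticeBox z k).card : ℝ≥0∞) = (2 * k + 1) ^ d := by
  rw [card_latticeBox, show (2 * (k : ℤ) + 1).toNat = 2 * k + 1 by lia]
  push_cast
  rfl

lemma tsum_sum_latticeBox (f : (Fin d → ℤ) → ℝ≥0∞) (k : ℕ) :
    ∑' z, ∑ a ∈ latticeBox z k, f a = (2 * k + 1) ^ d * ∑' a, f a := by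
  have hswap (z : Fin d → ℤ) :
      ∑ a ∈ latticeBox z k, f a = ∑' a, if z ∈ latticeBox a k then f a else 0 := by
    rw [tsum_eq_sum (s := latticeBox z k) fun a ha => if_neg fun h => ha (mem_latticeBox_comm.1 h)]
    exact Finset.sum_congr rfl fun a ha => (if_pos (mem_latticeBox_comm.1 ha)).symm
  simp only [hswap]
  rw [ENNReal.tsum_comm, ← ENNReal.tsum_mul_left]
  refine tsum_congr fun a => ?_
  rw [tsum_eq_sum (s := latticeBox a k) fun z hz => if_neg hz,
    Finset.sum_congr rfl fun z hz => if_pos hz, Finset.sum_const, nsmul_eq_mul,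
    cast_card_latticeBox]

variable {Ω : Type*} [MeasurableSpace Ω] {μ : Measure Ω}

lemma ae_exists_le {ι : Type*} [Zero ι] [Infinite ι] {V : ι → Ω → ℝ≥0∞} (hV : IsIIDField μ V)
    {v₀ : ℝ≥0∞} (hq : μ {ω | V 0 ω < v₀} < 1) : ∀ᵐ ω ∂μ, ∃ x, v₀ ≤ V x ω := by
  have hle (k : ℕ) : μ {ω | ¬ ∃ x, v₀ ≤ V x ω} ≤ μ {ω | V 0 ω < v₀} ^ k := by
    obtain ⟨s, hs⟩ := Infinite.exists_subset_card_eq ι k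
    rw [← hs, ← measure_forall_lt hV]
    exact measure_mono fun ω hω x _ => not_le.1 fun h => hω ⟨x, h⟩
  exact le_antisymm (ge_of_tendsto' (ENNReal.tendsto_pow_atTop_nhds_zero_of_lt_one hq) hle)
    zero_le

variable [NeZero d] {V : (Fin d → ℤ) → Ω → ℝ≥0∞}

lemma tsum_crossMass_mul_natCast (hV : ∀ z, Measurable (V z)) (y : Fin d → ℤ) :
    ∑' n : ℕ, crossMass μ V y n * n =
      ∫⁻ ω, ∑' n : ℕ,
        (killedStep srwStep {y}ᶜ fun z => V z ω)^[n] (Pi.single y 1) 0 * n ∂μ := by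
  have hmeas (n : ℕ) : Measurable fun ω =>
      (killedStep srwStep {y}ᶜ fun z => V z ω)^[n] (Pi.single y 1) 0 :=
    measurable_killedStep_iterate (fun z _ => hV z) _ n 0
  rw [lintegral_tsum fun n => ((hmeas n).mul_const _).aemeasurable]
  exact tsum_congr fun n => (lintegral_mul_const _ (hmeas n)).symm

variable {v₀ : ℝ≥0∞}

lemma lintegral_siteTime_le (hV : IsIIDField μ V) (hq : μ {ω | V 0 ω < v₀} < 1)
    (y z : Fin d → ℤ) :
    ∫⁻ ω, siteTime srwStep (fun z => V z ω) 0 y z ∂μ ≤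
      ∑' k, ∫⁻ ω in firstObstacle V v₀ z k, siteTime srwStep (fun z => V z ω) 0 y z ∂μ := by
  have hcover : (⋃ k, firstObstacle V v₀ z k) =ᵐ[μ] Set.univ := by
    refine eventuallyEq_univ.2 ?_
    filter_upwards [ae_exists_le hV hq] with ω hω
    exact Set.mem_iUnion.2 (exists_firstObstacle hω z)
  rw [← setLIntegral_univ, ← setLIntegral_congr hcover]
  exact lintegral_iUnion_le _ _

variable [IsProbabilityMeasure μ]

-- The weights inside and outside `B` are independent.
lemma lintegral_outerWeight_le (hV : IsIIDField μ V) {y a b : Fin d → ℤ} (hay : a ≠ y)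
    {B : Finset (Fin d → ℤ)} (ha : a ∈ B) (hb : b ∈ B) {θ : ℝ≥0∞} (hθ0 : θ ≠ 0)
    (hθ : θ ≤ ∫⁻ ω, innerWeight srwStep B (fun z => V z ω) a b ∂μ) :
    ∫⁻ ω, outerWeight srwStep B (fun z => V z ω) 0 y a b ∂μ ≤ θ⁻¹ * visitMass μ V y a := by
  have hθtop : θ ≠ ⊤ := by
    refine ne_top_of_le_ne_top ENNReal.one_ne_top (hθ.trans ?_)
    calc _ ≤ ∫⁻ _, 1 ∂μ := lintegral_mono fun ω => innerWeight_le_one B _ a b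
      _ = 1 := by simp
  rw [← ENNReal.mul_le_iff_le_inv hθ0 hθtop]
  calc _ ≤ (∫⁻ ω, outerWeight srwStep B (fun z => V z ω) 0 y a b ∂μ) *
        ∫⁻ ω, innerWeight srwStep B (fun z => V z ω) a b ∂μ := by rw [mul_comm]; gcongr
    _ = ∫⁻ ω, outerWeight srwStep B (fun z => V z ω) 0 y a b *
        innerWeight srwStep B (fun z => V z ω) a b ∂μ :=
        (hV.lintegral_mul disjoint_compl_left (measurable_outerWeight B 0 y a b)
          (measurable_innerWeight hb a)).symm
    _ ≤ _ := lintegral_mono fun ω =>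
        (outerWeight_mul_innerWeight_le ha b 0).trans_eq
          (green_mul_green_eq_lintegral_visitWeight _ hay 0)

variable {y z : Fin d → ℤ}

lemma setLIntegral_firstObstacle_outerWeight_le (hV : IsIIDField μ V) {k : ℕ}
    {a b : Fin d → ℤ} (hay : a ≠ y) (ha : a ∈ latticeBox z k) (hb : b ∈ latticeBox z k)
    {θ : ℝ≥0∞} (hθ0 : θ ≠ 0)
    (hθ : θ ≤ ∫⁻ ω, innerWeight srwStep (latticeBox z k) (fun z => V z ω) a b ∂μ) :
    ∫⁻ ω in firstObstacle V v₀ z k,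
        outerWeight srwStep (latticeBox z k) (fun z => V z ω) 0 y a b ∂μ ≤
      μ {ω | V 0 ω < v₀} ^ ((2 * k - 1) ^ d) * (θ⁻¹ * visitMass μ V y a) := by
  have hF := measurableSet_firstObstacle (V := V) v₀ z k
  have hFm := hV.sitesAlgebra_le _ _ hF
  have hone : Measurable[sitesAlgebra V (latticeBox z k : Set (Fin d → ℤ))]
      ((firstObstacle V v₀ z k).indicator (1 : Ω → ℝ≥0∞)) :=
    Measurable.indicator (f := fun _ => (1 : ℝ≥0∞)) measurable_const hF
  calc _ = ∫⁻ ω, (firstObstacle V v₀ z k).indicator 1 ω *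
        outerWeight srwStep (latticeBox z k) (fun z => V z ω) 0 y a b ∂μ := by
        rw [← lintegral_indicator hFm]
        refine lintegral_congr fun ω => ?_
        by_cases hω : ω ∈ firstObstacle V v₀ z k <;> simp [hω]
    _ = μ (firstObstacle V v₀ z k) *
        ∫⁻ ω, outerWeight srwStep (latticeBox z k) (fun z => V z ω) 0 y a b ∂μ := by
        rw [hV.lintegral_mul disjoint_compl_right hone (measurable_outerWeight _ 0 y a b),
          lintegral_indicator_one hFm]
    _ ≤ _ := by
        gcongr
        · exact measure_firstObstacle_le hV v₀ z k
        · exact lintegral_outerWeight_le hV hay ha hb hθ0 hθ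

lemma setLIntegral_firstObstacle_siteTime_le (hV : IsIIDField μ V) (k : ℕ) {Γ θ : ℝ≥0∞}
    (hΓ : ∀ v : (Fin d → ℤ) → ℝ≥0∞, (∃ w ∈ latticeBox z k, v₀ ≤ v w) → ∀ b ∈ latticeBox z k,
      ∀ x, green srwStep {y}ᶜ v (Pi.single b 1) x ≤ Γ)
    (hθ0 : θ ≠ 0)
    (hθ : ∀ a ∈ latticeBox z k, ∀ b ∈ latticeBox z k,
      θ ≤ ∫⁻ ω, innerWeight srwStep (latticeBox z k) (fun z => V z ω) a b ∂μ) :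
    ∫⁻ ω in firstObstacle V v₀ z k, siteTime srwStep (fun z => V z ω) 0 y z ∂μ ≤
      Γ ^ 2 * μ {ω | V 0 ω < v₀} ^ ((2 * k - 1) ^ d) * θ⁻¹ * (2 * k + 1) ^ d *
        ∑ a ∈ latticeBox z k, visitMass μ V y a := by
  set B := latticeBox z k
  set q := μ {ω | V 0 ω < v₀}
  have hFm : MeasurableSet (firstObstacle V v₀ z k) :=
    hV.sitesAlgebra_le _ _ (measurableSet_firstObstacle v₀ z k)
  have hmeas (a b : Fin d → ℤ) : Measurable fun ω =>
      outerWeight srwStep B (fun z => V z ω) 0 y a b :=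
    (measurable_outerWeight B 0 y a b).mono (hV.sitesAlgebra_le _) le_rfl
  calc _ ≤ ∫⁻ ω in firstObstacle V v₀ z k, Γ ^ 2 * ∑ a ∈ B.erase y, ∑ b ∈ B,
        outerWeight srwStep B (fun z => V z ω) 0 y a b ∂μ :=
        setLIntegral_mono' hFm fun ω hω =>
          siteTime_le (self_mem_latticeBox z k) (hΓ (fun z => V z ω) hω.2) 0
    _ = Γ ^ 2 * ∑ a ∈ B.erase y, ∑ b ∈ B, ∫⁻ ω in firstObstacle V v₀ z k,
        outerWeight srwStep B (fun z => V z ω) 0 y a b ∂μ := by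
        have hsum (a : Fin d → ℤ) : Measurable fun ω =>
            ∑ b ∈ B, outerWeight srwStep B (fun z => V z ω) 0 y a b :=
          Finset.measurable_fun_sum _ fun b _ => hmeas a b
        rw [lintegral_const_mul _ (Finset.measurable_fun_sum _ fun a _ => hsum a),
          lintegral_finsetSum _ fun a _ => hsum a]
        congr! 2 with a
        exact lintegral_finsetSum _ fun b _ => hmeas a b
    _ ≤ Γ ^ 2 * ∑ a ∈ B.erase y, ∑ _b ∈ B, q ^ ((2 * k - 1) ^ d) * (θ⁻¹ * visitMass μ V y a) := by
        gcongr with a ha b hb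
        rw [Finset.mem_erase] at ha
        exact setLIntegral_firstObstacle_outerWeight_le hV ha.1 ha.2 hb hθ0 (hθ a ha.2 b hb)
    _ ≤ Γ ^ 2 * ∑ a ∈ B, ∑ _b ∈ B, q ^ ((2 * k - 1) ^ d) * (θ⁻¹ * visitMass μ V y a) := by
        gcongr
        exact Finset.erase_subset _ _
    _ = _ := by
        simp only [Finset.sum_const, nsmul_eq_mul, ← Finset.mul_sum, cast_card_latticeBox, B]
        ring

lemma tsum_crossMass_mul_le (hV : IsIIDField μ V) (hq : μ {ω | V 0 ω < v₀} < 1)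
    {Γ θ : ℕ → ℝ≥0∞}
    (hΓ : ∀ (y z : Fin d → ℤ) (k : ℕ) (v : (Fin d → ℤ) → ℝ≥0∞),
      (∃ w ∈ latticeBox z k, v₀ ≤ v w) → ∀ b ∈ latticeBox z k,
      ∀ x, green srwStep {y}ᶜ v (Pi.single b 1) x ≤ Γ k)
    (hθ0 : ∀ k, θ k ≠ 0)
    (hθ : ∀ (z : Fin d → ℤ) (k : ℕ), ∀ a ∈ latticeBox z k, ∀ b ∈ latticeBox z k,
      θ k ≤ ∫⁻ ω, innerWeight srwStep (latticeBox z k) (fun z => V z ω) a b ∂μ)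
    (y : Fin d → ℤ) :
    ∑' n : ℕ, crossMass μ V y n * n ≤
      (∑' k : ℕ, Γ k ^ 2 * μ {ω | V 0 ω < v₀} ^ ((2 * k - 1) ^ d) * (θ k)⁻¹ *
        ((2 * k + 1) ^ d) ^ 2) * ∑' a, visitMass μ V y a := by
  set c : ℕ → ℝ≥0∞ := fun k =>
    Γ k ^ 2 * μ {ω | V 0 ω < v₀} ^ ((2 * k - 1) ^ d) * (θ k)⁻¹ * (2 * k + 1) ^ d with hc
  calc ∑' n : ℕ, crossMass μ V y n * n
      ≤ ∫⁻ ω, ∑' z, siteTime srwStep (fun z => V z ω) 0 y z ∂μ := by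
        rw [tsum_crossMass_mul_natCast hV.meas]
        exact lintegral_mono fun ω => tsum_hit_mul_natCast_le _ 0 y
    _ = ∑' z, ∫⁻ ω, siteTime srwStep (fun z => V z ω) 0 y z ∂μ :=
        lintegral_tsum fun z => (measurable_siteTime hV.meas 0 y z).aemeasurable
    _ ≤ ∑' z, ∑' k, c k * ∑ a ∈ latticeBox z k, visitMass μ V y a :=
        ENNReal.tsum_le_tsum fun z => (lintegral_siteTime_le hV hq y z).trans <|
          ENNReal.tsum_le_tsum fun k =>
            setLIntegral_firstObstacle_siteTime_le hV k (hΓ y z k) (hθ0 k) (hθ z k)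
    _ = ∑' k, c k * ((2 * k + 1) ^ d * ∑' a, visitMass μ V y a) := by
        rw [ENNReal.tsum_comm]
        simp only [ENNReal.tsum_mul_left, tsum_sum_latticeBox]
    _ = _ := by
        rw [← ENNReal.tsum_mul_right]
        refine tsum_congr fun k => ?_
        simp only [hc]
        ring

end Comparison

/-! ### Dimension at least two -/

section Barrier

lemma one_sub_expNeg_ne_zero {a : ℝ≥0∞} (ha : a ≠ 0) : 1 - expNeg a ≠ 0 :=
  (tsub_pos_of_lt (expNeg_lt_one ha)).ne'

-- The walk started at `b` reaches `w` along a shortest path, without returning to `b`, with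
-- probability at least `(2d) ^ -|b - w|`, and is then killed.
lemma green_single_le_of_obstacle [NeZero d] {A : Set (Fin d → ℤ)} {v : (Fin d → ℤ) → ℝ≥0∞}
    {v₀ : ℝ≥0∞} (hv₀ : v₀ ≠ 0) {w : Fin d → ℤ} (hw : v₀ ≤ v w) (b x : Fin d → ℤ) :
    green srwStep A v (Pi.single b 1) x ≤
      ((1 - expNeg v₀) * (2 * d : ℝ≥0∞)⁻¹ ^ latticeDist b w)⁻¹ := by
  set ε := 1 - expNeg v₀
  set ι := (2 * d : ℝ≥0∞)⁻¹
  have hεw : ε ≤ 1 - expNeg (v w) := tsub_le_tsub_left (expNeg_antitone hw) 1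
  have hι0 : ι ≠ 0 := ENNReal.inv_ne_zero.2 (ENNReal.mul_ne_top (by simp) (by simp))
  let ψ : (Fin d → ℤ) → ℝ≥0∞ := fun x =>
    if latticeDist x w < latticeDist b w then ε * ι ^ latticeDist x w else 0
  have hbarrier (x : Fin d → ℤ) (hxb : latticeDist x w ≤ latticeDist b w) :
      ε * ι ^ latticeDist x w ≤ markovOp srwStep ψ x ∨
        ε * ι ^ latticeDist x w ≤ 1 - expNeg (v x) := by
    obtain rfl | hx := eq_or_ne x w
    · right
      rwa [latticeDist_self, pow_zero, mul_one]
    · left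
      obtain ⟨s, hs, -, -⟩ := exists_unitStep_closer hx
      refine le_trans (le_of_eq ?_) (le_markovOp_srwStep ψ x s)
      simp only [ψ]
      rw [if_pos (by lia), ← hs, pow_succ]
      ring
  refine green_single_le_of_barrier
    (mul_ne_zero (one_sub_expNeg_ne_zero hv₀) (pow_ne_zero _ hι0)) ψ
    (fun x => ?_) (by simp [ψ]) (fun x _ => ?_) (hbarrier b le_rfl) x
  · simp only [ψ]
    split_ifs
    · exact mul_le_one' tsub_le_self (pow_le_one₀ zero_le two_mul_inv_le_one)
    · exact zero_le
  · by_cases hx : latticeDist x w < latticeDist b w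
    · simpa only [ψ, if_pos hx] using hbarrier x hx.le
    · left
      simp only [ψ, if_neg hx]
      exact zero_le

end Barrier

section Series

lemma two_mul_add_one_le_three_pow (k : ℕ) : 2 * k + 1 ≤ 3 ^ k := by
  induction k with
  | zero => simp
  | succ k ih => rw [pow_succ]; lia

lemma tsum_pow_mul_pow_sq_ne_top {M q : ℝ≥0∞} (hM : M ≠ ⊤) (hq : q < 1) :
    ∑' k : ℕ, M ^ k * q ^ (k ^ 2) ≠ ⊤ := by
  have hlim : Tendsto (fun k : ℕ => M * q ^ k) atTop (𝓝 0) := by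
    simpa only [mul_zero] using
      ENNReal.Tendsto.const_mul (ENNReal.tendsto_pow_atTop_nhds_zero_of_lt_one hq) (Or.inr hM)
  obtain ⟨N, hN⟩ := eventually_atTop.1 (hlim.eventually_le_const (u := (2 : ℝ≥0∞)⁻¹) (by simp))
  rw [← ENNReal.summable.sum_add_tsum_nat_add' (k := N)]
  refine ENNReal.add_ne_top.2 ⟨ENNReal.sum_ne_top.2 fun k _ => ENNReal.mul_ne_top
    (ENNReal.pow_ne_top hM) (ENNReal.pow_ne_top hq.ne_top), ?_⟩
  have hgeom (k : ℕ) : M ^ (k + N) * q ^ ((k + N) ^ 2) ≤ (2 : ℝ≥0∞)⁻¹ ^ k := by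
    rw [sq, pow_mul, ← mul_pow]
    exact (pow_le_pow_left₀ zero_le (hN _ (by lia)) _).trans
      (pow_le_pow_of_le_one zero_le (by simp) (by lia))
  refine ne_top_of_le_ne_top ?_ (ENNReal.tsum_le_tsum hgeom)
  simp [ENNReal.tsum_geometric]

end Series

section Threshold

lemma exists_measure_lt_lt {Ω : Type*} [MeasurableSpace Ω] {μ : Measure Ω} [IsFiniteMeasure μ]
    {X : Ω → ℝ≥0∞} (hX : Measurable X) {ρ : ℝ≥0∞} (hρ : μ {ω | X ω = 0} < ρ) :
    ∃ v₀ : ℝ≥0∞, v₀ ≠ 0 ∧ μ {ω | X ω < v₀} < ρ := by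
  have hanti : Antitone fun n : ℕ => {ω | X ω < (n : ℝ≥0∞)⁻¹} := fun m n hmn ω hω =>
    lt_of_lt_of_le hω (ENNReal.inv_le_inv.2 (by exact_mod_cast hmn))
  have hmeas (n : ℕ) : NullMeasurableSet {ω | X ω < (n : ℝ≥0∞)⁻¹} μ :=
    (measurableSet_lt hX measurable_const).nullMeasurableSet
  have hinter : ⋂ n : ℕ, {ω | X ω < (n : ℝ≥0∞)⁻¹} = {ω | X ω = 0} := by
    ext ω
    simp only [Set.mem_iInter, Set.mem_ofPred_eq]
    refine ⟨fun h => ?_, fun h n => by simp [h]⟩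
    by_contra h0
    obtain ⟨n, hn⟩ := ENNReal.exists_inv_nat_lt h0
    exact lt_asymm hn (h n)
  have hlim := tendsto_measure_iInter_atTop hmeas hanti ⟨0, measure_ne_top μ _⟩
  rw [hinter] at hlim
  obtain ⟨n, hn⟩ := (hlim.eventually_lt_const hρ).exists
  exact ⟨(n : ℝ≥0∞)⁻¹, by simp, hn⟩

end Threshold

section HighDim

lemma tsum_comparison_ne_top {d : ℕ} (hd : 2 ≤ d) {q ε ι κ : ℝ≥0∞} (hq : q < 1) (hε : ε ≠ 0)
    (hι : ι ≠ 0) (hκ : κ ≠ 0) :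
    ∑' k : ℕ, (ε * ι ^ (d * (2 * k)))⁻¹ ^ 2 * q ^ ((2 * k - 1) ^ d) *
      (κ ^ (d * (2 * k) + 1))⁻¹ * ((2 * k + 1) ^ d) ^ 2 ≠ ⊤ := by
  set M : ℝ≥0∞ := (ι⁻¹ ^ (2 * d)) ^ 2 * κ⁻¹ ^ (2 * d) * (3 ^ d) ^ 2 with hM
  have hMtop : M ≠ ⊤ := by finiteness
  have hterm (k : ℕ) : (ε * ι ^ (d * (2 * k)))⁻¹ ^ 2 * q ^ ((2 * k - 1) ^ d) *
      (κ ^ (d * (2 * k) + 1))⁻¹ * ((2 * k + 1) ^ d) ^ 2 ≤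
      ε⁻¹ ^ 2 * κ⁻¹ * (M ^ k * q ^ (k ^ 2)) := by
    have hexp : k ^ 2 ≤ (2 * k - 1) ^ d := by
      obtain rfl | hk := Nat.eq_zero_or_pos k
      · simp
      · exact (Nat.pow_le_pow_left (by lia) 2).trans (Nat.pow_le_pow_right (by lia) hd)
    calc _ = (ε⁻¹ * (ι⁻¹ ^ (2 * d)) ^ k) ^ 2 * q ^ ((2 * k - 1) ^ d) *
          (κ⁻¹ * (κ⁻¹ ^ (2 * d)) ^ k) * ((2 * k + 1) ^ d) ^ 2 := by
          rw [ENNReal.mul_inv (Or.inl hε) (Or.inr (pow_ne_zero _ hι)), ENNReal.inv_pow,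
            ENNReal.inv_pow]
          ring
      _ ≤ (ε⁻¹ * (ι⁻¹ ^ (2 * d)) ^ k) ^ 2 * q ^ (k ^ 2) *
          (κ⁻¹ * (κ⁻¹ ^ (2 * d)) ^ k) * ((3 ^ k) ^ d) ^ 2 := by
          gcongr _ * ?_ * _ * (?_ ^ d) ^ 2
          · exact pow_le_pow_of_le_one zero_le hq.le hexp
          · exact_mod_cast two_mul_add_one_le_three_pow k
      _ = _ := by
          rw [hM]
          ring
  refine ne_top_of_le_ne_top ?_ (ENNReal.tsum_le_tsum hterm)
  rw [ENNReal.tsum_mul_left]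
  exact ENNReal.mul_ne_top (by finiteness) (tsum_pow_mul_pow_sq_ne_top hMtop hq)

variable [NeZero d] {Ω : Type*} [MeasurableSpace Ω] {μ : Measure Ω} [IsProbabilityMeasure μ]
  {V : (Fin d → ℤ) → Ω → ℝ≥0∞}

lemma exists_tsum_crossMass_mul_le_of_two_le (hd : 2 ≤ d) (hV : IsIIDField μ V)
    (h0 : meanExp μ V ≠ 0) (hnz : μ {ω | V 0 ω = 0} < 1) :
    ∃ C : ℝ≥0∞, C ≠ ⊤ ∧ ∀ y, ∑' n : ℕ, crossMass μ V y n * n ≤ C * ∑' a, visitMass μ V y a := by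
  obtain ⟨v₀, hv₀, hq⟩ := exists_measure_lt_lt (hV.meas 0) hnz
  have hι0 : (2 * d : ℝ≥0∞)⁻¹ ≠ 0 :=
    ENNReal.inv_ne_zero.2 (ENNReal.mul_ne_top (by simp) (by simp))
  have hκ0 := stepMass_ne_zero h0
  refine ⟨_, tsum_comparison_ne_top hd hq (one_sub_expNeg_ne_zero hv₀) hι0 hκ0,
    tsum_crossMass_mul_le hV hq ?_ (fun k => pow_ne_zero _ hκ0) ?_⟩
  · rintro y z k v ⟨w, hw, hvw⟩ b hb x
    refine (green_single_le_of_obstacle hv₀ hvw b x).trans ?_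
    rw [ENNReal.inv_le_inv]
    gcongr 1
    exact pow_le_pow_of_le_one zero_le two_mul_inv_le_one (latticeDist_le_of_mem_latticeBox hb hw)
  · intro z k a ha b hb
    have hpath := pow_le_lintegral_green hV (Finset.mem_Icc.1 ha) (Finset.mem_Icc.1 hb)
    rw [← Finset.coe_Icc] at hpath
    exact (pow_le_pow_of_le_one zero_le stepMass_le_one
      (Nat.succ_le_succ (latticeDist_le_of_mem_latticeBox ha hb))).trans hpath

end HighDim

/-! ### Dimension one -/

section Line

/-- The site of `ℤ^1` with coordinate `n`. -/
def site (n : ℤ) : Fin 1 → ℤ := fun _ => n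

lemma site_apply (n : ℤ) (i : Fin 1) : site n i = n := rfl

lemma site_coord (x : Fin 1 → ℤ) : site (x 0) = x := by
  ext i
  rw [site_apply, Subsingleton.elim i 0]

lemma site_injective : Function.Injective site := fun _ _ h => congrFun h 0

lemma latticeDist_line (a b : Fin 1 → ℤ) : latticeDist a b = (a 0 - b 0).natAbs := by
  simp [latticeDist]

lemma markovOp_srwStep_site (f : (Fin 1 → ℤ) → ℝ≥0∞) {s : ℤ} (hs : s = 1 ∨ s = -1) (n : ℤ) :
    markovOp srwStep f (site n) = 2⁻¹ * f (site (n + s)) + 2⁻¹ * f (site (n - s)) := by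
  have hup : site n + unitStep (0, true) = site (n + 1) := by
    ext i
    simp [site, unitStep, Subsingleton.elim i 0]
  have hdown : site n + unitStep (0, false) = site (n - 1) := by
    ext i
    simp [site, unitStep, Subsingleton.elim i 0, sub_eq_add_neg]
  have hone : markovOp srwStep f (site n) =
      2⁻¹ * f (site (n + 1)) + 2⁻¹ * f (site (n - 1)) := by
    rw [markovOp_srwStep, Fintype.sum_prod_type]
    simp [hup, hdown]
  obtain rfl | rfl := hs
  · exact hone
  · rw [hone, add_comm, sub_neg_eq_add, ← sub_eq_add_neg]

lemma markovOp_srwStep_mul_natCast (c : ℝ≥0∞) (T : (Fin 1 → ℤ) → ℕ) (x : Fin 1 → ℤ) :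
    markovOp srwStep (fun x => c * T x) x =
      2⁻¹ * (c * ((T (site (x 0 + 1)) + T (site (x 0 - 1)) : ℕ) : ℝ≥0∞)) := by
  rw [← site_coord x, markovOp_srwStep_site _ (Or.inl rfl)]
  simp only [site_apply]
  push_cast
  ring

lemma ne_coord_of_ne {x w : Fin 1 → ℤ} (h : x ≠ w) : x 0 ≠ w 0 := fun h0 =>
  h (by rw [← site_coord x, h0, site_coord])

-- The gambler's ruin estimate: the walk started at `b` reaches `w` without returning to `b` with
-- probability `1 / (2 |b - w|)`.
lemma green_single_le_of_obstacle_line {A : Set (Fin 1 → ℤ)} {v : (Fin 1 → ℤ) → ℝ≥0∞}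
    {v₀ : ℝ≥0∞} (hv₀ : v₀ ≠ 0) {w : Fin 1 → ℤ} (hw : v₀ ≤ v w) (b x : Fin 1 → ℤ) :
    green srwStep A v (Pi.single b 1) x ≤
      ((1 - expNeg v₀) * (2⁻¹ * (latticeDist b w + 1 : ℝ≥0∞)⁻¹))⁻¹ := by
  set ε := 1 - expNeg v₀
  set r := latticeDist b w
  have hεw : ε ≤ 1 - expNeg (v w) := tsub_le_tsub_left (expNeg_antitone hw) 1
  let T : (Fin 1 → ℤ) → ℕ := fun x => r - latticeDist x w
  let ψ : (Fin 1 → ℤ) → ℝ≥0∞ := fun x => ε * (r : ℝ≥0∞)⁻¹ * T x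
  have hψ (x : Fin 1 → ℤ) : ψ x ≤ ε := by
    simp only [ψ, mul_assoc]
    refine mul_le_of_le_one_right zero_le ?_
    rw [mul_comm, ← div_eq_mul_inv]
    exact ENNReal.div_le_of_le_mul (by rw [one_mul]; exact_mod_cast Nat.sub_le _ _)
  refine green_single_le_of_barrier (δ := ε * (2⁻¹ * (r + 1 : ℝ≥0∞)⁻¹)) ?_ ψ
    (fun x => (hψ x).trans tsub_le_self) (by simp [ψ, T, r]) (fun x _ => ?_) ?_ x
  · exact mul_ne_zero (one_sub_expNeg_ne_zero hv₀)
      (mul_ne_zero (by simp) (ENNReal.inv_ne_zero.2 (by finiteness)))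
  · obtain rfl | hxw := eq_or_ne x w
    · exact Or.inr ((hψ x).trans hεw)
    · left
      have hx0 := ne_coord_of_ne hxw
      have hconvex : 2 * T x ≤ T (site (x 0 + 1)) + T (site (x 0 - 1)) := by
        simp only [T, latticeDist_line, site_apply]
        lia
      rw [markovOp_srwStep_mul_natCast, ← ENNReal.div_eq_inv_mul,
        ENNReal.le_div_iff_mul_le (by simp) (by simp), mul_assoc, mul_comm (T x : ℝ≥0∞)]
      gcongr
      exact_mod_cast hconvex
  · obtain rfl | hbw := eq_or_ne b w
    · refine Or.inr ((mul_le_of_le_one_right zero_le ?_).trans hεw)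
      exact mul_le_one' (by simp) (ENNReal.inv_le_one.2 le_add_self)
    · left
      have hb0 := ne_coord_of_ne hbw
      have hone : 1 ≤ T (site (b 0 + 1)) + T (site (b 0 - 1)) := by
        simp only [T, r, latticeDist_line, site_apply]
        lia
      calc ε * (2⁻¹ * (r + 1 : ℝ≥0∞)⁻¹) ≤ ε * (2⁻¹ * (r : ℝ≥0∞)⁻¹) := by
            gcongr
            exact le_self_add
        _ = 2⁻¹ * (ε * (r : ℝ≥0∞)⁻¹ * 1) := by ring
        _ ≤ _ := by
            rw [markovOp_srwStep_mul_natCast]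
            gcongr
            exact_mod_cast hone

/-- The sites `a, a + s, …, a + (m - 1) s`. -/
def segment (a s : ℤ) (m : ℕ) : Set (Fin 1 → ℤ) := {x | ∃ j : ℕ, j < m ∧ x = site (a + s * j)}

lemma site_add_mul_injective (a : ℤ) {s : ℤ} (hs : s = 1 ∨ s = -1) :
    Function.Injective fun j : ℤ => site (a + s * j) := fun i j h => by
  have hcoord : a + s * i = a + s * j := site_injective h
  obtain rfl | rfl := hs <;> lia

lemma site_mem_segment {a s : ℤ} (hs : s = 1 ∨ s = -1) {m : ℕ} {j : ℤ} :
    site (a + s * j) ∈ segment a s m ↔ 0 ≤ j ∧ j < m := by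
  constructor
  · rintro ⟨i, hi, h⟩
    obtain rfl : j = i := site_add_mul_injective a hs h
    lia
  · rintro ⟨h0, h⟩
    refine ⟨j.toNat, by lia, ?_⟩
    rw [Int.toNat_of_nonneg h0]

lemma eq_natCast_mul_of_harmonic {h : ℕ → ℝ} {n : ℕ} (h0 : h 0 = 0)
    (hrec : ∀ j < n, 2 * h (j + 1) = h (j + 2) + h j) {j : ℕ} (hj : j ≤ n + 1) :
    h j = j * h 1 := by
  induction j using Nat.strong_induction_on with
  | _ j ih =>
    match j with
    | 0 => simp [h0]
    | 1 => simp
    | j + 2 =>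
      have hprev := ih j (by lia) (by lia)
      have hlast := ih (j + 1) (by lia) (by lia)
      have hstep := hrec j (by lia)
      push_cast at hlast ⊢
      linarith

lemma site_notMem_segment (a : ℤ) {s : ℤ} (hs : s = 1 ∨ s = -1) (n : ℕ) :
    site (a + s * n) ∉ segment a s n := fun h =>
  ((site_mem_segment hs).1 h).2.false

lemma green_segment_eq_avg {a s : ℤ} (hs : s = 1 ∨ s = -1) {n : ℕ}
    {v : (Fin 1 → ℤ) → ℝ≥0∞} (hv : ∀ x ∈ segment a s n, v x = 0) {j : ℤ} (hj0 : 0 ≤ j)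
    (hjn : j < n) :
    green srwStep (segment a s n) v (Pi.single (site (a + s * n)) 1) (site (a + s * j)) =
      2⁻¹ * green srwStep (segment a s n) v (Pi.single (site (a + s * n)) 1)
          (site (a + s * (j + 1))) +
        2⁻¹ * green srwStep (segment a s n) v (Pi.single (site (a + s * n)) 1)
          (site (a + s * (j - 1))) := by
  have hmem : site (a + s * j) ∈ segment a s n := (site_mem_segment hs).2 ⟨hj0, hjn⟩
  conv_lhs => rw [green_eq, Pi.single_eq_of_ne ((site_add_mul_injective a hs).ne hjn.ne), zero_add,
    killedStep_of_mem hmem, hv _ hmem, expNeg_zero, one_mul, markovOp_srwStep_site _ hs]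
  congr 4 <;> ring

-- Gambler's ruin: started next to one end of an obstacle-free interval of length `n + 1`, the walk
-- leaves it at the other end with probability `1 / (n + 1)`.
lemma green_segment_of_zero {a s : ℤ} (hs : s = 1 ∨ s = -1) (n : ℕ)
    {v : (Fin 1 → ℤ) → ℝ≥0∞} (hv : ∀ x ∈ segment a s n, v x = 0) :
    green srwStep (segment a s n) v (Pi.single (site (a + s * n)) 1) (site a) =
      (n + 1 : ℝ≥0∞)⁻¹ := by
  set u := green srwStep (segment a s n) v (Pi.single (site (a + s * n)) 1) with hu
  have hend := site_notMem_segment a hs n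
  have htop (x : Fin 1 → ℤ) : 2⁻¹ * u x ≠ ⊤ :=
    ENNReal.mul_ne_top (by simp)
      (ne_top_of_le_ne_top ENNReal.one_ne_top (green_single_le_one hend x))
  let h : ℕ → ℝ := fun j => (u (site (a + s * (j - 1)))).toReal
  have hzero : h 0 = 0 := by
    have hout : site (a + s * (-1)) ∉ segment a s n := fun hmem =>
      absurd ((site_mem_segment hs).1 hmem).1 (by lia)
    simp only [h, hu, Nat.cast_zero, zero_sub]
    rw [green_of_notMem hout, Pi.single_eq_of_ne ((site_add_mul_injective a hs).ne (by lia)),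
      ENNReal.toReal_zero]
  have hlast : h (n + 1) = 1 := by simp [h, hu, green_single_self hend]
  have hrec (j : ℕ) (hj : j < n) : 2 * h (j + 1) = h (j + 2) + h j := by
    have hmean := congrArg ENNReal.toReal
      (green_segment_eq_avg hs hv (Int.natCast_nonneg j) (Nat.cast_lt.2 hj))
    rw [ENNReal.toReal_add (htop _) (htop _), ENNReal.toReal_mul, ENNReal.toReal_mul,
      ENNReal.toReal_inv, ENNReal.toReal_ofNat] at hmean
    have hshift : (j : ℤ) + 2 - 1 = j + 1 := by ring
    simp only [h, Nat.cast_add, Nat.cast_one, Nat.cast_ofNat, add_sub_cancel_right, hshift]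
    linarith
  have hlin := eq_natCast_mul_of_harmonic hzero hrec le_rfl
  rw [hlast] at hlin
  push_cast at hlin
  rw [← ENNReal.toReal_eq_toReal_iff'
    (ne_top_of_le_ne_top ENNReal.one_ne_top (green_single_le_one hend _)) (by finiteness)]
  simpa [h, ENNReal.toReal_add] using eq_inv_of_mul_eq_one_right hlin.symm

lemma le_green_segment {a s : ℤ} (hs : s = 1 ∨ s = -1) {m g : ℕ} (hg : g < m)
    {v : (Fin 1 → ℤ) → ℝ≥0∞} (hv : ∀ x ∈ segment a s g, v x = 0) :
    (g + 1 : ℝ≥0∞)⁻¹ * (expNeg (v (site (a + s * g))) * 2⁻¹) *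
        green srwStep (segment (a + s * (g + 1)) s (m - 1 - g)) v
          (Pi.single (site (a + s * m)) 1) (site (a + s * (g + 1))) ≤
      green srwStep (segment a s m) v (Pi.single (site (a + s * m)) 1) (site a) := by
  set u := green srwStep (segment a s m) v (Pi.single (site (a + s * m)) 1) with hu
  have hsuper (x : Fin 1 → ℤ) (hx : x ∈ segment a s m) :
      expNeg (v x) * markovOp srwStep u x ≤ u x := by
    conv_rhs => rw [hu, green_eq, killedStep_of_mem hx]
    exact le_add_self
  have hfree : segment a s g ⊆ segment a s m := by
    rintro x ⟨j, hj, rfl⟩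
    exact ⟨j, by lia, rfl⟩
  have hrest : segment (a + s * (g + 1)) s (m - 1 - g) ⊆ segment a s m := by
    rintro x ⟨j, hj, rfl⟩
    refine ⟨g + 1 + j, by lia, ?_⟩
    congr 1
    push_cast
    ring
  have hruin := green_single_mul_le (site_notMem_segment a hs g)
    (fun x hx => hsuper x (hfree hx)) (site a)
  rw [green_segment_of_zero hs g hv] at hruin
  refine le_trans ?_ hruin
  rw [mul_assoc]
  gcongr
  refine le_trans ?_ (hsuper _ ((site_mem_segment hs).2 ⟨by lia, by lia⟩))
  rw [mul_assoc]
  gcongr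
  rw [markovOp_srwStep_site u hs]
  refine le_trans ?_ le_self_add
  rw [show a + s * (g : ℤ) + s = a + s * (g + 1) by ring]
  gcongr
  exact green_mono_set hrest _

end Line

section Renewal

lemma exists_lt_sum_range_inv_succ {x : ℝ≥0∞} (hx : x ≠ ⊤) :
    ∃ N : ℕ, x < ∑ g ∈ Finset.range N, (g + 1 : ℝ≥0∞)⁻¹ := by
  obtain ⟨N, hN⟩ := (Real.tendsto_sum_range_one_div_nat_succ_atTop.eventually_gt_atTop
    x.toReal).exists
  refine ⟨N, ?_⟩
  rw [← ENNReal.ofReal_toReal hx]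
  refine ((ENNReal.ofReal_lt_ofReal_iff (ENNReal.toReal_nonneg.trans_lt hN)).2 hN).trans_eq ?_
  rw [ENNReal.ofReal_sum_of_nonneg fun g _ => by positivity]
  refine Finset.sum_congr rfl fun g _ => ?_
  rw [one_div, ENNReal.ofReal_inv_of_pos (by positivity)]
  norm_cast

-- At `ρ = p` the renewal weights sum to infinity, because the harmonic series diverges.
lemma exists_renewal_supercritical {p s : ℝ≥0∞} (hp : p < 1) (hs0 : s ≠ 0) (hs : s ≠ ⊤) :
    ∃ ρ, p < ρ ∧ ρ ≤ 1 ∧ ∃ N : ℕ,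
      1 ≤ ∑ g ∈ Finset.range N, s * p ^ g * (g + 1 : ℝ≥0∞)⁻¹ * ρ⁻¹ ^ (g + 1) := by
  obtain rfl | hp0 := eq_or_ne p 0
  · have hmin : min s 1 ≠ 0 := (lt_min (pos_iff_ne_zero.2 hs0) one_pos).ne'
    refine ⟨min s 1, pos_iff_ne_zero.2 hmin, min_le_right _ _, 1, ?_⟩
    simp only [Finset.range_one, Finset.sum_singleton, pow_zero, mul_one, Nat.cast_zero, zero_add,
      inv_one, pow_one]
    calc 1 = min s 1 * (min s 1)⁻¹ := (ENNReal.mul_inv_cancel hmin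
          (ne_top_of_le_ne_top ENNReal.one_ne_top (min_le_right _ _))).symm
      _ ≤ s * (min s 1)⁻¹ := by
          gcongr
          exact min_le_left _ _
  · obtain ⟨N, hN⟩ := exists_lt_sum_range_inv_succ (ENNReal.mul_ne_top hp.ne_top
      (ENNReal.inv_ne_top.2 hs0))
    let F : ℝ≥0∞ → ℝ≥0∞ := fun ρ =>
      ∑ g ∈ Finset.range N, s * p ^ g * (g + 1 : ℝ≥0∞)⁻¹ * ρ⁻¹ ^ (g + 1)
    have hF : 1 < F p := by
      have hterm (g : ℕ) : s * p ^ g * (g + 1 : ℝ≥0∞)⁻¹ * p⁻¹ ^ (g + 1) =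
          s * p⁻¹ * (g + 1 : ℝ≥0∞)⁻¹ := by
        calc _ = s * p⁻¹ * (g + 1 : ℝ≥0∞)⁻¹ * (p * p⁻¹) ^ g := by ring
          _ = _ := by rw [ENNReal.mul_inv_cancel hp0 hp.ne_top, one_pow, mul_one]
      calc 1 = s * p⁻¹ * (p * s⁻¹) := by
            rw [show s * p⁻¹ * (p * s⁻¹) = (s * s⁻¹) * (p * p⁻¹) by ring,
              ENNReal.mul_inv_cancel hs0 hs, ENNReal.mul_inv_cancel hp0 hp.ne_top, one_mul]
        _ < s * p⁻¹ * ∑ g ∈ Finset.range N, (g + 1 : ℝ≥0∞)⁻¹ :=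
            ENNReal.mul_lt_mul_right (mul_ne_zero hs0 (ENNReal.inv_ne_zero.2 hp.ne_top))
              (ENNReal.mul_ne_top hs (ENNReal.inv_ne_top.2 hp0)) hN
        _ = F p := by simp only [F, hterm, Finset.mul_sum]
    have hcont : Continuous F := continuous_finsetSum _ fun g _ =>
      (ENNReal.continuous_const_mul (by finiteness)).comp
        ((ENNReal.continuous_pow _).comp continuous_inv)
    have hev : ∀ᶠ ρ in 𝓝[>] p, 1 < F ρ :=
      (hcont.continuousAt.eventually (lt_mem_nhds hF)).filter_mono nhdsWithin_le_nhds
    have hne : (𝓝[>] p).NeBot := nhdsGT_neBot_of_exists_gt ⟨1, hp⟩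
    obtain ⟨ρ, hρF, hpρ, hρ1⟩ := (hev.and (Ioo_mem_nhdsGT hp)).exists
    exact ⟨ρ, hpρ, hρ1.le, N, hρF.le⟩

lemma pow_le_of_renewal {w L : ℕ → ℝ≥0∞} (hL0 : 1 ≤ L 0)
    (hL : ∀ m, ∑ g ∈ Finset.range m, w g * L (m - 1 - g) ≤ L m) (m : ℕ) : w 0 ^ m ≤ L m := by
  induction m with
  | zero => simpa using hL0
  | succ m ih =>
    calc w 0 ^ (m + 1) = w 0 * w 0 ^ m := pow_succ' _ _
      _ ≤ w 0 * L (m + 1 - 1 - 0) := by gcongr; exact ih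
      _ ≤ ∑ g ∈ Finset.range (m + 1), w g * L (m + 1 - 1 - g) :=
          Finset.single_le_sum (f := fun g => w g * L (m + 1 - 1 - g)) (fun _ _ => zero_le)
            (Finset.mem_range.2 m.succ_pos)
      _ ≤ L (m + 1) := hL _

lemma mul_pow_le_of_renewal {w L : ℕ → ℝ≥0∞} {ρ : ℝ≥0∞} {N : ℕ} (hρ0 : ρ ≠ 0) (hρ1 : ρ ≤ 1)
    (hw : 1 ≤ ∑ g ∈ Finset.range N, w g * ρ⁻¹ ^ (g + 1)) (hL0 : 1 ≤ L 0)
    (hL : ∀ m, ∑ g ∈ Finset.range m, w g * L (m - 1 - g) ≤ L m) (m : ℕ) :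
    min 1 (w 0) ^ N * ρ ^ m ≤ L m := by
  set c := min 1 (w 0) ^ N
  induction m using Nat.strong_induction_on with
  | _ m ih =>
    obtain hm | hm := lt_or_ge m N
    · calc c * ρ ^ m ≤ min 1 (w 0) ^ m * 1 :=
            mul_le_mul' (pow_le_pow_of_le_one zero_le (min_le_left _ _) hm.le) (pow_le_one' hρ1 m)
        _ ≤ w 0 ^ m := by
            rw [mul_one]
            gcongr
            exact min_le_right _ _
        _ ≤ L m := pow_le_of_renewal hL0 hL m
    · have hpow (g : ℕ) (hg : g < N) : ρ⁻¹ ^ (g + 1) * ρ ^ m = ρ ^ (m - 1 - g) := by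
        obtain ⟨i, rfl⟩ : ∃ i, m = g + 1 + i := ⟨m - (g + 1), by lia⟩
        rw [pow_add ρ (g + 1), ← mul_assoc, ← mul_pow,
          ENNReal.inv_mul_cancel hρ0 (ne_top_of_le_ne_top ENNReal.one_ne_top hρ1), one_pow,
          one_mul, show g + 1 + i - 1 - g = i by lia]
      calc c * ρ ^ m ≤ (∑ g ∈ Finset.range N, w g * ρ⁻¹ ^ (g + 1)) * (c * ρ ^ m) :=
            le_mul_of_one_le_left zero_le hw
        _ = ∑ g ∈ Finset.range N, w g * (c * ρ ^ (m - 1 - g)) := by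
            rw [Finset.sum_mul]
            refine Finset.sum_congr rfl fun g hg => ?_
            rw [← hpow g (Finset.mem_range.1 hg)]
            ring
        _ ≤ ∑ g ∈ Finset.range N, w g * L (m - 1 - g) := by
            gcongr with g hg
            exact ih _ (by have := Finset.mem_range.1 hg; lia)
        _ ≤ ∑ g ∈ Finset.range m, w g * L (m - 1 - g) :=
            Finset.sum_le_sum_of_subset (Finset.range_subset_range.2 hm)
        _ ≤ L m := hL m

end Renewal

section AnnealedLine

variable {Ω : Type*} {V : (Fin 1 → ℤ) → Ω → ℝ≥0∞} {M : ℝ≥0∞} {a s : ℤ} {g : ℕ}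

/-- The event that `a + s g` is the first of the sites `a, a + s, …` at which the potential does not
vanish, and that the potential is at most `M` there. -/
def firstPositive (V : (Fin 1 → ℤ) → Ω → ℝ≥0∞) (M : ℝ≥0∞) (a s : ℤ) (g : ℕ) : Set Ω :=
  {ω | (∀ j < g, V (site (a + s * (j : ℕ))) ω = 0) ∧ V (site (a + s * g)) ω ∈ Set.Ioc 0 M}

lemma firstPositive_eq_iInter : firstPositive V M a s g = ⋂ j ∈ Finset.range (g + 1),
    V (site (a + s * (j : ℕ))) ⁻¹' if j < g then {0} else Set.Ioc 0 M := by
  ext ω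
  simp only [firstPositive, Set.mem_ofPred_eq, Finset.mem_range, Set.mem_iInter,
    Set.mem_preimage, Nat.forall_lt_succ_right, lt_irrefl, if_false]
  refine and_congr_left fun _ => forall₂_congr fun j hj => ?_
  rw [if_pos hj, Set.mem_singleton_iff]

lemma disjoint_firstPositive {g' : ℕ} (h : g ≠ g') :
    Disjoint (firstPositive V M a s g) (firstPositive V M a s g') := by
  refine Set.disjoint_left.2 fun ω hω hω' => ?_
  obtain hlt | hlt := lt_or_gt_of_ne h
  · exact hω.2.1.ne' (hω'.1 g hlt)
  · exact hω'.2.1.ne' (hω.1 g' hlt)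

lemma measurableSet_firstPositive (hs : s = 1 ∨ s = -1) :
    MeasurableSet[sitesAlgebra V (segment a s (g + 1))] (firstPositive V M a s g) := by
  rw [firstPositive_eq_iInter]
  refine Finset.measurableSet_biInter _ fun j hj => ?_
  refine measurable_sitesAlgebra ((site_mem_segment hs).2 ⟨by lia, ?_⟩) ?_
  · exact_mod_cast Finset.mem_range.1 hj
  · split_ifs
    · exact measurableSet_singleton 0
    · exact measurableSet_Ioc

lemma disjoint_segment (a : ℤ) (hs : s = 1 ∨ s = -1) (g m : ℕ) :
    Disjoint (segment a s g) (segment (a + s * g) s m) := by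
  refine Set.disjoint_left.2 ?_
  rintro x hx ⟨i, -, rfl⟩
  rw [add_assoc, ← mul_add, site_mem_segment hs] at hx
  lia

variable [MeasurableSpace Ω] {μ : Measure Ω}

/-- The annealed weight of crossing a segment of `m` sites from its first site without leaving it
on the other side. -/
def segmentMass (μ : Measure Ω) (V : (Fin 1 → ℤ) → Ω → ℝ≥0∞) (a s : ℤ) (m : ℕ) : ℝ≥0∞ :=
  ∫⁻ ω, green srwStep (segment a s m) (fun z => V z ω) (Pi.single (site (a + s * m)) 1)
    (site a) ∂μ

lemma segmentMass_zero [IsProbabilityMeasure μ] (hs : s = 1 ∨ s = -1) :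
    segmentMass μ V a s 0 = 1 := by
  have hone (ω : Ω) : green srwStep (segment a s 0) (fun z => V z ω)
      (Pi.single (site (a + s * (0 : ℕ))) 1) (site a) = 1 := by
    simpa using green_single_self (p := srwStep) (v := fun z => V z ω) (site_notMem_segment a hs 0)
  simp only [segmentMass, hone, lintegral_one, measure_univ]

lemma exists_measure_pos_le {X : Ω → ℝ≥0∞} (h : 0 < μ {ω | 0 < X ω ∧ X ω < ⊤}) :
    ∃ M : ℕ, 0 < μ {ω | X ω ∈ Set.Ioc 0 (M : ℝ≥0∞)} := by
  by_contra! hcon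
  have hsub : {ω | 0 < X ω ∧ X ω < ⊤} ⊆ ⋃ M : ℕ, {ω | X ω ∈ Set.Ioc 0 (M : ℝ≥0∞)} := by
    rintro ω ⟨hpos, htop⟩
    obtain ⟨n, hn⟩ := ENNReal.exists_nat_gt htop.ne
    exact Set.mem_iUnion.2 ⟨n, hpos, hn.le⟩
  exact h.ne' (measure_mono_null hsub
    (measure_iUnion_null fun M => le_antisymm (hcon M) zero_le))

lemma segmentMass_mul_meanExp_le (hV : IsIIDField μ V) (hs : s = 1 ∨ s = -1) {m : ℕ}
    {B : Finset (Fin 1 → ℤ)} (hB : ∀ j : ℕ, j < m → site (a + s * j) ∈ B) :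
    segmentMass μ V a s m * meanExp μ V ≤
      ∫⁻ ω, innerWeight srwStep B (fun z => V z ω) (site a) (site (a + s * m)) ∂μ := by
  have hend := site_notMem_segment a hs m
  have hsub : segment a s m ⊆ (B : Set (Fin 1 → ℤ)) \ {site (a + s * m)} := by
    rintro x ⟨j, hj, rfl⟩
    exact ⟨hB j hj, fun h => hend (h ▸ ⟨j, hj, rfl⟩)⟩
  rw [segmentMass, meanExp, ← hV.lintegral_comp measurable_expNeg (site (a + s * m)),
    ← hV.lintegral_mul (S := segment a s m) (T := {site (a + s * m)})
      (g := fun ω => expNeg (V (site (a + s * m)) ω)) (by simpa using hend)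
      (measurable_green (fun z hz => measurable_sitesAlgebra hz) _ _)
      (measurable_expNeg.comp (measurable_sitesAlgebra rfl))]
  unfold innerWeight
  gcongr
  exact green_mono_set hsub _

lemma le_lintegral_innerWeight_latticeBox (hV : IsIIDField μ V) {ρ c : ℝ≥0∞} (hρ1 : ρ ≤ 1)
    (hseg : ∀ a s : ℤ, s = 1 ∨ s = -1 → ∀ m : ℕ, c * ρ ^ m ≤ segmentMass μ V a s m)
    {z a b : Fin 1 → ℤ} {k : ℕ} (ha : a ∈ latticeBox z k) (hb : b ∈ latticeBox z k) :
    c * ρ ^ (2 * k) * meanExp μ V ≤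
      ∫⁻ ω, innerWeight srwStep (latticeBox z k) (fun z => V z ω) a b ∂μ := by
  have ha0 := mem_latticeBox.1 ha 0
  have hb0 := mem_latticeBox.1 hb 0
  obtain ⟨s, hs, m, hm⟩ : ∃ s : ℤ, (s = 1 ∨ s = -1) ∧ ∃ m : ℕ, b 0 = a 0 + s * m := by
    obtain h | h := le_total (a 0) (b 0)
    · exact ⟨1, Or.inl rfl, (b 0 - a 0).toNat, by lia⟩
    · exact ⟨-1, Or.inr rfl, (a 0 - b 0).toNat, by lia⟩
  have hmk : m ≤ 2 * k := by obtain rfl | rfl := hs <;> lia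
  have hbox (j : ℕ) (hj : j < m) : site (a 0 + s * j) ∈ latticeBox z k := by
    refine mem_latticeBox.2 fun i => ?_
    rw [Subsingleton.elim i 0, site_apply]
    obtain rfl | rfl := hs <;> lia
  have hcross := segmentMass_mul_meanExp_le hV hs hbox
  rw [← hm, site_coord, site_coord] at hcross
  refine le_trans ?_ hcross
  gcongr
  calc c * ρ ^ (2 * k) ≤ c * ρ ^ m := by
        gcongr _ * ?_
        exact pow_le_pow_of_le_one zero_le hρ1 hmk
    _ ≤ segmentMass μ V (a 0) s m := hseg _ s hs m

lemma measure_firstPositive (hV : IsIIDField μ V) (hs : s = 1 ∨ s = -1) :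
    μ (firstPositive V M a s g) = μ {ω | V 0 ω = 0} ^ g * μ {ω | V 0 ω ∈ Set.Ioc 0 M} := by
  have hinj : Function.Injective fun j : ℕ => site (a + s * j) :=
    (site_add_mul_injective a hs).comp Nat.cast_injective
  have hmeas (j : ℕ) : MeasurableSet (if j < g then ({0} : Set ℝ≥0∞) else Set.Ioc 0 M) := by
    split_ifs
    · exact measurableSet_singleton 0
    · exact measurableSet_Ioc
  rw [firstPositive_eq_iInter,
    (hV.indep.precomp hinj).measure_inter_preimage_eq_mul _ fun j _ => hmeas j]
  simp only [fun j : ℕ => (hV.ident (site (a + s * j))).measure_mem_eq (hmeas j)]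
  rw [Finset.prod_range_succ, if_neg (lt_irrefl g), Finset.prod_congr rfl fun j hj => by
    rw [if_pos (Finset.mem_range.1 hj)], Finset.prod_const, Finset.card_range]
  rfl

lemma mul_segmentMass_le_setLIntegral (hV : IsIIDField μ V) (hs : s = 1 ∨ s = -1) {m : ℕ}
    (hg : g < m) :
    μ {ω | V 0 ω ∈ Set.Ioc 0 M} * (expNeg M * 2⁻¹) * μ {ω | V 0 ω = 0} ^ g *
        (g + 1 : ℝ≥0∞)⁻¹ * segmentMass μ V (a + s * (g + 1)) s (m - 1 - g) ≤
      ∫⁻ ω in firstPositive V M a s g, green srwStep (segment a s m) (fun z => V z ω)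
        (Pi.single (site (a + s * m)) 1) (site a) ∂μ := by
  let tail : Ω → ℝ≥0∞ := fun ω =>
    green srwStep (segment (a + s * (g + 1)) s (m - 1 - g)) (fun z => V z ω)
      (Pi.single (site (a + s * m)) 1) (site (a + s * (g + 1)))
  have htail : ∫⁻ ω, tail ω ∂μ = segmentMass μ V (a + s * (g + 1)) s (m - 1 - g) := by
    have hend : a + s * (g + 1) + s * ((m - 1 - g : ℕ) : ℤ) = a + s * m := by
      rw [Nat.cast_sub (by lia), Nat.cast_sub (by lia)]
      push_cast
      ring
    simp only [tail, segmentMass, hend]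
  have hE := measurableSet_firstPositive (V := V) (M := M) (a := a) (g := g) hs
  have hE' := hV.sitesAlgebra_le _ _ hE
  have hone : Measurable[sitesAlgebra V (segment a s (g + 1))]
      ((firstPositive V M a s g).indicator (1 : Ω → ℝ≥0∞)) :=
    Measurable.indicator (f := fun _ => (1 : ℝ≥0∞)) measurable_const hE
  have hdisj : Disjoint (segment a s (g + 1)) (segment (a + s * (g + 1)) s (m - 1 - g)) := by
    exact_mod_cast disjoint_segment a hs (g + 1) (m - 1 - g)
  have hsplit : ∫⁻ ω in firstPositive V M a s g, tail ω ∂μ =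
      μ (firstPositive V M a s g) * ∫⁻ ω, tail ω ∂μ := by
    rw [← lintegral_indicator_one hE', ← hV.lintegral_mul hdisj hone
      (measurable_green (fun z hz => measurable_sitesAlgebra hz) _ _), ← lintegral_indicator hE']
    refine lintegral_congr fun ω => ?_
    by_cases hω : ω ∈ firstPositive V M a s g <;> simp [hω, tail]
  calc _ = (g + 1 : ℝ≥0∞)⁻¹ * (expNeg M * 2⁻¹) * ∫⁻ ω in firstPositive V M a s g, tail ω ∂μ := by
        rw [hsplit, measure_firstPositive hV hs, htail]
        ring
    _ = ∫⁻ ω in firstPositive V M a s g, (g + 1 : ℝ≥0∞)⁻¹ * (expNeg M * 2⁻¹) * tail ω ∂μ :=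
        (lintegral_const_mul _ (measurable_green (fun z _ => hV.meas z) _ _)).symm
    _ ≤ _ := by
        refine setLIntegral_mono' hE' fun ω hω => ?_
        refine le_trans ?_ (le_green_segment hs hg (v := fun z => V z ω) ?_)
        · gcongr
          exact expNeg_antitone hω.2.2
        · rintro x ⟨j, hj, rfl⟩
          exact hω.1 j hj

-- The crossing path is decomposed at the first site where the potential does not vanish.
lemma segmentMass_renewal (hV : IsIIDField μ V) (M : ℝ≥0∞) (hs : s = 1 ∨ s = -1) (m : ℕ) :
    ∑ g ∈ Finset.range m, μ {ω | V 0 ω ∈ Set.Ioc 0 M} * (expNeg M * 2⁻¹) *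
        μ {ω | V 0 ω = 0} ^ g * (g + 1 : ℝ≥0∞)⁻¹ *
        segmentMass μ V (a + s * (g + 1)) s (m - 1 - g) ≤
      segmentMass μ V a s m := by
  have hE (g : ℕ) : MeasurableSet (firstPositive V M a s g) :=
    hV.sitesAlgebra_le _ _ (measurableSet_firstPositive hs)
  refine (Finset.sum_le_sum fun g hg =>
    mul_segmentMass_le_setLIntegral hV hs (Finset.mem_range.1 hg)).trans ?_
  rw [← lintegral_biUnion_finset (fun g _ g' _ h => disjoint_firstPositive h) fun g _ => hE g]
  exact setLIntegral_le_lintegral _ _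

lemma exists_mul_pow_le_segmentMass [IsProbabilityMeasure μ] (hV : IsIIDField μ V)
    (hnz : μ {ω | V 0 ω = 0} < 1) (hpos : 0 < μ {ω | 0 < V 0 ω ∧ V 0 ω < ⊤}) :
    ∃ ρ c : ℝ≥0∞, μ {ω | V 0 ω = 0} < ρ ∧ ρ ≤ 1 ∧ c ≠ 0 ∧
      ∀ a s : ℤ, s = 1 ∨ s = -1 → ∀ m : ℕ, c * ρ ^ m ≤ segmentMass μ V a s m := by
  obtain ⟨M, hM⟩ := exists_measure_pos_le hpos
  set p := μ {ω | V 0 ω = 0}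
  set σ := μ {ω | V 0 ω ∈ Set.Ioc 0 (M : ℝ≥0∞)} * (expNeg M * 2⁻¹)
  have hσ0 : σ ≠ 0 := mul_ne_zero hM.ne' (mul_ne_zero (expNeg_pos (by simp)).ne' (by simp))
  have hσtop : σ ≠ ⊤ := ENNReal.mul_ne_top (measure_ne_top μ _)
    (ENNReal.mul_ne_top (expNeg_ne_top _) (by simp))
  obtain ⟨ρ, hρ, hρ1, N, hN⟩ := exists_renewal_supercritical hnz hσ0 hσtop
  let w : ℕ → ℝ≥0∞ := fun g => σ * p ^ g * (g + 1 : ℝ≥0∞)⁻¹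
  have hw0 : w 0 = σ := by simp [w]
  let L : ℕ → ℝ≥0∞ := fun m => ⨅ (a : ℤ) (s : ℤ) (_ : s = 1 ∨ s = -1), segmentMass μ V a s m
  have hL0 : 1 ≤ L 0 := le_iInf fun a => le_iInf₂ fun s hs => (segmentMass_zero hs).ge
  have hL (m : ℕ) : ∑ g ∈ Finset.range m, w g * L (m - 1 - g) ≤ L m := by
    refine le_iInf fun a => le_iInf₂ fun s hs => ?_
    refine le_trans (Finset.sum_le_sum fun g _ => ?_) (segmentMass_renewal hV M hs m)
    gcongr
    exact iInf_le_of_le _ (iInf₂_le s hs)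
  refine ⟨ρ, min 1 (w 0) ^ N, hρ, hρ1, ?_, fun a s hs m => ?_⟩
  · rw [hw0]
    exact pow_ne_zero _ (lt_min one_pos (pos_iff_ne_zero.2 hσ0)).ne'
  · exact (mul_pow_le_of_renewal (zero_le.trans_lt hρ).ne' hρ1 hN hL0 hL m).trans
      (iInf_le_of_le a (iInf₂_le s hs))

lemma tsum_pow_mul_geometric_ne_top (j : ℕ) {t : ℝ≥0∞} (ht : t < 1) :
    ∑' n : ℕ, (n : ℝ≥0∞) ^ j * t ^ n ≠ ⊤ := by
  lift t to NNReal using ht.ne_top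
  have hsum : Summable fun n : ℕ => (n : NNReal) ^ j * t ^ n := by
    rw [← NNReal.summable_coe]
    push_cast
    exact summable_pow_mul_geometric_of_norm_lt_one j (by simpa using ht)
  exact_mod_cast ENNReal.tsum_coe_ne_top_iff_summable.2 hsum

lemma pow_pred_le_inv_sq_mul_pow {q r : ℝ≥0∞} (hr0 : r ≠ 0) (hr1 : r ≤ 1) (hqr : q ≤ r) (n : ℕ) :
    q ^ (n - 1) ≤ r⁻¹ ^ 2 * r ^ (n + 1) :=
  calc q ^ (n - 1) ≤ r ^ (n - 1) := by gcongr
    _ = (r⁻¹ * r) ^ 2 * r ^ (n - 1) := by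
        rw [ENNReal.inv_mul_cancel hr0 (ne_top_of_le_ne_top ENNReal.one_ne_top hr1), one_pow,
          one_mul]
    _ = r⁻¹ ^ 2 * r ^ (2 + (n - 1)) := by ring
    _ ≤ r⁻¹ ^ 2 * r ^ (n + 1) := by
        gcongr _ * ?_
        exact pow_le_pow_of_le_one zero_le hr1 (by lia)

lemma tsum_comparison_line_ne_top {q ρ ε c φ : ℝ≥0∞} (hq : q < ρ) (hρ1 : ρ ≤ 1) (hε : ε ≠ 0)
    (hc : c ≠ 0) (hφ : φ ≠ 0) :
    ∑' k : ℕ, (ε * (2⁻¹ * (2 * k + 1 : ℝ≥0∞)⁻¹))⁻¹ ^ 2 * q ^ ((2 * k - 1) ^ 1) *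
      (c * ρ ^ (2 * k) * φ)⁻¹ * ((2 * k + 1) ^ 1) ^ 2 ≠ ⊤ := by
  obtain ⟨r, hqr, hrρ⟩ := exists_between hq
  have hr0 : r ≠ 0 := (zero_le.trans_lt hqr).ne'
  have hr1 : r ≤ 1 := hrρ.le.trans hρ1
  have hρ0 : ρ ≠ 0 := (zero_le.trans_lt hq).ne'
  let K : ℝ≥0∞ := ε⁻¹ ^ 2 * 2 ^ 2 * r⁻¹ ^ 2 * c⁻¹ * φ⁻¹
  have hterm (k : ℕ) : (ε * (2⁻¹ * (2 * k + 1 : ℝ≥0∞)⁻¹))⁻¹ ^ 2 * q ^ ((2 * k - 1) ^ 1) *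
      (c * ρ ^ (2 * k) * φ)⁻¹ * ((2 * k + 1) ^ 1) ^ 2 ≤
      K * (((2 * k + 1 : ℕ) : ℝ≥0∞) ^ 4 * (r * ρ⁻¹) ^ (2 * k + 1)) := by
    have hodd : (2 * k + 1 : ℝ≥0∞) ≠ ⊤ := by finiteness
    rw [ENNReal.mul_inv (Or.inl hε) (Or.inr (mul_ne_zero (by simp) (ENNReal.inv_ne_zero.2 hodd))),
      ENNReal.mul_inv (by simp) (by simp),
      inv_inv, inv_inv, ENNReal.mul_inv (by simp [hc, hρ0]) (Or.inr hφ),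
      ENNReal.mul_inv (Or.inl hc) (by simp [hρ0]), ENNReal.inv_pow, pow_one, pow_one]
    calc _ ≤ (ε⁻¹ * (2 * (2 * k + 1))) ^ 2 * (r⁻¹ ^ 2 * r ^ (2 * k + 1)) *
          (c⁻¹ * ρ⁻¹ ^ (2 * k + 1) * φ⁻¹) * (2 * k + 1) ^ 2 := by
          gcongr _ * ?_ * (_ * ?_ * _) * _
          · exact pow_pred_le_inv_sq_mul_pow hr0 hr1 hqr.le (2 * k)
          · exact pow_le_pow_right₀ (ENNReal.one_le_inv.2 hρ1) (Nat.le_succ _)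
      _ = _ := by
          push_cast
          ring
  have hlt : r * ρ⁻¹ < 1 := by
    rw [← div_eq_mul_inv]
    exact ENNReal.div_lt_of_lt_mul (by rwa [one_mul])
  refine ne_top_of_le_ne_top ?_ (ENNReal.tsum_le_tsum hterm)
  rw [ENNReal.tsum_mul_left]
  refine ENNReal.mul_ne_top (by finiteness) (ne_top_of_le_ne_top
    (tsum_pow_mul_geometric_ne_top 4 hlt) ?_)
  exact ENNReal.tsum_comp_le_tsum_of_injective (f := fun k : ℕ => 2 * k + 1)
    (fun i j h => by lia) fun n : ℕ => (n : ℝ≥0∞) ^ 4 * (r * ρ⁻¹) ^ n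

lemma exists_tsum_crossMass_mul_le_of_line [IsProbabilityMeasure μ] (hV : IsIIDField μ V)
    (h0 : meanExp μ V ≠ 0) (hnz : μ {ω | V 0 ω = 0} < 1)
    (hpos : 0 < μ {ω | 0 < V 0 ω ∧ V 0 ω < ⊤}) :
    ∃ C : ℝ≥0∞, C ≠ ⊤ ∧ ∀ y, ∑' n : ℕ, crossMass μ V y n * n ≤ C * ∑' a, visitMass μ V y a := by
  obtain ⟨ρ, c, hρ, hρ1, hc, hseg⟩ := exists_mul_pow_le_segmentMass hV hnz hpos
  obtain ⟨v₀, hv₀, hq⟩ := exists_measure_lt_lt (hV.meas 0) hρ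
  have hρ0 : ρ ≠ 0 := (zero_le.trans_lt hρ).ne'
  refine ⟨_, tsum_comparison_line_ne_top hq hρ1 (one_sub_expNeg_ne_zero hv₀) hc h0,
    tsum_crossMass_mul_le hV (hq.trans_le hρ1) ?_
      (fun k => mul_ne_zero (mul_ne_zero hc (pow_ne_zero _ hρ0)) h0)
      fun z k a ha b hb => le_lintegral_innerWeight_latticeBox hV hρ1 hseg ha hb⟩
  rintro y z k v ⟨w, hw, hvw⟩ b hb x
  refine (green_single_le_of_obstacle_line hv₀ hvw b x).trans ?_
  have hdist : latticeDist b w ≤ 2 * k := by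
    simpa only [one_mul] using latticeDist_le_of_mem_latticeBox hb hw
  gcongr
  exact_mod_cast hdist

end AnnealedLine

/-! ### The right derivative of the Lyapunov exponents -/

section ExponentialTilt

variable {ι : Type*}

lemma tsum_rpow_mul_rpow_le (f g : ι → ℝ≥0∞) {p q : ℝ} (hp : 0 ≤ p) (hq : 0 ≤ q)
    (hpq : p + q = 1) : ∑' i, f i ^ p * g i ^ q ≤ (∑' i, f i) ^ p * (∑' i, g i) ^ q := by
  let _ : MeasurableSpace ι := ⊤
  simp only [← lintegral_count' measurable_from_top]
  exact ENNReal.lintegral_mul_norm_pow_le measurable_from_top.aemeasurable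
    measurable_from_top.aemeasurable hp hq hpq

lemma tsum_exp_neg_combo_mul_le (w : ι → ℝ≥0∞) (x : ι → ℝ) (s t : ℝ) {p q : ℝ} (hp : 0 ≤ p)
    (hq : 0 ≤ q) (hpq : p + q = 1) :
    ∑' i, ENNReal.ofReal (Real.exp (-((p * s + q * t) * x i))) * w i ≤
      (∑' i, ENNReal.ofReal (Real.exp (-(s * x i))) * w i) ^ p *
        (∑' i, ENNReal.ofReal (Real.exp (-(t * x i))) * w i) ^ q := by
  refine (tsum_congr fun i => ?_).trans_le (tsum_rpow_mul_rpow_le _ _ hp hq hpq)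
  have hw : w i = w i ^ p * w i ^ q := by
    rw [← ENNReal.rpow_add_of_nonneg _ _ hp hq, hpq, ENNReal.rpow_one]
  have hexp : Real.exp (-((p * s + q * t) * x i)) =
      Real.exp (-(s * x i)) ^ p * Real.exp (-(t * x i)) ^ q := by
    rw [← Real.exp_mul, ← Real.exp_mul, ← Real.exp_add]
    ring_nf
  rw [ENNReal.mul_rpow_of_nonneg _ _ hp, ENNReal.mul_rpow_of_nonneg _ _ hq, mul_mul_mul_comm, ← hw,
    hexp, ENNReal.ofReal_mul (by positivity),
    ENNReal.ofReal_rpow_of_nonneg (Real.exp_nonneg _) hp,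
    ENNReal.ofReal_rpow_of_nonneg (Real.exp_nonneg _) hq]

-- The tangent line of `x ↦ exp (-t x)` at the mean is written with `t x` moved to the right, so
-- that no subtraction occurs.
lemma exp_neg_mul_tsum_le {w : ι → ℝ≥0∞} (hw : ∑' i, w i ≠ ⊤) {x : ι → ℝ} {t c : ℝ} (ht : 0 ≤ t)
    (hc : 0 ≤ c)
    (hmean : ∑' i, w i * ENNReal.ofReal (x i) ≤ ENNReal.ofReal c * ∑' i, w i) :
    ENNReal.ofReal (Real.exp (-(t * c))) * ∑' i, w i ≤
      ∑' i, ENNReal.ofReal (Real.exp (-(t * x i))) * w i := by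
  set E := Real.exp (-(t * c))
  have hE : 0 ≤ E := Real.exp_nonneg _
  have htangent : ∀ i, ENNReal.ofReal E * (1 + ENNReal.ofReal (t * c)) ≤
      ENNReal.ofReal (Real.exp (-(t * x i))) +
        ENNReal.ofReal E * (ENNReal.ofReal t * ENNReal.ofReal (x i)) := by
    intro i
    have hexp : Real.exp (-(t * x i)) = E * Real.exp (t * c - t * x i) := by
      rw [← Real.exp_add]
      ring_nf
    have hline : E * (1 + t * c) ≤ Real.exp (-(t * x i)) + E * (t * x i) := by
      rw [hexp, ← mul_add]
      exact mul_le_mul_of_nonneg_left (by linarith [Real.add_one_le_exp (t * c - t * x i)]) hE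
    rw [← ENNReal.ofReal_one, ← ENNReal.ofReal_add one_pos.le (by positivity),
      ← ENNReal.ofReal_mul ht, ← ENNReal.ofReal_mul hE, ← ENNReal.ofReal_mul hE]
    exact (ENNReal.ofReal_le_ofReal hline).trans ENNReal.ofReal_add_le
  refine (ENNReal.add_le_add_iff_right
    (a := ENNReal.ofReal E * (ENNReal.ofReal (t * c) * ∑' i, w i)) (by finiteness)).1 ?_
  calc _ = ∑' i, ENNReal.ofReal E * (1 + ENNReal.ofReal (t * c)) * w i := by
        rw [ENNReal.tsum_mul_left]
        ring
    _ ≤ ∑' i, (ENNReal.ofReal (Real.exp (-(t * x i))) * w i +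
          ENNReal.ofReal E * ENNReal.ofReal t * (w i * ENNReal.ofReal (x i))) := by
        refine ENNReal.tsum_le_tsum fun i => (mul_le_mul_left (htangent i) (w i)).trans_eq ?_
        ring
    _ ≤ _ := by
        rw [ENNReal.tsum_add, ENNReal.tsum_mul_left, ENNReal.ofReal_mul ht]
        refine add_le_add_right ((mul_le_mul_right hmean _).trans_eq ?_) _
        ring

end ExponentialTilt

lemma exists_hasDerivWithinAt_of_concaveOn {f : ℝ → ℝ} {a C : ℝ} (hf : ConcaveOn ℝ (Set.Ici a) f)
    (hslope : ∀ t, a < t → slope f a t ≤ C) :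
    ∃ D, HasDerivWithinAt f D (Set.Ici a) a ∧ D ≤ C := by
  have hanti : AntitoneOn (slope f a) (Set.Ioi a) :=
    (hf.antitoneOn_slope_gt Set.self_mem_Ici).mono fun _ h => ⟨Set.mem_Ici.2 (le_of_lt h), h⟩
  have hle : ∀ D ∈ slope f a '' Set.Ioi a, D ≤ C := Set.forall_mem_image.2 hslope
  refine ⟨sSup (slope f a '' Set.Ioi a), ?_, csSup_le (Set.nonempty_Ioi.image _) hle⟩
  rw [← hasDerivWithinAt_Ioi_iff_Ici, hasDerivWithinAt_iff_tendsto_slope' Set.self_notMem_Ioi]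
  exact hanti.tendsto_nhdsGT ⟨C, hle⟩

section ShiftedPotential

section Chain

variable {α : Type*} {p : α → PMF α} {A : Set α} {v f : α → ℝ≥0∞}

lemma killedStep_const_add (c : ℝ≥0∞) :
    killedStep p A (fun z => c + v z) f = fun x => expNeg c * killedStep p A v f x := by
  ext x
  by_cases hx : x ∈ A
  · rw [killedStep_of_mem hx, killedStep_of_mem hx, expNeg_add, mul_assoc]
  · rw [killedStep_of_notMem hx, killedStep_of_notMem hx, mul_zero]

lemma killedStep_iterate_const_add (c : ℝ≥0∞) (n : ℕ) :
    (killedStep p A fun z => c + v z)^[n] f =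
      fun x => expNeg c ^ n * (killedStep p A v)^[n] f x := by
  induction n with
  | zero => simp
  | succ n ih =>
    rw [Function.iterate_succ_apply', ih, killedStep_const_add, killedStep_const_mul]
    ext x
    rw [Function.iterate_succ_apply', pow_succ', mul_assoc]

end Chain

variable {Ω : Type*} {V : (Fin d → ℤ) → Ω → ℝ≥0∞}

lemma shiftPotential_zero : shiftPotential 0 V = V := by
  ext z ω
  simp [shiftPotential]

variable [MeasurableSpace Ω] {μ : Measure Ω} {t : ℝ}

lemma IsIIDField.shiftPotential (hV : IsIIDField μ V) (t : ℝ) :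
    IsIIDField μ (shiftPotential t V) where
  meas z := measurable_const.add (hV.meas z)
  indep := hV.indep.comp (fun _ x => ENNReal.ofReal t + x) fun _ => measurable_const_add _
  ident z := (hV.ident z).comp (measurable_const_add (ENNReal.ofReal t))

lemma measure_eq_top_lt_one [IsProbabilityMeasure μ] {f : Ω → ℝ≥0∞} (hf : Measurable f)
    (h : essInf f μ ≠ ⊤) : μ {ω | f ω = ⊤} < 1 := by
  refine lt_of_le_of_ne prob_le_one fun h1 => h ?_
  have hae : f =ᵐ[μ] fun _ => ⊤ := (mem_ae_iff_prob_eq_one (hf (measurableSet_singleton ⊤))).2 h1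
  rw [essInf_congr_ae hae, essInf_const_top]

lemma meanExp_ne_zero [IsProbabilityMeasure μ] (hV : Measurable (V 0))
    (h : μ {ω | V 0 ω = ⊤} < 1) : meanExp μ V ≠ 0 := by
  refine fun h0 => h.ne ((mem_ae_iff_prob_eq_one (hV (measurableSet_singleton ⊤))).1 ?_)
  filter_upwards [(lintegral_eq_zero_iff (measurable_expNeg.comp hV)).1 h0] with ω hω
  by_contra hne
  exact (expNeg_pos hne).ne' hω

lemma meanExp_lt_one [IsProbabilityMeasure μ] (hV : Measurable (V 0)) (h : μ {ω | V 0 ω = 0} < 1) :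
    meanExp μ V < 1 := by
  refine lt_of_le_of_ne meanExp_le_one fun h1 => h.ne ?_
  have hae : (fun ω => expNeg (V 0 ω)) =ᵐ[μ] fun _ => 1 := by
    refine ae_eq_of_ae_le_of_lintegral_le (ae_of_all _ fun ω => expNeg_le_one _)
      (ne_top_of_le_ne_top ENNReal.one_ne_top meanExp_le_one) aemeasurable_const ?_
    rw [lintegral_const, measure_univ, mul_one]
    exact h1.ge
  refine (mem_ae_iff_prob_eq_one (hV (measurableSet_singleton 0))).1 ?_
  filter_upwards [hae] with ω hω
  by_contra hne
  exact (expNeg_lt_one hne).ne hω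

lemma meanExp_shiftPotential_ne_zero (hV : Measurable (V 0)) (h0 : meanExp μ V ≠ 0) (ht : 0 ≤ t) :
    meanExp μ (shiftPotential t V) ≠ 0 := by
  have hmul : meanExp μ (shiftPotential t V) = expNeg (ENNReal.ofReal t) * meanExp μ V := by
    simp only [meanExp, shiftPotential, expNeg_add]
    exact lintegral_const_mul _ (measurable_expNeg.comp hV)
  rw [hmul, expNeg_ofReal ht]
  exact mul_ne_zero (ENNReal.ofReal_pos.2 (Real.exp_pos _)).ne' h0

variable [NeZero d]

lemma annealedZ_shiftPotential_eq_tsum (hV : IsIIDField μ V) (ht : 0 ≤ t) (y : Fin d → ℤ) :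
    annealedZ μ (shiftPotential t V) 0 y =
      ∑' n : ℕ, ENNReal.ofReal (Real.exp (-(t * n))) * crossMass μ V y n := by
  rw [annealedZ_eq_tsum_crossMass (hV.shiftPotential t).meas]
  refine tsum_congr fun n => ?_
  simp only [crossMass, shiftPotential, killedStep_iterate_const_add]
  rw [lintegral_const_mul _ (measurable_killedStep_iterate (fun z _ => hV.meas z) _ _ _),
    expNeg_ofReal ht, ← ENNReal.ofReal_pow (Real.exp_nonneg _), ← Real.exp_nat_mul]
  ring_nf

variable [IsProbabilityMeasure μ]

lemma annealedZ_shiftPotential_toReal_pos (hV : IsIIDField μ V) (h0 : meanExp μ V ≠ 0)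
    (ht : 0 ≤ t) (y : Fin d → ℤ) : 0 < (annealedZ μ (shiftPotential t V) 0 y).toReal :=
  annealedZ_toReal_pos (hV.shiftPotential t) (meanExp_shiftPotential_ne_zero (hV.meas 0) h0 ht) y

lemma tendsto_decayRate_shiftPotential (hV : IsIIDField μ V) (h0 : meanExp μ V ≠ 0) (ht : 0 ≤ t)
    (h : EuclideanSpace ℝ (Fin d)) :
    Tendsto (decayRate μ (shiftPotential t V) h) atTop
      (𝓝 (lyapunov μ (shiftPotential t V) h)) :=
  tendsto_decayRate (hV.shiftPotential t) (meanExp_shiftPotential_ne_zero (hV.meas 0) h0 ht) h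

lemma convexOn_log_annealedZ_shiftPotential (hV : IsIIDField μ V) (h0 : meanExp μ V ≠ 0)
    (y : Fin d → ℤ) :
    ConvexOn ℝ (Set.Ici 0)
      fun t => Real.log (annealedZ μ (shiftPotential t V) 0 y).toReal := by
  refine ⟨convex_Ici 0, fun s hs t ht p q hp hq hpq => ?_⟩
  have hpqst := (convex_Ici (0 : ℝ)) hs ht hp hq hpq
  have hposs := annealedZ_shiftPotential_toReal_pos hV h0 hs y
  have hpost := annealedZ_shiftPotential_toReal_pos hV h0 ht y
  have hholder : (annealedZ μ (shiftPotential (p • s + q • t) V) 0 y).toReal ≤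
      (annealedZ μ (shiftPotential s V) 0 y).toReal ^ p *
        (annealedZ μ (shiftPotential t V) 0 y).toReal ^ q := by
    rw [ENNReal.toReal_rpow, ENNReal.toReal_rpow, ← ENNReal.toReal_mul]
    refine ENNReal.toReal_mono (ENNReal.mul_ne_top
      (ENNReal.rpow_ne_top_of_nonneg hp (annealedZ_ne_top 0 y))
      (ENNReal.rpow_ne_top_of_nonneg hq (annealedZ_ne_top 0 y))) ?_
    rw [annealedZ_shiftPotential_eq_tsum hV hs, annealedZ_shiftPotential_eq_tsum hV ht,
      annealedZ_shiftPotential_eq_tsum hV hpqst]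
    exact tsum_exp_neg_combo_mul_le _ _ s t hp hq hpq
  calc _ ≤ _ := Real.log_le_log (annealedZ_shiftPotential_toReal_pos hV h0 hpqst y) hholder
    _ = _ := by
        rw [Real.log_mul (Real.rpow_pos_of_pos hposs p).ne' (Real.rpow_pos_of_pos hpost q).ne',
          Real.log_rpow hposs, Real.log_rpow hpost, smul_eq_mul, smul_eq_mul]

lemma concaveOn_lyapunov_shiftPotential (hV : IsIIDField μ V) (h0 : meanExp μ V ≠ 0)
    (h : EuclideanSpace ℝ (Fin d)) :
    ConcaveOn ℝ (Set.Ici 0) fun t => lyapunov μ (shiftPotential t V) h := by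
  refine ⟨convex_Ici 0, fun s hs t ht p q hp hq hpq => ?_⟩
  refine le_of_tendsto_of_tendsto
    (((tendsto_decayRate_shiftPotential hV h0 hs h).const_smul p).add
      ((tendsto_decayRate_shiftPotential hV h0 ht h).const_smul q))
    (tendsto_decayRate_shiftPotential hV h0 (convex_Ici (0 : ℝ) hs ht hp hq hpq) h) ?_
  filter_upwards [eventually_gt_atTop 0] with r hr
  have hlog := ((convexOn_log_annealedZ_shiftPotential hV h0 (intPart (r • h))).smul
    (one_div_pos.2 hr).le).neg.2 hs ht hp hq hpq
  simpa only [decayRate, Pi.neg_apply, smul_eq_mul, neg_mul] using hlog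

lemma log_annealedZ_sub_le (hV : IsIIDField μ V) (h0 : meanExp μ V ≠ 0) (ht : 0 ≤ t) {c : ℝ}
    (hc : 0 ≤ c) {y : Fin d → ℤ} (hy : meanCrossingTime μ V y ≤ ENNReal.ofReal c) :
    Real.log (annealedZ μ V 0 y).toReal -
      Real.log (annealedZ μ (shiftPotential t V) 0 y).toReal ≤ t * c := by
  have hZ : ∑' n, crossMass μ V y n = annealedZ μ V 0 y :=
    (annealedZ_eq_tsum_crossMass hV.meas y).symm
  have hmean : ∑' n : ℕ, crossMass μ V y n * ENNReal.ofReal n ≤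
      ENNReal.ofReal c * ∑' n, crossMass μ V y n := by
    rw [meanCrossingTime_eq hV.meas, ← ENNReal.div_eq_inv_mul, ENNReal.div_le_iff
      (annealedZ_ne_zero hV h0 y) (annealedZ_ne_top 0 y)] at hy
    simpa only [ENNReal.ofReal_natCast, hZ] using hy
  have hjensen := exp_neg_mul_tsum_le (hZ ▸ annealedZ_ne_top 0 y) ht hc hmean
  rw [hZ, ← annealedZ_shiftPotential_eq_tsum hV ht] at hjensen
  have hreal := ENNReal.toReal_mono (annealedZ_ne_top 0 y) hjensen
  rw [ENNReal.toReal_mul, ENNReal.toReal_ofReal (Real.exp_nonneg _)] at hreal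
  have hpos := annealedZ_toReal_pos hV h0 y
  have hlog := Real.log_le_log (mul_pos (Real.exp_pos _) hpos) hreal
  rw [Real.log_mul (Real.exp_ne_zero _) hpos.ne', Real.log_exp] at hlog
  linarith

end ShiftedPotential

section Norms

lemma latticeDist_zero_le_mul_latticeNorm (y : Fin d → ℤ) :
    (latticeDist 0 y : ℝ) ≤ d * latticeNorm y := by
  unfold latticeDist
  push_cast
  calc ∑ i, (((0 : Fin d → ℤ) i - y i).natAbs : ℝ) ≤ ∑ _i : Fin d, latticeNorm y := by
        refine Finset.sum_le_sum fun i _ => Eq.trans_le ?_ (PiLp.norm_apply_le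
          (WithLp.toLp 2 fun i => (y i : ℝ) : EuclideanSpace ℝ (Fin d)) i)
        simp [Nat.cast_natAbs]
    _ = d * latticeNorm y := by simp

lemma tendsto_floor_mul_div_atTop (a : ℝ) :
    Tendsto (fun r : ℝ => (⌊r * a⌋ : ℝ) / r) atTop (𝓝 a) := by
  have hlower : Tendsto (fun r : ℝ => a - r⁻¹) atTop (𝓝 a) := by
    simpa only [sub_zero] using (tendsto_const_nhds (x := a)).sub tendsto_inv_atTop_zero
  refine tendsto_of_tendsto_of_tendsto_of_le_of_le' hlower tendsto_const_nhds ?_ ?_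
  · filter_upwards [eventually_gt_atTop 0] with r hr
    rw [le_div_iff₀ hr, sub_mul, inv_mul_cancel₀ hr.ne', mul_comm]
    exact (Int.sub_one_lt_floor _).le
  · filter_upwards [eventually_gt_atTop 0] with r hr
    rw [div_le_iff₀ hr, mul_comm]
    exact Int.floor_le _

lemma tendsto_latticeNorm_intPart_div (s : EuclideanSpace ℝ (Fin d)) :
    Tendsto (fun r : ℝ => latticeNorm (intPart (r • s)) / r) atTop (𝓝 ‖s‖) := by
  have hcoord : Tendsto (fun r : ℝ => fun i => (⌊r * s i⌋ : ℝ) / r) atTop (𝓝 s.ofLp) :=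
    tendsto_pi_nhds.2 fun i => tendsto_floor_mul_div_atTop (s i)
  have hnorm := (((PiLp.continuous_toLp 2 fun _ : Fin d => ℝ).tendsto _).comp hcoord).norm
  refine hnorm.congr' ?_
  filter_upwards [eventually_gt_atTop 0] with r hr
  rw [latticeNorm, div_eq_inv_mul, ← Real.norm_of_nonneg (inv_pos.2 hr).le, ← norm_smul]
  congr 1
  ext i
  exact div_eq_inv_mul _ _

lemma tendsto_latticeNorm_intPart {s : EuclideanSpace ℝ (Fin d)} (hs : s ≠ 0) :
    Tendsto (fun r : ℝ => latticeNorm (intPart (r • s))) atTop atTop := by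
  refine ((tendsto_latticeNorm_intPart_div s).pos_mul_atTop (norm_pos_iff.2 hs)
    tendsto_id).congr' ?_
  filter_upwards [eventually_ne_atTop 0] with r hr
  exact div_mul_cancel₀ _ hr

end Norms

section CrossingTime

variable [NeZero d] {Ω : Type*} [MeasurableSpace Ω] {μ : Measure Ω} [IsProbabilityMeasure μ]
  {V : (Fin d → ℤ) → Ω → ℝ≥0∞}

lemma lyapunov_shiftPotential_sub_le (hV : IsIIDField μ V) (h0 : meanExp μ V ≠ 0) {C t : ℝ}
    (hlim : limsupCrossingTime μ V < ENNReal.ofReal C) (ht : 0 ≤ t)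
    {s : EuclideanSpace ℝ (Fin d)} (hs : s ≠ 0) :
    lyapunov μ (shiftPotential t V) s - lyapunov μ V s ≤ t * (C * ‖s‖) := by
  have hC : 0 < C := ENNReal.ofReal_pos.1 (zero_le.trans_lt hlim)
  have hnorm := tendsto_latticeNorm_intPart hs
  have hcomap : Tendsto (fun r : ℝ => intPart (r • s)) atTop (comap latticeNorm atTop) :=
    tendsto_comap_iff.2 hnorm
  refine le_of_tendsto_of_tendsto
    ((tendsto_decayRate_shiftPotential hV h0 ht s).sub (tendsto_decayRate hV h0 s))
    (((tendsto_latticeNorm_intPart_div s).const_mul C).const_mul t) ?_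
  filter_upwards [hcomap.eventually (eventually_lt_of_limsup_lt hlim), eventually_gt_atTop 0,
    hnorm.eventually_gt_atTop 0] with r hcross hr hpos
  have hmean : meanCrossingTime μ V (intPart (r • s)) ≤
      ENNReal.ofReal (C * latticeNorm (intPart (r • s))) := by
    rw [ENNReal.ofReal_mul hC.le]
    exact (ENNReal.div_le_iff (ENNReal.ofReal_pos.2 hpos).ne' ENNReal.ofReal_ne_top).1 hcross.le
  have hlog := log_annealedZ_sub_le hV h0 ht (by positivity) hmean
  unfold decayRate
  calc _ = 1 / r * (Real.log (annealedZ μ V 0 (intPart (r • s))).toReal -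
        Real.log (annealedZ μ (shiftPotential t V) 0 (intPart (r • s))).toReal) := by ring
    _ ≤ 1 / r * (t * (C * latticeNorm (intPart (r • s)))) :=
        mul_le_mul_of_nonneg_left hlog (one_div_pos.2 hr).le
    _ = _ := by ring

lemma slope_lyapunov_shiftPotential_le (hV : IsIIDField μ V) (h0 : meanExp μ V ≠ 0) {C t : ℝ}
    (hlim : limsupCrossingTime μ V ≤ ENNReal.ofReal C) (hC : 0 < C) (ht : 0 < t)
    {s : EuclideanSpace ℝ (Fin d)} (hs : ‖s‖ = 1) :
    slope (fun t => lyapunov μ (shiftPotential t V) s) 0 t ≤ C := by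
  refine le_of_forall_gt_imp_ge_of_dense fun C' hC' => ?_
  have hlim' := hlim.trans_lt ((ENNReal.ofReal_lt_ofReal_iff (hC.trans hC')).2 hC')
  have hdiff := lyapunov_shiftPotential_sub_le hV h0 hlim' ht.le
    (norm_ne_zero_iff.1 (hs ▸ one_ne_zero))
  rw [slope_def_field, shiftPotential_zero, sub_zero, div_le_iff₀' ht]
  simpa only [hs, mul_one] using hdiff

lemma exists_tsum_crossMass_mul_le (hV : IsIIDField μ V) (h0 : meanExp μ V ≠ 0)
    (hnz : μ {ω | V 0 ω = 0} < 1) (hdim1 : d = 1 → 0 < μ {ω | 0 < V 0 ω ∧ V 0 ω < ⊤}) :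
    ∃ C : ℝ≥0∞, C ≠ ⊤ ∧ ∀ y, ∑' n : ℕ, crossMass μ V y n * n ≤ C * ∑' a, visitMass μ V y a := by
  obtain rfl | hd : d = 1 ∨ 2 ≤ d := by
    have hpos := NeZero.pos d
    lia
  · exact exists_tsum_crossMass_mul_le_of_line hV h0 hnz (hdim1 rfl)
  · exact exists_tsum_crossMass_mul_le_of_two_le hd hV h0 hnz

lemma ofReal_neg_log_mul_meanCrossingTime_le (hV : IsIIDField μ V) (h0 : meanExp μ V ≠ 0)
    {C : ℝ≥0∞} {y : Fin d → ℤ}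
    (hle : ∑' n : ℕ, crossMass μ V y n * n ≤ C * ∑' a, visitMass μ V y a) :
    ENNReal.ofReal (-Real.log (meanExp μ V).toReal) * meanCrossingTime μ V y ≤
      C * ENNReal.ofReal (-Real.log (annealedZ μ V 0 y).toReal + 1) := by
  set L := ENNReal.ofReal (-Real.log (meanExp μ V).toReal)
  set Z := annealedZ μ V 0 y
  calc L * meanCrossingTime μ V y ≤ L * (Z⁻¹ * (C * ∑' a, visitMass μ V y a)) := by
        rw [meanCrossingTime_eq hV.meas]
        gcongr
    _ = Z⁻¹ * (C * (L * ∑' a, visitMass μ V y a)) := by ring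
    _ ≤ Z⁻¹ * (C * (ENNReal.ofReal (-Real.log Z.toReal + 1) * Z)) :=
        mul_le_mul_right (mul_le_mul_right (tsum_visitMass_le hV h0 y) C) _
    _ = Z⁻¹ * Z * (C * ENNReal.ofReal (-Real.log Z.toReal + 1)) := by ring
    _ = _ := by
        rw [ENNReal.inv_mul_cancel (annealedZ_ne_zero hV h0 y) (annealedZ_ne_top 0 y), one_mul]

lemma exists_neg_log_annealedZ_add_one_le (hV : IsIIDField μ V) (h0 : meanExp μ V ≠ 0) :
    ∃ K : ℝ, 0 ≤ K ∧ ∀ y, 1 ≤ latticeNorm y →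
      -Real.log (annealedZ μ V 0 y).toReal + 1 ≤ K * latticeNorm y := by
  set K := -Real.log ((2 * d : ℝ≥0∞)⁻¹ * meanExp μ V).toReal
  have hK : 0 ≤ K := neg_log_toReal_nonneg stepMass_le_one
  refine ⟨K * (d + 1) + 1, by positivity, fun y hy => ?_⟩
  have hdist : K * (latticeDist 0 y + 1) ≤ K * (d * latticeNorm y + latticeNorm y) :=
    mul_le_mul_of_nonneg_left (add_le_add (latticeDist_zero_le_mul_latticeNorm y) hy) hK
  linarith [neg_log_annealedZ_le hV h0 y]

lemma limsupCrossingTime_ne_top (hV : IsIIDField μ V) (h0 : meanExp μ V ≠ 0)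
    (hnz : μ {ω | V 0 ω = 0} < 1) (hdim1 : d = 1 → 0 < μ {ω | 0 < V 0 ω ∧ V 0 ω < ⊤}) :
    limsupCrossingTime μ V ≠ ⊤ := by
  obtain ⟨C, hC, hle⟩ := exists_tsum_crossMass_mul_le hV h0 hnz hdim1
  obtain ⟨K, hK, hlog⟩ := exists_neg_log_annealedZ_add_one_le hV h0
  set L := ENNReal.ofReal (-Real.log (meanExp μ V).toReal)
  have hL : L ≠ 0 := by
    have hlt : (meanExp μ V).toReal < 1 := by
      simpa using (ENNReal.toReal_lt_toReal (ne_top_of_le_ne_top ENNReal.one_ne_top meanExp_le_one)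
        ENNReal.one_ne_top).2 (meanExp_lt_one (hV.meas 0) hnz)
    have hpos := ENNReal.toReal_pos h0 (ne_top_of_le_ne_top ENNReal.one_ne_top meanExp_le_one)
    exact (ENNReal.ofReal_pos.2 (neg_pos.2 (Real.log_neg hpos hlt))).ne'
  refine ne_top_of_le_ne_top (b := C * ENNReal.ofReal K / L)
    (ENNReal.div_ne_top (by finiteness) hL) (limsup_le_of_le (by isBoundedDefault) ?_)
  filter_upwards [tendsto_comap.eventually_ge_atTop 1] with y hy
  rw [ENNReal.div_le_iff (ENNReal.ofReal_pos.2 (by linarith)).ne' ENNReal.ofReal_ne_top,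
    ← ENNReal.mul_div_right_comm,
    ENNReal.le_div_iff_mul_le (Or.inl hL) (Or.inl ENNReal.ofReal_ne_top), mul_comm, mul_assoc,
    ← ENNReal.ofReal_mul hK]
  exact (ofReal_neg_log_mul_meanCrossingTime_le hV h0 (hle y)).trans
    (mul_le_mul_right (ENNReal.ofReal_le_ofReal (hlog y hy)) C)

end CrossingTime

end AnnealedWalk

end

theorem corollary1p2_general {d : ℕ} [NeZero d] {Ω : Type*} [MeasurableSpace Ω]
    (μ : Measure Ω) [IsProbabilityMeasure μ]
    (V : (Fin d → ℤ) → Ω → ℝ≥0∞)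
    (hmeas : ∀ z, Measurable (V z))
    (hindep : iIndepFun V μ)
    (hident : ∀ z, IdentDistrib (V z) (V 0) μ μ)
    (hnonzero : μ {ω | V 0 ω = 0} < 1)
    (hfinite : μ {ω | V 0 ω = ⊤} < 1)
    (hdim1 : d = 1 → 0 < μ {ω | 0 < V 0 ω ∧ V 0 ω < ⊤}) :
    (∀ t : ℝ, 0 ≤ t → ∀ h : EuclideanSpace ℝ (Fin d),
      Tendsto (AnnealedWalk.decayRate μ (AnnealedWalk.shiftPotential t V) h) atTop
        (𝓝 (AnnealedWalk.lyapunov μ (AnnealedWalk.shiftPotential t V) h))) ∧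
    (∃ C : ℝ, 0 < C ∧ AnnealedWalk.limsupCrossingTime μ V ≤ ENNReal.ofReal C) ∧
    ∀ C : ℝ, 0 < C → AnnealedWalk.limsupCrossingTime μ V ≤ ENNReal.ofReal C →
      ∀ s : EuclideanSpace ℝ (Fin d), ‖s‖ = 1 →
        ∃ D : ℝ,
          HasDerivWithinAt
            (fun t : ℝ => AnnealedWalk.lyapunov μ (AnnealedWalk.shiftPotential t V) s)
            D (Set.Ici 0) 0 ∧
          D ≤ C := by
  have hV : AnnealedWalk.IsIIDField μ V := ⟨hmeas, hindep, hident⟩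
  have h0 : AnnealedWalk.meanExp μ V ≠ 0 := AnnealedWalk.meanExp_ne_zero (hmeas 0) hfinite
  have hlim := AnnealedWalk.limsupCrossingTime_ne_top hV h0 hnonzero hdim1
  refine ⟨fun t ht h => AnnealedWalk.tendsto_decayRate_shiftPotential hV h0 ht h,
    ⟨(AnnealedWalk.limsupCrossingTime μ V).toReal + 1, by positivity,
      ENNReal.le_ofReal_iff_toReal_le hlim (by positivity) |>.2 (by linarith)⟩,
    fun C hC hle s hs => ?_⟩
  exact AnnealedWalk.exists_hasDerivWithinAt_of_concaveOn
    (AnnealedWalk.concaveOn_lyapunov_shiftPotential hV h0 s)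
    fun t ht => AnnealedWalk.slope_lyapunov_shiftPotential_le hV h0 hle hC ht hs

theorem corollary1p2 {d : ℕ} [NeZero d] {Ω : Type*} [MeasurableSpace Ω]
    (μ : Measure Ω) [IsProbabilityMeasure μ]
    (V : (Fin d → ℤ) → Ω → ℝ≥0∞)
    (hmeas : ∀ z, Measurable (V z))
    (hindep : iIndepFun V μ)
    (hident : ∀ z, IdentDistrib (V z) (V 0) μ μ)
    (hnonzero : μ {ω | V 0 ω = 0} < 1)
    (hessInf : essInf (V 0) μ = 0)
    (hdim1 : d = 1 → 0 < μ {ω | 0 < V 0 ω ∧ V 0 ω < ⊤}) :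
    -- the Lyapunov exponents of all the potentials `t + V`, `t ≥ 0`, are genuine limits
    (∀ t : ℝ, 0 ≤ t → ∀ h : EuclideanSpace ℝ (Fin d),
      Tendsto (AnnealedWalk.decayRate μ (AnnealedWalk.shiftPotential t V) h) atTop
        (𝓝 (AnnealedWalk.lyapunov μ (AnnealedWalk.shiftPotential t V) h))) ∧
    -- there is a constant bounding the normalized expected crossing time
    (∃ C : ℝ, 0 < C ∧ AnnealedWalk.limsupCrossingTime μ V ≤ ENNReal.ofReal C) ∧
    -- every such constant bounds the right derivative at `0`, which exists, in every direction
    ∀ C : ℝ, 0 < C → AnnealedWalk.limsupCrossingTime μ V ≤ ENNReal.ofReal C →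
      ∀ s : EuclideanSpace ℝ (Fin d), ‖s‖ = 1 →
        ∃ D : ℝ,
          HasDerivWithinAt
            (fun t : ℝ => AnnealedWalk.lyapunov μ (AnnealedWalk.shiftPotential t V) s)
            D (Set.Ici 0) 0 ∧
          D ≤ C := by
  have hfinite := AnnealedWalk.measure_eq_top_lt_one (hmeas 0) (hessInf ▸ ENNReal.zero_ne_top)
  exact corollary1p2_general μ V hmeas hindep hident hnonzero hfinite hdim1
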